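/- **Setting.** Let $d\ge 1$, $k\ge 0$ be integers. Write $x=(u,v)\in\mathbb{R}^d$ with $u\in\mathbb{R}^{d-1}$, $v\in\mathbb{R}$, and $\mathbf e_d=(0,1)$. Let $D\subset\mathbb{R}^d$ be a *rotund* set: open, bounded, strictly convex (its closure is strictly convex), containing the origin, with gauge function $\gamma(x)=\inf\{\alpha\ge 0: x\in\alpha D\}$ of class $C^2$ outside the origin and with the Hessian of $\gamma^2$ positive definite outside the origin. Let $\zeta_D(u)=\sup_{x\in D}\langle x,u\rangle$, and for a unit vector $\theta\in S^{d-1}$ let $H(\theta)=\{x:\langle\theta,x\rangle\ge\zeta_D(\theta)\}$ and $p(\theta)=\nabla\zeta_D(\theta)$. An *initial transformation* for $\theta$ is an invertible linear map $A$ of $\mathbb{R}^d$ with $A(\mathbf e_d)=p(\theta)$, $A(\{v\ge 1\})=H(\theta)$ and $\gamma(A(u,1))-\gamma(A(\mathbf e_d))\sim\|u\|^2/2$ as $u\to 0$; put $z_D(\theta)=|\det A|$. Let $f=g\circ\gamma$ be a probability density on $\mathbb{R}^d$, where $g=Ce^{-\psi}$, $C>0$, and $\psi:[0,\infty)\to\mathbb{R}$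 is continuous, $C^2$ on $(0,\infty)$, with $\psi'>0$ on $(0,\infty)$, $\psi(t)\to\infty$ and $(1/\psi')'(t)\to 0$ as $t\to\infty$. Let $a=1/\psi'$, let $t_n>0$ with $t_n\to\infty$ and $a(t_n)\to\xi\in(0,\infty]$ (with $\xi^{-1}=0$ if $\xi=\infty$), let $r_n>0$ with $r_n\to r\in[0,\infty)$, and let $q_n=(a(t_n)t_n)^{(d-1)/2}a(t_n)$. Let $h^k_s:(\mathbb{R}^d)^{k+1}\to[0,\infty)$, $s\ge 0$, be symmetric measurable functions such that: $h^k_s$ is translation invariant; there is $\kappa$ such that $h^k_1(x_0,\dots,x_k)>0$ implies $\mathrm{diam}\{x_0,\dots,x_k\}\le\kappa$; $h^k_s(cx_0,\dots,cx_k)=h^k_{s/c}(x_0,\dots,x_k)$ for $c>0$; and there is $M<\infty$ with $h^k_s\le M$ for all $s\ge 0$. Let $\mathcal P_n$ be a Poisson process on $\mathbb{R}^d$ with intensity $nf$ and $$S_{k,n}(\theta)=\frac1{(k+1)!}\sum h^k_{r_n}(x_0,\dots,x_k),$$ the sum being over all $(k+1)$-tuples of distinct points of $\mathcal P_n\cap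 t_nH(\theta)$. For $1\le\ell\le k+1$ let $y_0=0$ and $$\begin{aligned}\mathcal I_{k,\ell}=z_D(\theta)\int_{(\mathbb{R}^d)^{2k+2-\ell}}& h^k_1(0,y_1,\dots,y_{\ell-1},y_\ell,\dots,y_k)\,h^k_1(0,y_1,\dots,y_{\ell-1},y_{k+1},\dots,y_{2k+1-\ell})\,\mathbf 1\{v\ge 0\}\prod_{i=1}^{2k+1-\ell}\mathbf 1\{v\ge -r\xi^{-1}\langle A^{-1}(y_i),\mathbf e_d\rangle\}\\ &\times\exp\Big\{-(2k+2-\ell)\big(\|u\|^2/2+v\big)-r\xi^{-1}\sum_{i=1}^{2k+1-\ell}\langle\nabla\gamma(p(\theta)),y_i\rangle\Big\}\,dx\,dy_1\cdots dy_{2k+1-\ell},\qquad x=(u,v).\end{aligned}$$ (In the two kernels the first $\ell$ points $y_0,\dots,y_{\ell-1}$ are common; for $\ell=k+1$ both kernels are $h^k_1(0,y_1,\dots,y_k)$.) **Statement.** The variables $S_{k,n}(\theta)$ have finite second moments, and for every $\theta\in S^{d-1}$ and every initial transformation $A$ for $\theta$, $$\lim_{n\to\infty}\frac{\mathbb E[S_{k,n}(\theta)]}{[ng(t_n)]^{k+1}r_n^{dk}q_n}=\frac{[2\pi/(k+1)]^{(d-1)/2}z_D(\theta)}{(k+1)!}\int_{(\mathbb{R}^d)^k}\int_0^\infty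 h^k_1(0,\mathbf y)\prod_{i=1}^k\mathbf 1\{v\ge -r\xi^{-1}\langle A^{-1}(y_i),\mathbf e_d\rangle\}\exp\Big\{-(k+1)v-r\xi^{-1}\sum_{i=1}^k\langle\nabla\gamma(p(\theta)),y_i\rangle\Big\}\,dv\,d\mathbf y .$$ Let $\tau_{k,n}=[ng(t_n)]^{k+1}r_n^{dk}q_n$ if $ng(t_n)r_n^d\to 0$; $\tau_{k,n}=ng(t_n)q_n$ if $ng(t_n)r_n^d\to\chi\in(0,\infty)$; and $\tau_{k,n}=[ng(t_n)]^{2k+1}r_n^{2dk}q_n$ if $ng(t_n)r_n^d\to\infty$. Then $$\lim_{n\to\infty}\tau_{k,n}^{-1}\mathrm{Var}(S_{k,n}(\theta))=\begin{cases}\dfrac{\mathcal I_{k,k+1}}{(k+1)!}&\text{if } ng(t_n)r_n^d\to 0,\\[2mm] \displaystyle\sum_{\ell=1}^{k+1}\frac{\chi^{2k+1-\ell}\,\mathcal I_{k,\ell}}{\ell!\,((k+1-\ell)!)^2}&\text{if } ng(t_n)r_n^d\to\chi\in(0,\infty),\\[2mm] \dfrac{\mathcal I_{k,1}}{(k!)^2}&\text{if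 } ng(t_n)r_n^d\to\infty.\end{cases}$$ Furthermore, in each of the three regimes, if $\theta_1,\theta_2\in S^{d-1}$ and $\theta_1\ne\pm\theta_2$, then $\lim_{n\to\infty}\tau_{k,n}^{-1}\mathrm{Cov}(S_{k,n}(\theta_1),S_{k,n}(\theta_2))=0$. If $\theta_1=-\theta_2$, then $\mathrm{Cov}(S_{k,n}(\theta_1),S_{k,n}(\theta_2))=0$ for all $n$. -/

import Mathlib

open MeasureTheory ProbabilityTheory Filter Set
open scoped Topology ENNReal NNReal Pointwise Nat Asymptotics

noncomputable section

/-- Euclidean space of dimension `d`. -/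
abbrev Euc (d : ℕ) : Type := EuclideanSpace ℝ (Fin d)

namespace Extremes

/-! ### Convex geometry -/

/-- The support function `ζ_D(u) = sup {⟨x, u⟩ : x ∈ D}`. -/
def supportFun {d : ℕ} (D : Set (Euc d)) (u : Euc d) : ℝ :=
  sSup ((fun x : Euc d => inner ℝ x u) '' D)

/-- The outer support halfspace `H(θ) = {x : ⟨θ, x⟩ ≥ ζ_D(θ)}`. -/
def supportHalfspace {d : ℕ} (D : Set (Euc d)) (θ : Euc d) : Set (Euc d) :=
  {x | supportFun D θ ≤ inner ℝ θ x}

/-- The support point `p(θ) = ∇ζ_D(θ)`. -/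
def supportPoint {d : ℕ} (D : Set (Euc d)) (θ : Euc d) : Euc d :=
  gradient (supportFun D) θ

/-- Rotund sets. Strict convexity is imposed on the closure, since for an open set
Mathlib's `StrictConvex` only says that the set is convex. -/
structure IsRotund {d : ℕ} (D : Set (Euc d)) : Prop where
  isOpen : IsOpen D
  isBounded : Bornology.IsBounded D
  convex : Convex ℝ D
  strictConvex_closure : StrictConvex ℝ (closure D)
  zero_mem : (0 : Euc d) ∈ D
  contDiffOn_gauge : ContDiffOn ℝ 2 (gauge D) {0}ᶜ
  hessian_pos : ∀ x : Euc d, x ≠ 0 → ∀ w : Euc d, w ≠ 0 →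
    0 < fderiv ℝ (fderiv ℝ (fun y : Euc d => gauge D y ^ 2)) x w w

/-- The point `(u, v)` of `ℝ^{m+1}` with `u ∈ ℝ^m` and vertical coordinate `v`. -/
def joinPt {m : ℕ} (u : Euc m) (v : ℝ) : Euc (m + 1) :=
  WithLp.toLp 2 (Fin.snoc (α := fun _ => ℝ) (fun i => u i) v)

/-- The vertical coordinate `v = ⟨x, e_d⟩` of `x = (u, v)`. -/
def vert {m : ℕ} (x : Euc (m + 1)) : ℝ := x (Fin.last m)

/-- The squared norm `‖u‖²` of the horizontal part of `x = (u, v)`. -/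
def horizSq {m : ℕ} (x : Euc (m + 1)) : ℝ := ∑ i : Fin m, x (Fin.castSucc i) ^ 2

/-- `A` is an initial transformation of `D` at the angle `θ`. -/
structure IsInitialTransformation {m : ℕ} (D : Set (Euc (m + 1))) (θ : Euc (m + 1))
    (A : Euc (m + 1) ≃ₗ[ℝ] Euc (m + 1)) : Prop where
  map_axis : A (joinPt 0 1) = supportPoint D θ
  map_halfspace : A '' {x | 1 ≤ vert x} = supportHalfspace D θ
  initial_position :
    Asymptotics.IsEquivalent (𝓝 (0 : Euc m))
      (fun u => gauge D (A (joinPt u 1)) - gauge D (A (joinPt 0 1)))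
      (fun u => ‖u‖ ^ 2 / 2)

/-- `z_D(θ) = |det A|`. -/
def zConst {m : ℕ} (A : Euc (m + 1) ≃ₗ[ℝ] Euc (m + 1)) : ℝ :=
  |LinearMap.det (A : Euc (m + 1) →ₗ[ℝ] Euc (m + 1))|

/-! ### Light-tailed densities -/

/-- Von Mises functions `ψ` on `[0, ∞)`. -/
structure IsVonMises (ψ : ℝ → ℝ) : Prop where
  continuousOn : ContinuousOn ψ (Ici 0)
  contDiffOn : ContDiffOn ℝ 2 ψ (Ioi 0)
  deriv_pos : ∀ t : ℝ, 0 < t → 0 < deriv ψ t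
  tendsto_atTop : Tendsto ψ atTop atTop
  tendsto_deriv : Tendsto (deriv fun t => (deriv ψ t)⁻¹) atTop (𝓝 0)

/-- The auxiliary function `a = 1 / ψ'`. -/
def aux (ψ : ℝ → ℝ) (t : ℝ) : ℝ := (deriv ψ t)⁻¹

/-- The density generator `g = C e^{-ψ}`. -/
def generator (C : ℝ) (ψ : ℝ → ℝ) (t : ℝ) : ℝ := C * Real.exp (-ψ t)

/-- The homothetic function `f = g ∘ γ_D`. -/
def homDensity {d : ℕ} (D : Set (Euc d)) (C : ℝ) (ψ : ℝ → ℝ) (x : Euc d) : ℝ :=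
  generator C ψ (gauge D x)

/-- `q(t) = (a(t) t)^{(d-1)/2} a(t)` in dimension `d = m + 1`. -/
def qFun (m : ℕ) (ψ : ℝ → ℝ) (t : ℝ) : ℝ :=
  (aux ψ t * t) ^ ((m : ℝ) / 2) * aux ψ t

/-! ### Poisson processes -/

/-- The random countable set `P` is a Poisson process with intensity measure `ν`: the number of
points in a measurable set `B` is Poisson distributed with mean `ν B` (and almost surely infinite
if `ν B = ∞`), and the numbers of points in disjoint sets are independent. -/
structure IsPoissonProcess {Ω E : Type*} [MeasurableSpace Ω] [MeasurableSpace E]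
    (P : Ω → Set E) (ν : Measure E) (Pr : Measure Ω) : Prop where
  countable : ∀ ω, (P ω).Countable
  measurable_count : ∀ B : Set E, MeasurableSet B → Measurable fun ω => (P ω ∩ B).encard
  law_count : ∀ B : Set E, MeasurableSet B → ν B ≠ ∞ → ∀ j : ℕ,
    Pr {ω | (P ω ∩ B).encard = j} = poissonMeasure (ν B).toNNReal {j}
  law_count_top : ∀ B : Set E, MeasurableSet B → ν B = ∞ → ∀ᵐ ω ∂Pr, (P ω ∩ B).encard = ⊤
  indep : ∀ (j : ℕ) (B : Fin j → Set E), (∀ i, MeasurableSet (B i)) →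
    (Pairwise fun i i' => Disjoint (B i) (B i')) →
    iIndepFun (fun i ω => (P ω ∩ B i).encard) Pr

/-! ### Local U-statistics -/

/-- The kernels `h = (h_r)_{r ≥ 0}` of order `k + 1`. -/
structure IsLocalKernel {d : ℕ} (k : ℕ) (h : ℝ → (Fin (k + 1) → Euc d) → ℝ) : Prop where
  nonneg : ∀ r, 0 ≤ r → ∀ x, 0 ≤ h r x
  measurable : ∀ r, 0 ≤ r → Measurable (h r)
  symm : ∀ r, 0 ≤ r → ∀ (σ : Equiv.Perm (Fin (k + 1))) (x), h r (x ∘ σ) = h r x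
  translation : ∀ r, 0 ≤ r → ∀ (y : Euc d) (x), h r (fun i => x i + y) = h r x
  localized : ∃ κ : ℝ, ∀ x, 0 < h 1 x → Metric.diam (range x) ≤ κ
  scaling : ∀ r, 0 ≤ r → ∀ s, 0 < s → ∀ x, h r (fun i => s • x i) = h (r / s) x
  bounded : ∃ M : ℝ, ∀ r, 0 ≤ r → ∀ x, h r x ≤ M

/-- The U-statistic of the point set `X`: `1/(k+1)!` times the sum of the kernel over all
`(k+1)`-tuples of distinct points of `X` (used for finite `X`). -/
def uStat {d : ℕ} (k : ℕ) (h : (Fin (k + 1) → Euc d) → ℝ) (X : Set (Euc d)) : ℝ :=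
  ((k + 1)! : ℝ)⁻¹ *
    ∑' x : {x : Fin (k + 1) → Euc d // Function.Injective x ∧ ∀ i, x i ∈ X}, h x.1

/-! ### Limits -/

/-- The limit of the normalized expectation; `c` stands for `r ξ⁻¹`. -/
def meanLimit {m : ℕ} (k : ℕ) (h : ℝ → (Fin (k + 1) → Euc (m + 1)) → ℝ)
    (D : Set (Euc (m + 1))) (θ : Euc (m + 1)) (A : Euc (m + 1) ≃ₗ[ℝ] Euc (m + 1)) (c : ℝ) : ℝ :=
  (2 * Real.pi / (k + 1)) ^ ((m : ℝ) / 2) * zConst A / (k + 1)! *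
    ∫ y : Fin k → Euc (m + 1), ∫ v in Ioi (0 : ℝ),
      h 1 (Fin.cons (α := fun _ => Euc (m + 1)) 0 y) *
      (∏ i, if -c * vert (A.symm (y i)) ≤ v then (1 : ℝ) else 0) *
      Real.exp (-(k + 1) * v - c * ∑ i, inner ℝ (gradient (gauge D) (supportPoint D θ)) (y i))

/-- The points `y_0 = 0, y_1, …, y_N`, for `y = (y_1, …, y_N)`. -/
def vertexPt {d N : ℕ} (y : Fin N → Euc d) (i : ℕ) : Euc d :=
  if hi : 0 < i ∧ i ≤ N then y ⟨i - 1, by omega⟩ else 0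

/-- The integral `I_{k,ℓ}`, for `1 ≤ ℓ ≤ k + 1`; `c` stands for `r ξ⁻¹`. The two kernels share the
points `0, y_1, …, y_{ℓ-1}`; the first one has in addition `y_ℓ, …, y_k` and the second one
`y_{k+1}, …, y_{2k+1-ℓ}`. -/
def varIntegral {m : ℕ} (k ℓ : ℕ) (h : ℝ → (Fin (k + 1) → Euc (m + 1)) → ℝ)
    (D : Set (Euc (m + 1))) (θ : Euc (m + 1)) (A : Euc (m + 1) ≃ₗ[ℝ] Euc (m + 1)) (c : ℝ) : ℝ :=
  zConst A *
    ∫ p : Euc (m + 1) × (Fin (2 * k + 1 - ℓ) → Euc (m + 1)),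
      h 1 (fun i => vertexPt p.2 i) *
      h 1 (fun i => vertexPt p.2 (if (i : ℕ) < ℓ then (i : ℕ) else i + (k + 1 - ℓ))) *
      (if 0 ≤ vert p.1 then (1 : ℝ) else 0) *
      (∏ i, if -c * vert (A.symm (p.2 i)) ≤ vert p.1 then (1 : ℝ) else 0) *
      Real.exp (-(2 * k + 2 - ℓ) * (horizSq p.1 / 2 + vert p.1) -
        c * ∑ i, inner ℝ (gradient (gauge D) (supportPoint D θ)) (p.2 i))

end Extremes

end

/-! The moments of a Poisson U-statistic are exact integrals. By the multivariate Mecke formula, the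
expected sum of a kernel over injective tuples of points is its integral against the product of the
intensity measure. A product of two such sums splits according to how the two tuples overlap
(`tsum_embedding_mul_tsum_embedding`). The pairs without common points give the product of the
means, so the covariance is the sum over `1 ≤ ℓ ≤ k + 1` of the overlap integrals with `ℓ` common
points, with weights `1/(ℓ! ((k+1-ℓ)!)²)` (`IsLocalKernel.covariance_uStat`).

The mean and the overlap integrals are cluster integrals over `N + 1` points, with `N = k` and `N =
2k + 1 - ℓ` respectively: the kernel forces all points to lie within distance `O(r_n)` of the first
one. Writing the first point as `A(√(a t) u, t + a v)` and the others as the first plus `r_n y_i`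
produces the Jacobian `z_D(θ) q_n r_n^{dN}`, and the densities contribute `(n g(t_n))^{N+1}` times a
normalized integrand (`integral_cluster_eq`). Since `a' → 0`, one has `ψ(t + a s) - ψ(t) → s`. The
rescaled excess `(γ - t)/a` of a cluster point tends to `‖u‖²/2 + v + c ⟨∇γ(p), y⟩`, where `c = r
ξ⁻¹` is the limit of `r_n / a(t_n)`. Hence the integrand converges almost everywhere. It is
dominated because `a' → 0` also gives the generator tails of every polynomial order, uniformly in
`t`, while convexity makes the excess grow at least linearly. Dominated convergence identifies the
limits.

Two consecutive values of `ℓ` differ in order by the factor `ν_n = n g(t_n) r_n^d`, so the limit of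
`ν_n` decides which overlaps survive in the variance.

At two different angles the common point of the tuples lies in both halfspaces. Differentiability of
the gauge and compactness force the gauge there to be at least `(1 + δ) t_n`
(`IsRotund.exists_one_add_le_gauge`). The mass of the density so far out is smaller than `g(t_n)
q_n` by a factor `O(a(t_n)/t_n)` (`exists_tail_bound`), and every normalized overlap tends to zero.
Halfspaces at opposite angles are disjoint, so all overlaps vanish identically. -/

namespace Extremes

/-! ### Pairs of injective tuples and their overlap -/

/-- The second of two overlapping tuples: its entries with index in `T` are shared with the first
tuple by means of `e`, the others are new. -/
def overlapEmb {ι : Type*} [DecidableEq ι] (T : Finset ι) (e : T ↪ ι) :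
    ι ↪ ι ⊕ {j // j ∉ T} where
  toFun j := if hj : j ∈ T then Sum.inl (e ⟨j, hj⟩) else Sum.inr ⟨j, hj⟩
  inj' := by
    intro i j hij
    dsimp only at hij
    split_ifs at hij with h1 h2 h2
    · simpa using hij
    · simpa using hij

theorem overlapEmb_of_mem {ι : Type*} [DecidableEq ι] {T : Finset ι} (e : T ↪ ι) {j : ι}
    (hj : j ∈ T) : overlapEmb T e j = Sum.inl (e ⟨j, hj⟩) := dif_pos hj

theorem overlapEmb_of_notMem {ι : Type*} [DecidableEq ι] {T : Finset ι} (e : T ↪ ι) {j : ι}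
    (hj : j ∉ T) : overlapEmb T e j = Sum.inr ⟨j, hj⟩ := dif_neg hj

/-- A tuple indexed by an overlap pattern determines two injective tuples. -/
def overlapPair {ι A : Type*} [DecidableEq ι]
    (p : Σ T : Finset ι, Σ _ : T ↪ ι, (ι ⊕ {j // j ∉ T}) ↪ A) : (ι ↪ A) × (ι ↪ A) :=
  (Function.Embedding.inl.trans p.2.2, (overlapEmb p.1 p.2.1).trans p.2.2)

/-- The pattern can be read off from a pair of tuples: `T` is the set of indices at which the second
tuple hits the range of the first, `e` records where, and `z` lists the first tuple followed by the
new entries of the second. -/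
theorem overlapPair_bijective {ι A : Type*} [DecidableEq ι] [Fintype ι] :
    Function.Bijective (overlapPair (ι := ι) (A := A)) := by
  constructor
  · rintro ⟨T, e, z⟩ ⟨T', e', z'⟩ h
    have h1 : ∀ i, z (Sum.inl i) = z' (Sum.inl i) := fun i =>
      DFunLike.congr_fun (congrArg Prod.fst h) i
    have h2 : ∀ j, z (overlapEmb T e j) = z' (overlapEmb T' e' j) := fun j =>
      DFunLike.congr_fun (congrArg Prod.snd h) j
    have key : ∀ (T : Finset ι) (e : T ↪ ι) (z : (ι ⊕ {j // j ∉ T}) ↪ A) (j : ι),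
        j ∈ T ↔ ∃ i, z (Sum.inl i) = z (overlapEmb T e j) := by
      intro T e z j
      constructor
      · intro hj
        exact ⟨e ⟨j, hj⟩, by rw [overlapEmb_of_mem e hj]⟩
      · rintro ⟨i, hi⟩
        by_contra hj
        rw [overlapEmb_of_notMem e hj] at hi
        simpa using z.injective hi
    have hT : T = T' := by
      ext j
      rw [key T e z, key T' e' z']
      simp only [h1, h2]
    subst hT
    have he : e = e' := by
      ext ⟨j, hj⟩
      have := h2 j
      rw [overlapEmb_of_mem e hj, overlapEmb_of_mem e' hj, h1] at this
      simpa using z'.injective this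
    subst he
    have hz : z = z' := by
      ext x
      rcases x with i | ⟨j, hj⟩
      · exact h1 i
      · have := h2 j
        rwa [overlapEmb_of_notMem e hj] at this
    subst hz
    rfl
  · rintro ⟨x, y⟩
    classical
    let T : Finset ι := Finset.univ.filter fun j => ∃ i, x i = y j
    have hT : ∀ j : T, ∃ i, x i = y j := fun j => (Finset.mem_filter.1 j.2).2
    choose e he using hT
    have heinj : Function.Injective e := by
      intro j j' hjj
      have := he j
      rw [hjj, he j'] at this
      exact Subtype.ext (y.injective this).symm
    let z : (ι ⊕ {j // j ∉ T}) ↪ A :=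
      ⟨Sum.elim x fun j => y j, by
        apply Function.Injective.sumElim x.injective
        · exact fun a b hab => Subtype.ext (y.injective hab)
        · intro i j hij
          exact j.2 (Finset.mem_filter.2 ⟨Finset.mem_univ _, i, hij⟩)⟩
    refine ⟨⟨T, ⟨e, heinj⟩, z⟩, ?_⟩
    refine Prod.ext ?_ ?_
    · ext i; rfl
    · ext j
      change z (overlapEmb T ⟨e, heinj⟩ j) = y j
      by_cases hj : j ∈ T
      · rw [overlapEmb_of_mem _ hj]; exact he ⟨j, hj⟩
      · rw [overlapEmb_of_notMem _ hj]; rfl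

/-- This makes a product of two sums over tuples a finite combination of single sums over longer
injective tuples, to which the Mecke formula applies. -/
theorem tsum_embedding_mul_tsum_embedding {ι A : Type*} [DecidableEq ι] [Fintype ι]
    (F G : (ι → A) → ℝ≥0∞) :
    (∑' x : ι ↪ A, F x) * (∑' y : ι ↪ A, G y) =
      ∑ T : Finset ι, ∑ e : T ↪ ι, ∑' z : (ι ⊕ {j // j ∉ T}) ↪ A,
        F (z ∘ Sum.inl) * G (z ∘ overlapEmb T e) := by
  classical
  have h1 : (∑' x : ι ↪ A, F x) * (∑' y : ι ↪ A, G y) =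
      ∑' p : (ι ↪ A) × (ι ↪ A), F p.1 * G p.2 := by
    rw [ENNReal.tsum_prod (f := fun x y : ι ↪ A => F x * G y), ← ENNReal.tsum_mul_right]
    simp only [ENNReal.tsum_mul_left]
  rw [h1, ← (Equiv.ofBijective _ (overlapPair_bijective (ι := ι) (A := A))).tsum_eq,
    ENNReal.tsum_sigma', tsum_fintype]
  refine Finset.sum_congr rfl fun T _ => ?_
  rw [ENNReal.tsum_sigma', tsum_fintype]
  rfl

/-! ### Integrals over finite powers -/

theorem lintegral_pi_comp_equiv {E ι ι' : Type*} [MeasurableSpace E] [Fintype ι] [Fintype ι']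
    (ν : Measure E) [SigmaFinite ν] (F : ι ≃ ι') (f : (ι → E) → ℝ≥0∞) :
    ∫⁻ w : ι' → E, f (w ∘ F) ∂(Measure.pi fun _ => ν) =
      ∫⁻ z, f z ∂(Measure.pi fun _ => ν) := by
  have h := measurePreserving_piCongrLeft (α := fun _ : ι => E) (fun _ => ν) F.symm
  rw [← h.lintegral_comp_emb (MeasurableEquiv.measurableEmbedding _)]
  refine lintegral_congr fun w => ?_
  congr 1
  ext i
  have := Equiv.piCongrLeft_apply_apply (fun _ : ι => E) F.symm w (F i)
  rw [Equiv.symm_apply_apply] at this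
  exact this.symm

/-- The first index map in the overlap of two `(k+1)`-tuples with `ℓ` common entries. -/
def fstIdx (k ℓ : ℕ) (i : Fin (k + 1)) : Fin (2 * k + 1 - ℓ + 1) :=
  Fin.ofNat _ i

/-- The second index map in the overlap of two `(k+1)`-tuples with `ℓ` common entries. -/
def sndIdx (k ℓ : ℕ) (i : Fin (k + 1)) : Fin (2 * k + 1 - ℓ + 1) :=
  Fin.ofNat _ (if (i : ℕ) < ℓ then (i : ℕ) else i + (k + 1 - ℓ))

/-- `Fin.ofNat` reduces modulo the number of points; for `ℓ ≤ k + 1` the reduction does nothing. -/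
theorem val_fstIdx {k ℓ : ℕ} (hℓ : ℓ ≤ k + 1) (i : Fin (k + 1)) :
    (fstIdx k ℓ i : ℕ) = i := by
  have := i.2
  simp only [fstIdx, Fin.ofNat]
  exact Nat.mod_eq_of_lt (by omega)

theorem val_sndIdx {k ℓ : ℕ} (hℓ : ℓ ≤ k + 1) (i : Fin (k + 1)) :
    (sndIdx k ℓ i : ℕ) = if (i : ℕ) < ℓ then (i : ℕ) else i + (k + 1 - ℓ) := by
  have := i.2
  simp only [sndIdx, Fin.ofNat]
  exact Nat.mod_eq_of_lt (by split_ifs <;> omega)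

/-- Only the number of shared entries matters: the kernels are symmetric and the product measure
does not see the labels, so the indices can be permuted until the first `ℓ` entries of both tuples
are the shared ones. -/
theorem lintegral_overlap_eq {E : Type*} [MeasurableSpace E] (ν : Measure E) [SigmaFinite ν]
    {k : ℕ} (f g : (Fin (k + 1) → E) → ℝ≥0∞)
    (hf : ∀ (σ : Equiv.Perm (Fin (k + 1))) x, f (x ∘ σ) = f x)
    (hg : ∀ (σ : Equiv.Perm (Fin (k + 1))) x, g (x ∘ σ) = g x)
    (T : Finset (Fin (k + 1))) (e : T ↪ Fin (k + 1)) :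
    ∫⁻ z : Fin (k + 1) ⊕ {j // j ∉ T} → E, f (z ∘ Sum.inl) * g (z ∘ overlapEmb T e)
        ∂(Measure.pi fun _ => ν) =
      ∫⁻ w : Fin (2 * k + 1 - T.card + 1) → E,
        f (w ∘ fstIdx k T.card) * g (w ∘ sndIdx k T.card) ∂(Measure.pi fun _ => ν) := by
  classical
  set ℓ := T.card with hℓdef
  have hℓ : ℓ ≤ k + 1 := by simpa using Finset.card_le_univ T
  -- a permutation moving `T` to the first `ℓ` indices
  have hcard : (Finset.univ.filter fun i : Fin (k + 1) => (i : ℕ) < ℓ).card = ℓ := by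
    rw [Fin.card_filter_val_lt]; omega
  have e1 : {j // j ∈ T} ≃ {i : Fin (k + 1) // (i : ℕ) < ℓ} := by
    refine Fintype.equivOfCardEq ?_
    rw [Fintype.card_coe, Fintype.card_subtype, hcard]
  let τ : Equiv.Perm (Fin (k + 1)) := e1.extendSubtype
  have hτ : ∀ j, j ∈ T ↔ (τ j : ℕ) < ℓ := by
    intro j
    constructor
    · intro hj; exact e1.extendSubtype_mem j hj
    · intro h
      by_contra hj
      exact e1.extendSubtype_not_mem j hj h
  -- `σ` relabels the first tuple so that a shared entry gets the label that `τ` gives it in the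
  -- second tuple.
  let e2 : {i // i ∈ Set.range e} ≃ {i : Fin (k + 1) // (i : ℕ) < ℓ} :=
    (Equiv.ofInjective e e.injective).symm.trans e1
  let σ : Equiv.Perm (Fin (k + 1)) := e2.extendSubtype
  have hσ : ∀ j (hj : j ∈ T), σ (e ⟨j, hj⟩) = τ j := by
    intro j hj
    have h1 : σ (e ⟨j, hj⟩) = e2 ⟨e ⟨j, hj⟩, ⟨_, rfl⟩⟩ := e2.extendSubtype_apply_of_mem _ ⟨_, rfl⟩
    have h2 : τ j = e1 ⟨j, hj⟩ := e1.extendSubtype_apply_of_mem _ hj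
    rw [h1, h2]
    simp [e2]
  let F0 : Fin (k + 1) ⊕ {j // j ∉ T} → Fin (2 * k + 1 - ℓ + 1) :=
    Sum.elim (fun i => fstIdx k ℓ (σ i)) fun j => sndIdx k ℓ (τ j)
  have hF0 : Function.Injective F0 := by
    apply Function.Injective.sumElim
    · intro i j hij
      have := congrArg Fin.val hij
      rw [val_fstIdx hℓ, val_fstIdx hℓ] at this
      exact σ.injective (Fin.ext this)
    · rintro ⟨i, hi⟩ ⟨j, hj⟩ hij
      have : (sndIdx k ℓ (τ i) : ℕ) = sndIdx k ℓ (τ j) := congrArg Fin.val hij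
      rw [hτ] at hi hj
      rw [val_sndIdx hℓ, val_sndIdx hℓ, if_neg hi, if_neg hj] at this
      have h5 : (τ i : ℕ) = τ j := by omega
      exact Subtype.ext (τ.injective (Fin.ext h5))
    · rintro i ⟨j, hj⟩ hij
      have := congrArg Fin.val hij
      rw [hτ] at hj
      have h3 := (σ i).2
      simp only [val_sndIdx hℓ, val_fstIdx hℓ, if_neg hj] at this
      omega
  have hcardeq : Fintype.card (Fin (k + 1) ⊕ {j // j ∉ T}) =
      Fintype.card (Fin (2 * k + 1 - ℓ + 1)) := by
    rw [Fintype.card_sum, Fintype.card_subtype_compl, Fintype.card_coe, Fintype.card_fin,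
      Fintype.card_fin]
    omega
  let F := Equiv.ofBijective F0 ((Fintype.bijective_iff_injective_and_card _).2 ⟨hF0, hcardeq⟩)
  rw [← lintegral_pi_comp_equiv ν F]
  refine lintegral_congr fun w => ?_
  have a1 : (w ∘ F) ∘ Sum.inl = (w ∘ fstIdx k ℓ) ∘ σ := rfl
  have a2 : (w ∘ F) ∘ overlapEmb T e = (w ∘ sndIdx k ℓ) ∘ τ := by
    ext j
    simp only [Function.comp]
    congr 1
    change F0 _ = _
    by_cases hj : j ∈ T
    · rw [overlapEmb_of_mem e hj]
      change fstIdx k ℓ (σ (e ⟨j, hj⟩)) = _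
      rw [hσ]
      apply Fin.ext
      rw [val_fstIdx hℓ, val_sndIdx hℓ, if_pos ((hτ j).1 hj)]
    · rw [overlapEmb_of_notMem e hj]
      rfl
  rw [a1, a2, hf, hg]

/-- With no shared entry the integrand separates; this is the term that the covariance subtracts. -/
theorem lintegral_overlap_empty {E ι : Type*} [MeasurableSpace E] [Fintype ι] [DecidableEq ι]
    (ν : Measure E) [SigmaFinite ν] {f g : (ι → E) → ℝ≥0∞} (hf : Measurable f)
    (hg : Measurable g) (e : (∅ : Finset ι) ↪ ι) :
    ∫⁻ z : ι ⊕ {j // j ∉ (∅ : Finset ι)} → E, f (z ∘ Sum.inl) * g (z ∘ overlapEmb ∅ e)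
        ∂(Measure.pi fun _ => ν) =
      (∫⁻ x, f x ∂(Measure.pi fun _ => ν)) * ∫⁻ x, g x ∂(Measure.pi fun _ => ν) := by
  let ε : ι ≃ {j // j ∉ (∅ : Finset ι)} := (Equiv.subtypeUnivEquiv (by simp)).symm
  have h := measurePreserving_sumPiEquivProdPi
    (X := fun _ : ι ⊕ {j // j ∉ (∅ : Finset ι)} => E) (fun _ => ν)
  refine (h.lintegral_comp_emb (MeasurableEquiv.measurableEmbedding _)
    fun p : (ι → E) × ({j // j ∉ (∅ : Finset ι)} → E) => f p.1 * g (p.2 ∘ ε)).trans ?_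
  have hg' : Measurable fun w : {j // j ∉ (∅ : Finset ι)} → E => g (w ∘ ε) :=
    hg.comp (measurable_pi_lambda _ fun i => measurable_pi_apply _)
  rw [lintegral_prod_mul (g := fun w : {j // j ∉ (∅ : Finset ι)} → E => g (w ∘ ε))
    hf.aemeasurable hg'.aemeasurable, lintegral_pi_comp_equiv ν ε g]

/-! ### The factorial measure of a set -/

/-- The sum of the unit masses at the injective `ι`-tuples of points of `s`. -/
noncomputable def tupleMeasure {E : Type*} [MeasurableSpace E] (ι : Type*) (s : Set E) :
    Measure (ι → E) :=
  Measure.sum fun x : ι ↪ s => Measure.dirac fun i => (x i : E)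

theorem lintegral_tupleMeasure {E ι : Type*} [MeasurableSpace E] (s : Set E)
    {f : (ι → E) → ℝ≥0∞} (hf : Measurable f) :
    ∫⁻ x, f x ∂(tupleMeasure ι s) = ∑' x : ι ↪ s, f fun i => x i := by
  rw [tupleMeasure, lintegral_sum_measure]
  simp only [lintegral_dirac' _ hf]

theorem tupleMeasure_apply {E ι : Type*} [MeasurableSpace E] (s : Set E)
    {B : Set (ι → E)} (hB : MeasurableSet B) :
    tupleMeasure ι s B = ∑' x : ι ↪ s, B.indicator 1 fun i => (x i : E) := by
  rw [tupleMeasure, Measure.sum_apply _ hB]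
  simp only [Measure.dirac_apply' _ hB]

/-- The injective tuples with prescribed classes, in terms of the classes. -/
def embeddingFiberEquiv {E ι β : Type*} (s : Set E) (C : β → Set E)
    (hC : Pairwise fun b b' => Disjoint (C b) (C b')) (a : ι → β) :
    {x : ι ↪ s // ∀ i, (x i : E) ∈ C (a i)} ≃
      ∀ b, ({i // a i = b} ↪ (s ∩ C b : Set E)) where
  toFun x b := ⟨fun i => ⟨x.1 i, (x.1 i).2, by have := x.2 i; rwa [i.2] at this⟩, by
    intro i j hij
    have : x.1 i = x.1 j := by
      exact Subtype.ext (Subtype.mk.inj hij)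
    exact Subtype.ext (x.1.injective this)⟩
  invFun y := ⟨⟨fun i => ⟨y (a i) ⟨i, rfl⟩, (y (a i) ⟨i, rfl⟩).2.1⟩, by
    intro i j hij
    have hij' : (y (a i) ⟨i, rfl⟩ : E) = y (a j) ⟨j, rfl⟩ := congrArg Subtype.val hij
    have hab : a i = a j := by
      by_contra hne
      exact Set.disjoint_left.1 (hC hne) (y (a i) ⟨i, rfl⟩).2.2
        (hij' ▸ (y (a j) ⟨j, rfl⟩).2.2)
    have key : ∀ b (hb : a j = b), (y (a j) ⟨j, rfl⟩ : E) = y b ⟨j, hb⟩ := by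
      rintro b rfl; rfl
    rw [key (a i) hab.symm] at hij'
    exact congrArg Subtype.val ((y (a i)).injective (Subtype.ext hij'))⟩,
    fun i => (y (a i) ⟨i, rfl⟩).2.2⟩
  left_inv x := rfl
  right_inv y := by
    ext b ⟨i, rfl⟩
    rfl

/-- Entries in disjoint classes are automatically distinct, so injective tuples can be counted class
by class, each class giving a falling factorial. -/
theorem tupleMeasure_pi_disjoint {E ι β : Type*} [MeasurableSpace E] [Fintype ι] [Fintype β]
    [DecidableEq β] {s : Set E} (hs : s.Finite) {C : β → Set E} (hCm : ∀ b, MeasurableSet (C b))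
    (hC : Pairwise fun b b' => Disjoint (C b) (C b')) (a : ι → β) :
    tupleMeasure ι s (Set.pi univ fun i => C (a i)) =
      ∏ b, (((s ∩ C b).encard.toNat.descFactorial (Fintype.card {i // a i = b}) : ℕ) : ℝ≥0∞) := by
  classical
  rw [tupleMeasure_apply s (MeasurableSet.univ_pi fun i => hCm _)]
  have : Fintype s := hs.fintype
  have hfin : ∀ b, Fintype (s ∩ C b : Set E) := fun b => (hs.inter_of_left _).fintype
  rw [tsum_fintype]
  have h1 : ∀ x : ι ↪ s, (Set.pi univ fun i => C (a i)).indicator (1 : (ι → E) → ℝ≥0∞)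
      (fun i => (x i : E)) = if ∀ i, (x i : E) ∈ C (a i) then 1 else 0 := by
    intro x
    simp [Set.indicator_apply]
  simp only [h1]
  rw [Finset.sum_boole, ← Fintype.card_subtype,
    Fintype.card_congr (embeddingFiberEquiv s C hC a), Fintype.card_pi]
  simp only [Fintype.card_embedding_eq, Nat.cast_prod]
  refine Finset.prod_congr rfl fun b _ => ?_
  congr 2
  rw [← Set.ncard_def, ← Nat.card_coe_set_eq, Nat.card_eq_fintype_card]

instance isFiniteMeasure_tupleMeasure {E ι : Type*} [MeasurableSpace E] [Fintype ι] {s : Set E}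
    [h : Finite s] : IsFiniteMeasure (tupleMeasure ι s) := by
  classical
  have : Fintype s := Fintype.ofFinite s
  constructor
  rw [tupleMeasure_apply s MeasurableSet.univ, tsum_fintype]
  simp

/-! ### Poisson processes -/

/-- The falling factorial kills the terms below `j` and cancels against the factorial in the others,
leaving `r ^ j` times a shifted Poisson law of total mass one. -/
theorem tsum_poissonMeasure_descFactorial (r : ℝ≥0) (j : ℕ) :
    ∑' n : ℕ, poissonMeasure r {n} * ((n.descFactorial j : ℕ) : ℝ≥0∞) = (r : ℝ≥0∞) ^ j := by
  rw [← ENNReal.summable.sum_add_tsum_nat_add' (k := j), Finset.sum_eq_zero, zero_add]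
  · have h1 : ∀ i : ℕ, poissonMeasure r {i + j} * (((i + j).descFactorial j : ℕ) : ℝ≥0∞) =
        poissonMeasure r {i} * (r : ℝ≥0∞) ^ j := by
      intro i
      rw [poissonMeasure_singleton, poissonMeasure_singleton, ← ENNReal.ofReal_natCast,
        ← ENNReal.ofReal_coe_nnreal, ← ENNReal.ofReal_pow (NNReal.coe_nonneg r),
        ← ENNReal.ofReal_mul (by positivity), ← ENNReal.ofReal_mul (by positivity)]
      congr 1
      have h := Nat.factorial_mul_descFactorial (Nat.le_add_left j i)
      rw [Nat.add_sub_cancel] at h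
      have h' : ((i ! : ℕ) : ℝ) * (((i + j).descFactorial j : ℕ) : ℝ) = ((i + j)! : ℕ) := by
        exact_mod_cast h
      have hi : ((i ! : ℕ) : ℝ) ≠ 0 := by positivity
      have hij : (((i + j)! : ℕ) : ℝ) ≠ 0 := by positivity
      rw [div_mul_eq_mul_div, div_mul_eq_mul_div, div_eq_div_iff hij hi, ← h']
      ring
    simp_rw [h1]
    rw [ENNReal.tsum_mul_right]
    have h2 : ∑' i : ℕ, poissonMeasure r {i} = 1 := by
      have := Measure.tsum_indicator_apply_singleton (poissonMeasure r) Set.univ MeasurableSet.univ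
      simpa using this
    rw [h2, one_mul]
  · intro n hn
    rw [Nat.descFactorial_of_lt (Finset.mem_range.1 hn)]
    simp

section Poisson

variable {Ω E : Type*} [MeasurableSpace E] {P : Ω → Set E}

/-- The factorial measure of the Poisson process, put to zero where it is infinite. -/
noncomputable def factorialMeasure (ι : Type*) (P : Ω → Set E) (ω : Ω) : Measure (ι → E) :=
  if (P ω ∩ Set.univ).encard = ⊤ then 0 else tupleMeasure ι (P ω)

/-- The truncation in the definition serves this finiteness, on which the π-system argument for
measurability relies. -/
instance isFiniteMeasure_factorialMeasure {ι : Type*} [Fintype ι] (ω : Ω) :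
    IsFiniteMeasure (factorialMeasure ι P ω) := by
  unfold factorialMeasure
  split_ifs with h
  · infer_instance
  · rw [Set.inter_univ, Set.encard_eq_top_iff, Set.not_infinite] at h
    have := h.to_subtype
    infer_instance

theorem factorialMeasure_pi_disjoint {ι β : Type*} [Fintype ι] [Fintype β] [DecidableEq β]
    {C : β → Set E} (hCm : ∀ b, MeasurableSet (C b))
    (hC : Pairwise fun b b' => Disjoint (C b) (C b')) (a : ι → β) (ω : Ω) :
    factorialMeasure ι P ω (Set.pi univ fun i => C (a i)) =
      if (P ω ∩ Set.univ).encard = ⊤ then 0 else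
      ∏ b, (((P ω ∩ C b).encard.toNat.descFactorial (Fintype.card {i // a i = b}) : ℕ) :
        ℝ≥0∞) := by
  unfold factorialMeasure
  split_ifs with h
  · rfl
  · rw [Set.inter_univ, Set.encard_eq_top_iff, Set.not_infinite] at h
    exact tupleMeasure_pi_disjoint h hCm hC a

/-- The atoms of the finite algebra generated by the sets `B i`. -/
def atomSet {E ι : Type*} (B : ι → Set E) (s : Finset ι) : Set E :=
  {x | ∀ i, x ∈ B i ↔ i ∈ s}

theorem atomSet_disjoint {E ι : Type*} (B : ι → Set E) :
    Pairwise fun s s' : Finset ι => Disjoint (atomSet B s) (atomSet B s') := by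
  intro s s' hss
  refine Set.disjoint_left.2 fun x h1 h2 => hss ?_
  ext i
  rw [← h1 i, h2 i]

theorem measurableSet_atomSet {ι : Type*} [Finite ι] {B : ι → Set E}
    (hB : ∀ i, MeasurableSet (B i)) (s : Finset ι) : MeasurableSet (atomSet B s) := by
  have : atomSet B s = ⋂ i, {x | x ∈ B i ↔ i ∈ s} := by
    ext x; simp [atomSet]
  rw [this]
  refine MeasurableSet.iInter fun i => ?_
  by_cases hi : i ∈ s
  · simpa [hi] using hB i
  · simp only [hi, iff_false]
    exact (hB i).compl

/-- The counts are independent only over disjoint sets. Recording for each coordinate which of the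
sets `B j` contain it splits a general box into boxes with sides in one disjoint family. -/
theorem pi_eq_iUnion_atomSet {E ι : Type*} [Fintype ι] (B : ι → Set E) :
    Set.pi univ B = ⋃ a : {a : ι → Finset ι // ∀ i, i ∈ a i},
      Set.pi univ fun i => atomSet B (a.1 i) := by
  classical
  ext x
  simp only [Set.mem_pi, Set.mem_univ, true_imp_iff, Set.mem_iUnion, atomSet, Set.mem_ofPred_eq]
  constructor
  · intro hx
    refine ⟨⟨fun i => Finset.univ.filter fun j => x i ∈ B j, fun i => by simp [hx i]⟩, ?_⟩
    intro i j
    simp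
  · rintro ⟨a, ha⟩ i
    exact (ha i i).2 (a.2 i)

theorem measure_pi_eq_sum_atomSet {ι : Type*} [Fintype ι] [DecidableEq ι] {B : ι → Set E}
    (hB : ∀ i, MeasurableSet (B i)) (μ : Measure (ι → E)) :
    μ (Set.pi univ B) = ∑ a : {a : ι → Finset ι // ∀ i, i ∈ a i},
      μ (Set.pi univ fun i => atomSet B (a.1 i)) := by
  rw [pi_eq_iUnion_atomSet, measure_iUnion, tsum_fintype]
  · intro a a' haa
    refine Set.disjoint_left.2 fun x h1 h2 => haa ?_
    refine Subtype.ext (funext fun i => ?_)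
    by_contra hne
    exact Set.disjoint_left.1 (atomSet_disjoint B hne) (h1 i trivial) (h2 i trivial)
  · intro a
    exact MeasurableSet.univ_pi fun i => measurableSet_atomSet hB _

/-! ### Factorial moments of the counts and the Mecke formula. -/

variable [MeasurableSpace Ω] {ν : Measure E} {Pr : Measure Ω}

theorem measurable_enat_toNat_descFactorial (j : ℕ) :
    Measurable fun N : ℕ∞ => ((N.toNat.descFactorial j : ℕ) : ℝ≥0∞) :=
  measurable_from_top

theorem IsPoissonProcess.ae_encard_ne_top [IsProbabilityMeasure Pr] (hP : IsPoissonProcess P ν Pr)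
    {B : Set E} (hB : MeasurableSet B) (hν : ν B ≠ ∞) : ∀ᵐ ω ∂Pr, (P ω ∩ B).encard ≠ ⊤ := by
  have hm := hP.measurable_count B hB
  have h1 : Pr (⋃ j : ℕ, {ω | (P ω ∩ B).encard = j}) = 1 := by
    rw [measure_iUnion]
    · simp_rw [hP.law_count B hB hν]
      have := Measure.tsum_indicator_apply_singleton (poissonMeasure (ν B).toNNReal) Set.univ
        MeasurableSet.univ
      simpa using this
    · intro i j hij
      refine Set.disjoint_left.2 fun ω h1 h2 => hij ?_
      simp only [Set.mem_ofPred_eq] at h1 h2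
      rw [h1] at h2
      exact_mod_cast h2
    · intro j
      exact hm (measurableSet_singleton _)
  have h2 : MeasurableSet (⋃ j : ℕ, {ω | (P ω ∩ B).encard = j}) :=
    MeasurableSet.iUnion fun j => hm (measurableSet_singleton _)
  have h3 := (prob_compl_eq_zero_iff h2).2 h1
  rw [ae_iff]
  refine measure_mono_null ?_ h3
  intro ω hω
  simp only [ne_eq, not_not, Set.mem_ofPred_eq] at hω
  simp [hω]

theorem IsPoissonProcess.lintegral_descFactorial [IsProbabilityMeasure Pr]
    (hP : IsPoissonProcess P ν Pr) {B : Set E} (hB : MeasurableSet B) (hν : ν B ≠ ∞) (j : ℕ) :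
    ∫⁻ ω, (((P ω ∩ B).encard.toNat.descFactorial j : ℕ) : ℝ≥0∞) ∂Pr = ν B ^ j := by
  have hm := hP.measurable_count B hB
  have hm' : Measurable fun ω => (P ω ∩ B).encard.toNat := measurable_from_top.comp hm
  have h1 : ∫⁻ ω, (((P ω ∩ B).encard.toNat.descFactorial j : ℕ) : ℝ≥0∞) ∂Pr =
      ∫⁻ n : ℕ, ((n.descFactorial j : ℕ) : ℝ≥0∞) ∂(Pr.map fun ω => (P ω ∩ B).encard.toNat) := by
    rw [lintegral_map measurable_from_top hm']
  rw [h1, lintegral_countable']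
  -- `toNat` also sends `⊤` to `0`, so the two events agree only almost surely.
  have h2 : ∀ n : ℕ, (Pr.map fun ω => (P ω ∩ B).encard.toNat) {n} =
      poissonMeasure (ν B).toNNReal {n} := by
    intro n
    rw [Measure.map_apply hm' (measurableSet_singleton _), ← hP.law_count B hB hν n]
    refine measure_congr ?_
    filter_upwards [hP.ae_encard_ne_top hB hν] with ω hω
    refine propext ⟨fun h => ?_, fun h => ?_⟩
    · change (P ω ∩ B).encard.toNat = n at h
      change (P ω ∩ B).encard = n
      rw [← h, ENat.natCast_toNat hω]
    · change (P ω ∩ B).encard = n at h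
      change (P ω ∩ B).encard.toNat = n
      rw [h]; rfl
  simp_rw [h2]
  have h3 := tsum_poissonMeasure_descFactorial (ν B).toNNReal j
  rw [ENNReal.coe_toNNReal hν] at h3
  rw [← h3]
  exact tsum_congr fun n => mul_comm _ _

theorem IsPoissonProcess.indep_fintype (hP : IsPoissonProcess P ν Pr) {β : Type*} [Fintype β]
    {B : β → Set E} (hB : ∀ b, MeasurableSet (B b))
    (hd : Pairwise fun b b' => Disjoint (B b) (B b')) :
    iIndepFun (fun b ω => (P ω ∩ B b).encard) Pr := by
  let e := Fintype.equivFin β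
  have h := hP.indep _ (fun i => B (e.symm i)) (fun i => hB _)
    (fun i j hij => hd fun h => hij (e.symm.injective h))
  have h' := h.precomp e.injective
  simpa using h'

theorem IsPoissonProcess.ae_factorialMeasure_eq [IsProbabilityMeasure Pr] [IsFiniteMeasure ν]
    (hP : IsPoissonProcess P ν Pr) (ι : Type*) :
    ∀ᵐ ω ∂Pr, factorialMeasure ι P ω = tupleMeasure ι (P ω) := by
  filter_upwards [hP.ae_encard_ne_top MeasurableSet.univ (measure_ne_top ν _)] with ω hω
  rw [factorialMeasure, if_neg hω]

theorem IsPoissonProcess.measurable_factorialMeasure (hP : IsPoissonProcess P ν Pr)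
    (ι : Type*) [Fintype ι] : Measurable (factorialMeasure ι P) := by
  classical
  have hbox : ∀ B : ι → Set E, (∀ i, MeasurableSet (B i)) →
      Measurable fun ω => factorialMeasure ι P ω (Set.pi univ B) := by
    intro B hB
    simp_rw [measure_pi_eq_sum_atomSet hB]
    refine Finset.measurable_sum _ fun a _ => ?_
    simp_rw [factorialMeasure_pi_disjoint (measurableSet_atomSet hB) (atomSet_disjoint B)]
    refine Measurable.ite ?_ measurable_const ?_
    · exact hP.measurable_count _ MeasurableSet.univ (measurableSet_singleton _)
    · refine Finset.measurable_prod _ fun s _ => ?_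
      exact (measurable_enat_toNat_descFactorial _).comp
        (hP.measurable_count _ (measurableSet_atomSet hB s))
  refine Measurable.measure_of_isPiSystem generateFrom_pi.symm isPiSystem_pi ?_ ?_
  · rintro _ ⟨B, hB, rfl⟩
    exact hbox B fun i => hB i trivial
  · simpa using hbox (fun _ => Set.univ) fun i => MeasurableSet.univ

/-- Independence factors the expectation over the classes, and the factorial moment of each Poisson
count is a power of its mean, with exponent the number of coordinates in that class. -/
theorem IsPoissonProcess.lintegral_factorialMeasure_pi_disjoint [IsProbabilityMeasure Pr]
    [IsFiniteMeasure ν] (hP : IsPoissonProcess P ν Pr) {ι β : Type*} [Fintype ι] [Fintype β]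
    {C : β → Set E} (hCm : ∀ b, MeasurableSet (C b))
    (hC : Pairwise fun b b' => Disjoint (C b) (C b')) (a : ι → β) :
    ∫⁻ ω, factorialMeasure ι P ω (Set.pi univ fun i => C (a i)) ∂Pr = ∏ i, ν (C (a i)) := by
  classical
  have h1 : ∀ᵐ ω ∂Pr, factorialMeasure ι P ω (Set.pi univ fun i => C (a i)) =
      ∏ b, (((P ω ∩ C b).encard.toNat.descFactorial (Fintype.card {i // a i = b}) : ℕ) :
        ℝ≥0∞) := by
    filter_upwards [hP.ae_encard_ne_top MeasurableSet.univ (measure_ne_top ν _)] with ω hω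
    rw [factorialMeasure_pi_disjoint hCm hC, if_neg hω]
  rw [lintegral_congr_ae h1]
  have hind := (hP.indep_fintype hCm hC).comp
    (fun b (N : ℕ∞) => ((N.toNat.descFactorial (Fintype.card {i // a i = b}) : ℕ) : ℝ≥0∞))
    (fun b => measurable_enat_toNat_descFactorial _)
  have h2 := lintegral_prod_eq_prod_lintegral_of_indepFun Finset.univ _ hind
    (fun b => (measurable_enat_toNat_descFactorial _).comp (hP.measurable_count _ (hCm b)))
  refine h2.trans ?_
  rw [← Finset.prod_fiberwise_of_maps_to (s := Finset.univ) (t := Finset.univ) (g := a)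
    (fun i _ => Finset.mem_univ _)]
  refine Finset.prod_congr rfl fun b _ => ?_
  refine (hP.lintegral_descFactorial (hCm b) (measure_ne_top ν _) _).trans ?_
  rw [Finset.prod_congr rfl (g := fun _ => ν (C b)), Finset.prod_const, Fintype.card_subtype]
  intro i hi
  rw [(Finset.mem_filter.1 hi).2]

/-- This is the Mecke formula at the level of measures. The decomposition into atoms reduces a box
to boxes with disjoint or equal sides, and boxes determine the product measure. -/
theorem IsPoissonProcess.bind_factorialMeasure [IsProbabilityMeasure Pr]
    [IsFiniteMeasure ν] (hP : IsPoissonProcess P ν Pr) (ι : Type*) [Fintype ι] :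
    Pr.bind (factorialMeasure ι P) = Measure.pi fun _ => ν := by
  classical
  refine (Measure.pi_eq fun B hB => ?_).symm
  have hm := hP.measurable_factorialMeasure ι
  rw [← Measure.pi_pi (fun _ => ν), measure_pi_eq_sum_atomSet hB, measure_pi_eq_sum_atomSet hB]
  refine Finset.sum_congr rfl fun a _ => ?_
  rw [Measure.bind_apply (MeasurableSet.univ_pi fun i => measurableSet_atomSet hB _)
    hm.aemeasurable, hP.lintegral_factorialMeasure_pi_disjoint (measurableSet_atomSet hB)
    (atomSet_disjoint B), Measure.pi_pi]

/-- The multivariate Mecke formula. -/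
theorem IsPoissonProcess.lintegral_tsum_embedding [IsProbabilityMeasure Pr]
    [IsFiniteMeasure ν] (hP : IsPoissonProcess P ν Pr) {ι : Type*} [Fintype ι]
    {f : (ι → E) → ℝ≥0∞} (hf : Measurable f) :
    ∫⁻ ω, ∑' x : ι ↪ P ω, f (fun i => x i) ∂Pr = ∫⁻ x, f x ∂(Measure.pi fun _ => ν) := by
  rw [← hP.bind_factorialMeasure ι, Measure.lintegral_bind
    (hP.measurable_factorialMeasure ι).aemeasurable hf.aemeasurable]
  refine lintegral_congr_ae ?_
  filter_upwards [hP.ae_factorialMeasure_eq ι] with ω hω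
  rw [hω, lintegral_tupleMeasure _ hf]

/-- Measurability is obtained only almost everywhere, because the truncated factorial measure
differs from the true one on the null event of infinitely many points. -/
theorem IsPoissonProcess.aemeasurable_tsum_embedding [IsProbabilityMeasure Pr]
    [IsFiniteMeasure ν] (hP : IsPoissonProcess P ν Pr) {ι : Type*} [Fintype ι]
    {f : (ι → E) → ℝ≥0∞} (hf : Measurable f) :
    AEMeasurable (fun ω => ∑' x : ι ↪ P ω, f (fun i => x i)) Pr := by
  refine ⟨fun ω => ∫⁻ x, f x ∂(factorialMeasure ι P ω),
    (Measure.measurable_lintegral hf).comp (hP.measurable_factorialMeasure ι), ?_⟩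
  filter_upwards [hP.ae_factorialMeasure_eq ι] with ω hω
  rw [hω, lintegral_tupleMeasure _ hf]

end Poisson

/-! ### Moments of Poisson U-statistics -/

/-- The restriction of a kernel to the tuples in `H`, with values in `[0, ∞]`. -/
noncomputable def restrictKernel {E ι : Type*} (h : (ι → E) → ℝ) (H : Set E) (x : ι → E) : ℝ≥0∞ :=
  (Set.pi univ fun _ => H).indicator (fun x => ENNReal.ofReal (h x)) x

theorem measurable_restrictKernel {E ι : Type*} [MeasurableSpace E] [Finite ι]
    {h : (ι → E) → ℝ} {H : Set E} (hh : Measurable h) (hH : MeasurableSet H) :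
    Measurable (restrictKernel h H) := by
  have := Fintype.ofFinite ι
  exact hh.ennreal_ofReal.indicator (MeasurableSet.univ_pi fun _ => hH)

theorem restrictKernel_comp_perm {E ι : Type*} {h : (ι → E) → ℝ} (H : Set E)
    (hh : ∀ (σ : Equiv.Perm ι) x, h (x ∘ σ) = h x) (σ : Equiv.Perm ι) (x : ι → E) :
    restrictKernel h H (x ∘ σ) = restrictKernel h H x := by
  have : x ∘ σ ∈ (Set.pi univ fun _ => H) ↔ x ∈ (Set.pi univ fun _ : ι => H) := by
    simp only [Set.mem_pi, Set.mem_univ, true_imp_iff, Function.comp]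
    exact σ.forall_congr_right (q := fun i => x i ∈ H)
  unfold restrictKernel
  by_cases hx : x ∈ (Set.pi univ fun _ : ι => H)
  · rw [Set.indicator_of_mem hx, Set.indicator_of_mem (this.2 hx), hh]
  · rw [Set.indicator_of_notMem hx, Set.indicator_of_notMem fun h => hx (this.1 h)]

theorem restrictKernel_le {E ι : Type*} {h : (ι → E) → ℝ} (H : Set E) {M : ℝ}
    (hM : ∀ x, h x ≤ M) (x : ι → E) : restrictKernel h H x ≤ ENNReal.ofReal M := by
  unfold restrictKernel
  refine Set.indicator_le' (f := fun x => ENNReal.ofReal (h x)) (g := fun _ => ENNReal.ofReal M)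
    ?_ ?_ x
  · intro y _; exact ENNReal.ofReal_le_ofReal (hM y)
  · intro y _; exact bot_le

/-- `X` need not be finite: a divergent real sum is `0` by convention, and so is `toReal ⊤`. -/
theorem uStat_inter {d : ℕ} (k : ℕ) {h : (Fin (k + 1) → Euc d) → ℝ} (hh : ∀ x, 0 ≤ h x)
    (X H : Set (Euc d)) :
    uStat k h (X ∩ H) = ((k + 1)! : ℝ)⁻¹ *
      (∑' x : Fin (k + 1) ↪ X, restrictKernel h H fun i => (x i : Euc d)).toReal := by
  rw [uStat, ENNReal.tsum_toReal_eq]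
  swap
  · intro x
    refine ne_top_of_le_ne_top ENNReal.ofReal_ne_top (b := ENNReal.ofReal (h fun i => x i)) ?_
    exact Set.indicator_le_self (f := fun x => ENNReal.ofReal (h x)) _ _
  congr 1
  let g : {x : Fin (k + 1) → Euc d // Function.Injective x ∧ ∀ i, x i ∈ X ∩ H} →
      (Fin (k + 1) ↪ X) := fun x =>
    ⟨fun i => ⟨x.1 i, (x.2.2 i).1⟩, fun i j hij => x.2.1 (Subtype.mk.inj hij)⟩
  have hg : Function.Injective g := by
    intro x y hxy
    refine Subtype.ext (funext fun i => ?_)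
    exact Subtype.mk.inj (DFunLike.congr_fun hxy i)
  rw [← hg.tsum_eq]
  · refine tsum_congr fun x => ?_
    have hx : (fun i => ((g x i : X) : Euc d)) ∈ (Set.pi univ fun _ : Fin (k + 1) => H) :=
      fun i _ => (x.2.2 i).2
    rw [restrictKernel, Set.indicator_of_mem hx, ENNReal.toReal_ofReal (hh _)]
    rfl
  · intro y hy
    have hy' : (fun i => (y i : Euc d)) ∈ (Set.pi univ fun _ : Fin (k + 1) => H) := by
      by_contra hcon
      refine hy ?_
      simp only [restrictKernel, Set.indicator_of_notMem hcon, ENNReal.toReal_zero]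
    exact ⟨⟨fun i => y i, fun i j hij => y.injective (Subtype.ext hij),
      fun i => ⟨(y i).2, hy' i trivial⟩⟩, rfl⟩

/-- The integral of the product of two kernels with `ℓ` common arguments. -/
noncomputable def overlapIntegral {E : Type*} [MeasurableSpace E] (ν : Measure E) (k ℓ : ℕ)
    (f g : (Fin (k + 1) → E) → ℝ≥0∞) : ℝ≥0∞ :=
  ∫⁻ w : Fin (2 * k + 1 - ℓ + 1) → E, f (w ∘ fstIdx k ℓ) * g (w ∘ sndIdx k ℓ)
    ∂(Measure.pi fun _ => ν)

theorem lintegral_pi_lt_top {E ι : Type*} [MeasurableSpace E] [Fintype ι] (ν : Measure E)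
    [IsFiniteMeasure ν] {f : (ι → E) → ℝ≥0∞} {M : ℝ≥0∞} (hM : M ≠ ∞) (hf : ∀ x, f x ≤ M) :
    ∫⁻ x, f x ∂(Measure.pi fun _ => ν) < ∞ := by
  refine (lintegral_mono hf).trans_lt ?_
  rw [lintegral_const]
  exact ENNReal.mul_lt_top hM.lt_top (measure_lt_top _ _)

/-- The product `(k+1).choose ℓ * (k+1).descFactorial ℓ` counts the overlap patterns `(T, e)` with
`ℓ` shared entries; the two prefactors `1/(k+1)!` turn it into the weight of the `ℓ`-th overlap. -/
theorem choose_mul_descFactorial_div {k ℓ : ℕ} (hℓ : ℓ ≤ k + 1) :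
    ((k + 1)! : ℝ)⁻¹ ^ 2 * ((k + 1).choose ℓ * ((k + 1).descFactorial ℓ : ℝ)) =
      ((ℓ ! : ℝ) * ((k + 1 - ℓ)! : ℝ) ^ 2)⁻¹ := by
  have h1 : ((k + 1).choose ℓ : ℝ) * ℓ ! * ((k + 1 - ℓ)! : ℝ) = ((k + 1)! : ℝ) := by
    exact_mod_cast Nat.choose_mul_factorial_mul_factorial hℓ
  have h2 : ((k + 1 - ℓ)! : ℝ) * ((k + 1).descFactorial ℓ : ℝ) = ((k + 1)! : ℝ) := by
    exact_mod_cast Nat.factorial_mul_descFactorial hℓ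
  have a1 : (ℓ ! : ℝ) ≠ 0 := by positivity
  have a2 : ((k + 1 - ℓ)! : ℝ) ≠ 0 := by positivity
  have a3 : ((k + 1)! : ℝ) ≠ 0 := by positivity
  have h3 : ((k + 1)! : ℝ) ^ 2 = (((k + 1).choose ℓ : ℝ) * (k + 1).descFactorial ℓ) *
      ((ℓ ! : ℝ) * ((k + 1 - ℓ)! : ℝ) ^ 2) := by
    nth_rw 1 [pow_two]
    nth_rw 1 [← h1]
    rw [← h2]
    ring
  have h4 : (((k + 1).choose ℓ : ℝ) * (k + 1).descFactorial ℓ) ≠ 0 := by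
    intro h0
    rw [h0, zero_mul] at h3
    exact pow_ne_zero 2 a3 h3
  rw [inv_pow, h3, mul_inv, mul_comm, ← mul_assoc, mul_inv_cancel₀ h4, one_mul]

/-! ### First and second moments of sums over tuples. -/

section Poisson

variable {Ω E : Type*} [MeasurableSpace E] [MeasurableSpace Ω] {P : Ω → Set E} {ν : Measure E}
  {Pr : Measure Ω} [IsProbabilityMeasure Pr] [IsFiniteMeasure ν]

/-- The Mecke formula is applied to every overlap pattern and the patterns are grouped by `ℓ = |T|`;
`ℓ = 0` gives the product of the means. -/
theorem IsPoissonProcess.lintegral_mul_tsum_embedding (hP : IsPoissonProcess P ν Pr) {k : ℕ}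
    {f g : (Fin (k + 1) → E) → ℝ≥0∞} (hf : Measurable f) (hg : Measurable g)
    (hfs : ∀ (σ : Equiv.Perm (Fin (k + 1))) x, f (x ∘ σ) = f x)
    (hgs : ∀ (σ : Equiv.Perm (Fin (k + 1))) x, g (x ∘ σ) = g x) :
    ∫⁻ ω, (∑' x : Fin (k + 1) ↪ P ω, f fun i => x i) *
        (∑' x : Fin (k + 1) ↪ P ω, g fun i => x i) ∂Pr =
      (∫⁻ x, f x ∂(Measure.pi fun _ => ν)) * (∫⁻ x, g x ∂(Measure.pi fun _ => ν)) +
      ∑ ℓ ∈ Finset.Icc 1 (k + 1), ((k + 1).choose ℓ * (k + 1).descFactorial ℓ) *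
        overlapIntegral ν k ℓ f g := by
  have hm : ∀ (T : Finset (Fin (k + 1))) (e : T ↪ Fin (k + 1)),
      Measurable fun z : Fin (k + 1) ⊕ {j // j ∉ T} → E =>
        f (z ∘ Sum.inl) * g (z ∘ overlapEmb T e) := by
    intro T e
    refine (hf.comp ?_).mul (hg.comp ?_) <;>
    exact measurable_pi_lambda _ fun i => measurable_pi_apply _
  have h1 : ∀ ω, (∑' x : Fin (k + 1) ↪ P ω, f fun i => x i) *
        (∑' x : Fin (k + 1) ↪ P ω, g fun i => x i) =
      ∑ T : Finset (Fin (k + 1)), ∑ e : T ↪ Fin (k + 1),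
        ∑' z : (Fin (k + 1) ⊕ {j // j ∉ T}) ↪ P ω,
          (fun z : Fin (k + 1) ⊕ {j // j ∉ T} → E => f (z ∘ Sum.inl) * g (z ∘ overlapEmb T e))
            (fun i => z i) := fun ω =>
    tsum_embedding_mul_tsum_embedding (fun x : Fin (k + 1) → P ω => f fun i => x i)
      (fun x : Fin (k + 1) → P ω => g fun i => x i)
  simp_rw [h1]
  rw [lintegral_finsetSum' _ fun T _ => Finset.aemeasurable_fun_sum _ fun e _ =>
    hP.aemeasurable_tsum_embedding (hm T e)]
  have h2 : ∀ T : Finset (Fin (k + 1)), ∫⁻ ω, ∑ e : T ↪ Fin (k + 1),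
        ∑' z : (Fin (k + 1) ⊕ {j // j ∉ T}) ↪ P ω,
          (fun z : Fin (k + 1) ⊕ {j // j ∉ T} → E => f (z ∘ Sum.inl) * g (z ∘ overlapEmb T e))
            (fun i => z i) ∂Pr =
      ((k + 1).descFactorial T.card : ℕ) * (if T.card = 0 then
        (∫⁻ x, f x ∂(Measure.pi fun _ => ν)) * (∫⁻ x, g x ∂(Measure.pi fun _ => ν))
        else overlapIntegral ν k T.card f g) := by
    intro T
    rw [lintegral_finsetSum' _ fun e _ => hP.aemeasurable_tsum_embedding (hm T e)]
    have h3 : ∀ e : T ↪ Fin (k + 1), ∫⁻ ω, ∑' z : (Fin (k + 1) ⊕ {j // j ∉ T}) ↪ P ω,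
          (fun z : Fin (k + 1) ⊕ {j // j ∉ T} → E => f (z ∘ Sum.inl) * g (z ∘ overlapEmb T e))
            (fun i => z i) ∂Pr = if T.card = 0 then
        (∫⁻ x, f x ∂(Measure.pi fun _ => ν)) * (∫⁻ x, g x ∂(Measure.pi fun _ => ν))
        else overlapIntegral ν k T.card f g := by
      intro e
      rw [hP.lintegral_tsum_embedding (hm T e)]
      split_ifs with h0
      · obtain rfl := Finset.card_eq_zero.1 h0
        exact lintegral_overlap_empty ν hf hg e
      · exact lintegral_overlap_eq ν f g hfs hgs T e
    rw [Finset.sum_congr rfl fun e _ => h3 e, Finset.sum_const, Finset.card_univ,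
      Fintype.card_embedding_eq, Fintype.card_fin, Fintype.card_coe, nsmul_eq_mul]
  rw [Finset.sum_congr rfl fun T _ => h2 T, ← Finset.powerset_univ,
    Finset.sum_powerset_apply_card (fun ℓ => ((k + 1).descFactorial ℓ : ℕ) * (if ℓ = 0 then
        (∫⁻ x, f x ∂(Measure.pi fun _ => ν)) * (∫⁻ x, g x ∂(Measure.pi fun _ => ν))
        else overlapIntegral ν k ℓ f g)), Finset.card_univ, Fintype.card_fin,
    Finset.sum_range_succ', add_comm]
  congr 1
  · simp
  · rw [← Finset.Ico_add_one_right_eq_Icc, Finset.sum_Ico_eq_sum_range]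
    refine Finset.sum_congr (by simp) fun ℓ _ => ?_
    simp [nsmul_eq_mul, mul_assoc, add_comm]

variable {k : ℕ} {f g : (Fin (k + 1) → E) → ℝ≥0∞} {M : ℝ≥0∞}

theorem overlapIntegral_lt_top (ℓ : ℕ) (hM : M ≠ ∞) (hfM : ∀ x, f x ≤ M)
    (hgM : ∀ x, g x ≤ M) : overlapIntegral ν k ℓ f g < ∞ :=
  lintegral_pi_lt_top ν (ENNReal.mul_ne_top hM hM) fun _ => mul_le_mul' (hfM _) (hgM _)

theorem IsPoissonProcess.lintegral_mul_tsum_lt_top (hP : IsPoissonProcess P ν Pr)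
    (hf : Measurable f) (hg : Measurable g)
    (hfs : ∀ (σ : Equiv.Perm (Fin (k + 1))) x, f (x ∘ σ) = f x)
    (hgs : ∀ (σ : Equiv.Perm (Fin (k + 1))) x, g (x ∘ σ) = g x)
    (hM : M ≠ ∞) (hfM : ∀ x, f x ≤ M) (hgM : ∀ x, g x ≤ M) :
    ∫⁻ ω, (∑' x : Fin (k + 1) ↪ P ω, f fun i => x i) *
        (∑' x : Fin (k + 1) ↪ P ω, g fun i => x i) ∂Pr < ∞ := by
  rw [hP.lintegral_mul_tsum_embedding hf hg hfs hgs]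
  refine ENNReal.add_lt_top.2 ⟨ENNReal.mul_lt_top (lintegral_pi_lt_top ν hM hfM)
    (lintegral_pi_lt_top ν hM hgM), ENNReal.sum_lt_top.2 fun ℓ _ => ENNReal.mul_lt_top ?_
      (overlapIntegral_lt_top ℓ hM hfM hgM)⟩
  exact_mod_cast ENNReal.natCast_lt_top ((k + 1).choose ℓ * (k + 1).descFactorial ℓ)

theorem IsPoissonProcess.memLp_toReal_tsum (hP : IsPoissonProcess P ν Pr)
    (hf : Measurable f) (hfs : ∀ (σ : Equiv.Perm (Fin (k + 1))) x, f (x ∘ σ) = f x)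
    (hM : M ≠ ∞) (hfM : ∀ x, f x ≤ M) :
    MemLp (fun ω => (∑' x : Fin (k + 1) ↪ P ω, f fun i => x i).toReal) 2 Pr := by
  have hm := hP.aemeasurable_tsum_embedding hf
  rw [memLp_two_iff_integrable_sq hm.ennreal_toReal.aestronglyMeasurable]
  have := integrable_toReal_of_lintegral_ne_top (hm.mul hm)
    (hP.lintegral_mul_tsum_lt_top hf hf hfs hfs hM hfM hfM).ne
  refine this.congr (Eventually.of_forall fun ω => ?_)
  simp [pow_two]

theorem IsPoissonProcess.integral_toReal_tsum (hP : IsPoissonProcess P ν Pr)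
    (hf : Measurable f) (hM : M ≠ ∞) (hfM : ∀ x, f x ≤ M) :
    ∫ ω, (∑' x : Fin (k + 1) ↪ P ω, f fun i => x i).toReal ∂Pr =
      (∫⁻ x, f x ∂(Measure.pi fun _ => ν)).toReal := by
  have hm := hP.aemeasurable_tsum_embedding hf
  have h1 := hP.lintegral_tsum_embedding hf
  rw [integral_toReal hm, h1]
  refine ae_lt_top' hm ?_
  rw [h1]
  exact (lintegral_pi_lt_top ν hM hfM).ne

theorem IsPoissonProcess.covariance_toReal_tsum (hP : IsPoissonProcess P ν Pr)
    (hf : Measurable f) (hg : Measurable g)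
    (hfs : ∀ (σ : Equiv.Perm (Fin (k + 1))) x, f (x ∘ σ) = f x)
    (hgs : ∀ (σ : Equiv.Perm (Fin (k + 1))) x, g (x ∘ σ) = g x)
    (hM : M ≠ ∞) (hfM : ∀ x, f x ≤ M) (hgM : ∀ x, g x ≤ M) :
    covariance (fun ω => (∑' x : Fin (k + 1) ↪ P ω, f fun i => x i).toReal)
        (fun ω => (∑' x : Fin (k + 1) ↪ P ω, g fun i => x i).toReal) Pr =
      ∑ ℓ ∈ Finset.Icc 1 (k + 1), ((k + 1).choose ℓ * ((k + 1).descFactorial ℓ : ℝ)) *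
        (overlapIntegral ν k ℓ f g).toReal := by
  have hmf := hP.aemeasurable_tsum_embedding hf
  have hmg := hP.aemeasurable_tsum_embedding hg
  rw [covariance_eq_sub (hP.memLp_toReal_tsum hf hfs hM hfM)
    (hP.memLp_toReal_tsum hg hgs hM hgM), hP.integral_toReal_tsum hf hM hfM,
    hP.integral_toReal_tsum hg hM hgM]
  have hlt := hP.lintegral_mul_tsum_lt_top hf hg hfs hgs hM hfM hgM
  have h1 : Pr[(fun ω => (∑' x : Fin (k + 1) ↪ P ω, f fun i => x i).toReal) *
        (fun ω => (∑' x : Fin (k + 1) ↪ P ω, g fun i => x i).toReal)] =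
      (∫⁻ ω, (∑' x : Fin (k + 1) ↪ P ω, f fun i => x i) *
        (∑' x : Fin (k + 1) ↪ P ω, g fun i => x i) ∂Pr).toReal := by
    refine Eq.trans ?_ (integral_toReal (hmf.mul hmg) (ae_lt_top' (hmf.mul hmg) hlt.ne))
    refine integral_congr_ae (Eventually.of_forall fun ω => ?_)
    simp [ENNReal.toReal_mul]
  have hfin : ∀ ℓ ∈ Finset.Icc 1 (k + 1), (((k + 1).choose ℓ : ℝ≥0∞) *
      (k + 1).descFactorial ℓ) * overlapIntegral ν k ℓ f g ≠ ∞ := fun ℓ _ =>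
    ENNReal.mul_ne_top (ENNReal.mul_ne_top (ENNReal.natCast_ne_top _) (ENNReal.natCast_ne_top _))
      (overlapIntegral_lt_top ℓ hM hfM hgM).ne
  rw [h1, hP.lintegral_mul_tsum_embedding hf hg hfs hgs, ENNReal.toReal_add
    (ENNReal.mul_lt_top (lintegral_pi_lt_top ν hM hfM) (lintegral_pi_lt_top ν hM hgM)).ne
    (ENNReal.sum_ne_top.2 hfin), ENNReal.toReal_sum hfin, ENNReal.toReal_mul, add_sub_cancel_left]
  refine Finset.sum_congr rfl fun ℓ _ => ?_
  simp [ENNReal.toReal_mul]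

end Poisson

/-! ### Moments of local U-statistics in a set. -/

section UStatistics

variable {Ω : Type*} [MeasurableSpace Ω] {d k : ℕ} {P : Ω → Set (Euc d)} {ν : Measure (Euc d)}
  {Pr : Measure Ω} [IsProbabilityMeasure Pr] [IsFiniteMeasure ν]
  {h : ℝ → (Fin (k + 1) → Euc d) → ℝ} {r : ℝ} {H H' : Set (Euc d)}

theorem IsLocalKernel.memLp_uStat (hh : IsLocalKernel k h) (hr : 0 ≤ r)
    (hP : IsPoissonProcess P ν Pr) (hH : MeasurableSet H) :
    MemLp (fun ω => uStat k (h r) (P ω ∩ H)) 2 Pr := by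
  obtain ⟨M, hM⟩ := hh.bounded
  simp_rw [uStat_inter k (hh.nonneg r hr)]
  exact (hP.memLp_toReal_tsum (measurable_restrictKernel (hh.measurable r hr) hH)
    (restrictKernel_comp_perm H (hh.symm r hr)) ENNReal.ofReal_ne_top
    (restrictKernel_le H (hM r hr))).const_mul _

theorem IsLocalKernel.integral_uStat (hh : IsLocalKernel k h) (hr : 0 ≤ r)
    (hP : IsPoissonProcess P ν Pr) (hH : MeasurableSet H) :
    ∫ ω, uStat k (h r) (P ω ∩ H) ∂Pr = ((k + 1)! : ℝ)⁻¹ *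
      (∫⁻ x, restrictKernel (h r) H x ∂(Measure.pi fun _ => ν)).toReal := by
  obtain ⟨M, hM⟩ := hh.bounded
  simp_rw [uStat_inter k (hh.nonneg r hr)]
  rw [integral_const_mul, hP.integral_toReal_tsum
    (measurable_restrictKernel (hh.measurable r hr) hH) ENNReal.ofReal_ne_top
    (restrictKernel_le H (hM r hr))]

theorem IsLocalKernel.covariance_uStat (hh : IsLocalKernel k h) (hr : 0 ≤ r)
    (hP : IsPoissonProcess P ν Pr) (hH : MeasurableSet H) (hH' : MeasurableSet H') :
    covariance (fun ω => uStat k (h r) (P ω ∩ H)) (fun ω => uStat k (h r) (P ω ∩ H')) Pr =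
      ∑ ℓ ∈ Finset.Icc 1 (k + 1), ((ℓ ! : ℝ) * ((k + 1 - ℓ)! : ℝ) ^ 2)⁻¹ *
        (overlapIntegral ν k ℓ (restrictKernel (h r) H) (restrictKernel (h r) H')).toReal := by
  obtain ⟨M, hM⟩ := hh.bounded
  simp_rw [uStat_inter k (hh.nonneg r hr)]
  rw [covariance_const_mul_left, covariance_const_mul_right, hP.covariance_toReal_tsum
    (measurable_restrictKernel (hh.measurable r hr) hH)
    (measurable_restrictKernel (hh.measurable r hr) hH')
    (restrictKernel_comp_perm H (hh.symm r hr)) (restrictKernel_comp_perm H' (hh.symm r hr))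
    ENNReal.ofReal_ne_top (restrictKernel_le H (hM r hr)) (restrictKernel_le H' (hM r hr)),
    ← mul_assoc, Finset.mul_sum]
  refine Finset.sum_congr rfl fun ℓ hℓ => ?_
  rw [← choose_mul_descFactorial_div (Finset.mem_Icc.1 hℓ).2]
  ring

end UStatistics

/-! ### Von Mises functions -/

namespace IsVonMises

variable {ψ : ℝ → ℝ} (hψ : IsVonMises ψ)

include hψ

theorem aux_pos {t : ℝ} (ht : 0 < t) : 0 < aux ψ t := inv_pos.2 (hψ.deriv_pos t ht)

theorem differentiableAt {t : ℝ} (ht : 0 < t) : DifferentiableAt ℝ ψ t :=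
  (hψ.contDiffOn.contDiffAt (Ioi_mem_nhds ht)).differentiableAt (by norm_num)

theorem differentiableAt_aux {t : ℝ} (ht : 0 < t) : DifferentiableAt ℝ (aux ψ) t := by
  have h1 : ContDiffOn ℝ 1 (deriv ψ) (Ioi 0) :=
    hψ.contDiffOn.deriv_of_isOpen isOpen_Ioi (by norm_num)
  have h2 : DifferentiableAt ℝ (deriv ψ) t :=
    (h1.contDiffAt (Ioi_mem_nhds ht)).differentiableAt (by norm_num)
  exact h2.inv (hψ.deriv_pos t ht).ne'

/-- The mean value inequality with `a' → 0`. The condition `(1/ψ')' → 0` enters the proof only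
through this slow variation of `a`. -/
theorem exists_abs_aux_sub_le {ε : ℝ} (hε : 0 < ε) :
    ∃ T : ℝ, 0 < T ∧ ∀ x, T ≤ x → ∀ y, T ≤ y → |aux ψ y - aux ψ x| ≤ ε * |y - x| := by
  have h1 : ∀ᶠ t in atTop, |deriv (aux ψ) t| < ε := by
    have := hψ.tendsto_deriv.abs
    rw [abs_zero] at this
    exact this.eventually_lt_const hε
  obtain ⟨T, hT⟩ := eventually_atTop.1 h1
  refine ⟨max T 1, by positivity, fun x hx y hy => ?_⟩
  refine Convex.norm_image_sub_le_of_norm_deriv_le (f := aux ψ) (s := Ici (max T 1))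
    (fun z hz => ?_) (fun z hz => ?_) (convex_Ici _) hx hy
  · exact hψ.differentiableAt_aux (lt_of_lt_of_le (by positivity) hz)
  · exact (hT z ((le_max_left _ _).trans hz)).le

theorem tendsto_aux_div : Tendsto (fun t => aux ψ t / t) atTop (𝓝 0) := by
  rw [Metric.tendsto_atTop]
  intro ε hε
  -- With Lipschitz constant `ε/4`, both `a(T)` and the increment `a(t) - a(T)` are at most `ε t /
  -- 4` for large `t`.
  obtain ⟨T, hT0, hT⟩ := hψ.exists_abs_aux_sub_le (half_pos (half_pos hε))
  refine ⟨max T (aux ψ T * (4 / ε)), fun t ht => ?_⟩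
  have ht1 : T ≤ t := (le_max_left _ _).trans ht
  have ht2 : aux ψ T * (4 / ε) ≤ t := (le_max_right _ _).trans ht
  have ht0 : 0 < t := hT0.trans_le ht1
  have h1 := abs_le.1 (hT T le_rfl t ht1)
  rw [abs_of_nonneg (sub_nonneg.2 ht1)] at h1
  rw [dist_zero_right, Real.norm_eq_abs, abs_of_pos (div_pos (hψ.aux_pos ht0) ht0),
    div_lt_iff₀ ht0]
  have h3 : aux ψ T ≤ ε / 4 * t := by
    calc aux ψ T = (aux ψ T * (4 / ε)) * (ε / 4) := by field_simp
      _ ≤ t * (ε / 4) := by gcongr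
      _ = ε / 4 * t := mul_comm _ _
  nlinarith [h1.2]

theorem strictMonoOn : StrictMonoOn ψ (Ici 0) := by
  refine strictMonoOn_of_deriv_pos (convex_Ici 0) hψ.continuousOn fun x hx => ?_
  rw [interior_Ici] at hx
  exact hψ.deriv_pos x hx

theorem generator_le {C s t : ℝ} (hC : 0 < C) (hs : 0 ≤ s) (hst : s ≤ t) :
    generator C ψ t ≤ generator C ψ s := by
  have := hψ.strictMonoOn.monotoneOn (mem_Ici.2 hs) (mem_Ici.2 (hs.trans hst)) hst
  unfold generator
  gcongr

/-- Once `a` is `1/p`-Lipschitz, `a(t + a(t) s) ≤ a(t)(1 + s/p)`. The left side below therefore has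
derivative `(1 + s/p)⁻¹` in `s`, no larger than the derivative `a(t)/a(t + a(t) s)` of the right
side. -/
theorem eventually_log_le {p : ℕ} (hp : 0 < p) :
    ∀ᶠ t in atTop, ∀ s, 0 ≤ s → p * Real.log (1 + s / p) ≤ ψ (t + aux ψ t * s) - ψ t := by
  have hp' : (0 : ℝ) < p := by exact_mod_cast hp
  obtain ⟨T, hT0, hT⟩ := hψ.exists_abs_aux_sub_le (inv_pos.2 hp')
  filter_upwards [eventually_ge_atTop T] with t ht s hs
  have ht0 : 0 < t := hT0.trans_le ht
  have ha : 0 < aux ψ t := hψ.aux_pos ht0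
  have hd : ∀ x, 0 ≤ x → HasDerivAt (fun x => ψ (t + aux ψ t * x) - p * Real.log (1 + x / p))
      (deriv ψ (t + aux ψ t * x) * aux ψ t - p * ((1 / p) / (1 + x / p))) x := by
    intro x hx
    have h1 : HasDerivAt (fun x => t + aux ψ t * x) (aux ψ t) x := by
      simpa using ((hasDerivAt_id x).const_mul (aux ψ t)).const_add t
    have h2 := (hψ.differentiableAt (t := t + aux ψ t * x) (by positivity)).hasDerivAt
    have h3 : HasDerivAt (fun x : ℝ => 1 + x / p) (1 / p) x :=
      ((hasDerivAt_id x).div_const (p : ℝ)).const_add 1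
    exact (h2.comp x h1).sub ((h3.log (by positivity)).const_mul (p : ℝ))
  have hmono : MonotoneOn (fun x => ψ (t + aux ψ t * x) - p * Real.log (1 + x / p)) (Ici 0) := by
    refine monotoneOn_of_deriv_nonneg (convex_Ici 0)
      (fun x hx => (hd x hx).continuousAt.continuousWithinAt)
      (fun x hx => (hd x (interior_subset hx)).differentiableAt.differentiableWithinAt)
      (fun x hx => ?_)
    have hx0 : 0 ≤ x := interior_subset hx
    rw [(hd x hx0).deriv, sub_nonneg]
    have hy : T ≤ t + aux ψ t * x := by nlinarith [mul_nonneg ha.le hx0]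
    have h1 := (abs_le.1 (hT t ht _ hy)).2
    rw [add_sub_cancel_left, abs_of_nonneg (by positivity)] at h1
    have h2 : 0 < aux ψ (t + aux ψ t * x) := hψ.aux_pos (hT0.trans_le hy)
    have h3 : deriv ψ (t + aux ψ t * x) = (aux ψ (t + aux ψ t * x))⁻¹ := (inv_inv _).symm
    have h4 : aux ψ (t + aux ψ t * x) ≤ aux ψ t * (1 + x / p) := by
      calc _ ≤ aux ψ t + (p : ℝ)⁻¹ * (aux ψ t * x) := by linarith
        _ = _ := by ring
    rw [h3, ← div_eq_inv_mul, le_div_iff₀ h2]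
    have h5 : (p : ℝ) * (1 / p / (1 + x / p)) = (1 + x / p)⁻¹ := by
      field_simp
    rw [h5, inv_mul_le_iff₀ (by positivity)]
    linarith
  have := hmono (mem_Ici.2 le_rfl) (mem_Ici.2 hs) hs
  simp only [mul_zero, add_zero, zero_div, Real.log_one, sub_zero] at this
  linarith

theorem eventually_generator_div_le {C : ℝ} (hC : 0 < C) {p : ℕ} (hp : 0 < p) :
    ∀ᶠ t in atTop, ∀ s, 0 ≤ s →
      generator C ψ (t + aux ψ t * s) / generator C ψ t ≤ ((1 + s / p) ^ p)⁻¹ := by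
  filter_upwards [hψ.eventually_log_le hp] with t ht s hs
  have h1 : (0 : ℝ) < 1 + s / p := by positivity
  unfold generator
  rw [mul_div_mul_left _ _ hC.ne', ← Real.exp_sub, ← Real.exp_log (pow_pos h1 p),
    ← Real.exp_neg, Real.log_pow]
  exact Real.exp_le_exp.2 (by linarith [ht s hs])

/-- On the window of radius `a(t) K` about `t` the function `a` changes by a small proportion only,
so `ψ' = 1/a` stays close to `1/a(t)`. The mean value inequality is applied to `y ↦ ψ(y) - y/a(t)`.
-/
theorem eventually_abs_sub_le (K : ℝ) {δ : ℝ} (hδ : 0 < δ) :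
    ∀ᶠ t in atTop, ∀ s, |s| ≤ K → |ψ (t + aux ψ t * s) - ψ t - s| ≤ δ := by
  wlog hK : 1 ≤ K generalizing K
  · filter_upwards [this 1 le_rfl] with t ht s hs
    exact ht s (hs.trans (le_of_not_ge hK))
  have hK0 : 0 < K := one_pos.trans_le hK
  -- The first entry gives `ε K ≤ 1/2`, hence `a(t) ≤ 2 a(y)` on the window; the second bounds the
  -- accumulated error `2 ε K²` by `δ`.
  set ε := min (1 / (2 * K)) (δ / (2 * K ^ 2)) with hε
  have hε0 : 0 < ε := by positivity
  have hε1 : ε * K ≤ 1 / 2 := by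
    calc ε * K ≤ 1 / (2 * K) * K := by gcongr; exact min_le_left _ _
      _ = 1 / 2 := by field_simp
  have hε2 : 2 * ε * K * K ≤ δ := by
    calc 2 * ε * K * K = ε * (2 * K ^ 2) := by ring
      _ ≤ δ / (2 * K ^ 2) * (2 * K ^ 2) := by gcongr; exact min_le_right _ _
      _ = δ := by field_simp
  obtain ⟨T, hT0, hT⟩ := hψ.exists_abs_aux_sub_le hε0
  -- This keeps the window inside `[t/2, ∞)`, hence inside `[T, ∞)` once `t ≥ 2T`.
  have h1 : ∀ᶠ t in atTop, aux ψ t / t < 1 / (2 * K) :=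
    hψ.tendsto_aux_div.eventually_lt_const (by positivity)
  filter_upwards [h1, eventually_ge_atTop (2 * T)] with t ht1 ht2 s hs
  have ht0 : 0 < t := by linarith
  have ha : 0 < aux ψ t := hψ.aux_pos ht0
  rw [div_lt_iff₀ ht0] at ht1
  have haK : aux ψ t * K ≤ t / 2 := by
    calc aux ψ t * K ≤ 1 / (2 * K) * t * K := by gcongr
      _ = t / 2 := by field_simp
  have hball : ∀ y ∈ Metric.closedBall t (aux ψ t * K), T ≤ y ∧ |y - t| ≤ aux ψ t * K := by
    intro y hy
    rw [Metric.mem_closedBall, Real.dist_eq] at hy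
    exact ⟨by linarith [(abs_le.1 hy).1], hy⟩
  have hd : ∀ y ∈ Metric.closedBall t (aux ψ t * K),
      HasDerivAt (fun y => ψ y - y / aux ψ t) (deriv ψ y - 1 / aux ψ t) y := by
    intro y hy
    exact (hψ.differentiableAt (hT0.trans_le (hball y hy).1)).hasDerivAt.sub
      ((hasDerivAt_id y).div_const _)
  have key := Convex.norm_image_sub_le_of_norm_hasDerivWithin_le (C := 2 * ε * K / aux ψ t)
    (fun y hy => (hd y hy).hasDerivWithinAt) (fun y hy => ?_) (convex_closedBall _ _)
    (Metric.mem_closedBall_self (by positivity))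
    (show t + aux ψ t * s ∈ Metric.closedBall t (aux ψ t * K) by
      rw [Metric.mem_closedBall, Real.dist_eq, add_sub_cancel_left, abs_mul, abs_of_pos ha]
      gcongr)
  · rw [Real.norm_eq_abs, add_sub_cancel_left, Real.norm_eq_abs, abs_mul, abs_of_pos ha] at key
    have e1 : ψ (t + aux ψ t * s) - (t + aux ψ t * s) / aux ψ t - (ψ t - t / aux ψ t) =
        ψ (t + aux ψ t * s) - ψ t - s := by
      field_simp
      ring
    rw [e1] at key
    refine key.trans ?_
    calc 2 * ε * K / aux ψ t * (aux ψ t * |s|) = 2 * ε * K * |s| := by field_simp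
      _ ≤ 2 * ε * K * K := by gcongr
      _ ≤ δ := hε2
  · obtain ⟨hy1, hy2⟩ := hball y hy
    have hay : 0 < aux ψ y := hψ.aux_pos (hT0.trans_le hy1)
    have h2 : |aux ψ y - aux ψ t| ≤ ε * K * aux ψ t :=
      calc |aux ψ y - aux ψ t| ≤ ε * |y - t| := hT t (by linarith) y hy1
        _ ≤ ε * (aux ψ t * K) := by gcongr
        _ = ε * K * aux ψ t := by ring
    have h3 : aux ψ t ≤ 2 * aux ψ y := by
      have := (abs_le.1 h2).1
      nlinarith
    have h4 : deriv ψ y = (aux ψ y)⁻¹ := (inv_inv _).symm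
    rw [h4, Real.norm_eq_abs, inv_eq_one_div, div_sub_div _ _ hay.ne' ha.ne', abs_div,
      abs_of_pos (mul_pos hay ha), one_mul, mul_one, abs_sub_comm, div_le_div_iff₀
      (mul_pos hay ha) ha]
    calc |aux ψ y - aux ψ t| * aux ψ t ≤ ε * K * aux ψ t * aux ψ t := by gcongr
      _ ≤ ε * K * (2 * aux ψ y) * aux ψ t := by gcongr
      _ = 2 * ε * K * (aux ψ y * aux ψ t) := by ring

theorem tendsto_generator_div {C : ℝ} (hC : 0 < C) {t s : ℕ → ℝ} {s' : ℝ}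
    (ht : Tendsto t atTop atTop) (hs : Tendsto s atTop (𝓝 s')) :
    Tendsto (fun n => generator C ψ (t n + aux ψ (t n) * s n) / generator C ψ (t n)) atTop
      (𝓝 (Real.exp (-s'))) := by
  have h1 : Tendsto (fun n => ψ (t n + aux ψ (t n) * s n) - ψ (t n) - s n) atTop (𝓝 0) := by
    rw [Metric.tendsto_nhds]
    intro ε hε
    have h2 : ∀ᶠ n in atTop, |s n| < |s'| + 1 := hs.abs.eventually_lt_const (by linarith)
    filter_upwards [h2, ht.eventually (hψ.eventually_abs_sub_le (|s'| + 1) (half_pos hε))]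
      with n hn1 hn2
    rw [dist_zero_right, Real.norm_eq_abs]
    exact (hn2 _ hn1.le).trans_lt (by linarith)
  have h3 : Tendsto (fun n => -(ψ (t n + aux ψ (t n) * s n) - ψ (t n))) atTop (𝓝 (-s')) := by
    have := (h1.add hs).neg
    simpa using this
  refine ((Real.continuous_exp.tendsto _).comp h3).congr fun n => ?_
  unfold generator
  rw [mul_div_mul_left _ _ hC.ne', ← Real.exp_sub, Function.comp]
  congr 1
  ring

end IsVonMises

/-! ### Rotund sets, their gauge and their support halfspaces -/

theorem mem_smul_supportHalfspace {d : ℕ} {D : Set (Euc d)} {t : ℝ} (ht : 0 < t) {θ x : Euc d} :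
    x ∈ t • supportHalfspace D θ ↔ t * supportFun D θ ≤ inner ℝ θ x := by
  rw [Set.mem_smul_set_iff_inv_smul_mem₀ ht.ne']
  change supportFun D θ ≤ inner ℝ θ (t⁻¹ • x) ↔ _
  rw [real_inner_smul_right, le_inv_mul_iff₀ ht]

theorem measurableSet_smul_supportHalfspace {d : ℕ} (D : Set (Euc d)) {t : ℝ} (ht : 0 < t)
    (θ : Euc d) : MeasurableSet (t • supportHalfspace D θ) := by
  have : t • supportHalfspace D θ = {x | t * supportFun D θ ≤ inner ℝ θ x} := by
    ext x; exact mem_smul_supportHalfspace ht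
  rw [this]
  exact measurableSet_le measurable_const (by fun_prop)

namespace IsRotund

variable {d : ℕ} {D : Set (Euc d)} (hD : IsRotund D)

include hD

theorem mem_nhds : D ∈ 𝓝 (0 : Euc d) := hD.isOpen.mem_nhds hD.zero_mem

theorem absorbent : Absorbent ℝ D := absorbent_nhds_zero hD.mem_nhds

theorem continuous_gauge : Continuous (gauge D) := _root_.continuous_gauge hD.convex hD.mem_nhds

theorem gauge_pos {x : Euc d} (hx : x ≠ 0) : 0 < gauge D x :=
  (_root_.gauge_pos hD.absorbent ((NormedSpace.isVonNBounded_iff ℝ).2 hD.isBounded)).2 hx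

theorem exists_norm_le : ∃ R : ℝ, 0 < R ∧ ∀ x, ‖x‖ ≤ R * gauge D x := by
  obtain ⟨R, hR0, hR⟩ := hD.isBounded.subset_closedBall_lt 0 0
  refine ⟨R, hR0, fun x => ?_⟩
  have := le_gauge_of_subset_closedBall hD.absorbent hR0.le hR (x := x)
  rwa [div_le_iff₀' hR0] at this

theorem contDiffAt_gauge {x : Euc d} (hx : x ≠ 0) : ContDiffAt ℝ 2 (gauge D) x :=
  hD.contDiffOn_gauge.contDiffAt (isOpen_compl_singleton.mem_nhds hx)

theorem bddAbove_inner (u : Euc d) : BddAbove ((fun x : Euc d => inner ℝ x u) '' D) := by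
  obtain ⟨R, hR⟩ := hD.isBounded.exists_norm_le
  refine ⟨R * ‖u‖, ?_⟩
  rintro _ ⟨x, hx, rfl⟩
  refine (real_inner_le_norm x u).trans ?_
  gcongr
  exact hR x hx

theorem inner_le_supportFun {x : Euc d} (hx : x ∈ closure D) (u : Euc d) :
    inner ℝ x u ≤ supportFun D u := by
  have hc : IsClosed {x : Euc d | inner ℝ x u ≤ supportFun D u} :=
    isClosed_le (by fun_prop) continuous_const
  exact hc.closure_subset_iff.2 (fun y hy => le_csSup (hD.bddAbove_inner u) ⟨y, hy, rfl⟩) hx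

theorem inner_le_gauge_mul (x u : Euc d) : inner ℝ x u ≤ gauge D x * supportFun D u := by
  rcases eq_or_ne x 0 with rfl | hx
  · simp
  have hg := hD.gauge_pos hx
  have h1 : (gauge D x)⁻¹ • x ∈ closure D := by
    rw [← gauge_le_one_iff_mem_closure hD.convex hD.mem_nhds,
      gauge_smul_of_nonneg (inv_nonneg.2 hg.le), smul_eq_mul, inv_mul_cancel₀ hg.ne']
  have h2 := hD.inner_le_supportFun h1 u
  rw [real_inner_smul_left, inv_mul_le_iff₀ hg] at h2
  exact h2

theorem supportFun_pos {u : Euc d} (hu : u ≠ 0) : 0 < supportFun D u := by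
  have hpos : 0 < inner ℝ u u := real_inner_self_pos.2 hu
  have h1 := hD.inner_le_gauge_mul u u
  have h2 := hD.gauge_pos hu
  by_contra hcon
  have := mul_nonpos_of_nonneg_of_nonpos h2.le (not_lt.1 hcon)
  linarith

/-- On `t H(θ)` one has `t ζ_D(θ) ≤ ⟨x, θ⟩ ≤ γ(x) ζ_D(θ)` with `ζ_D(θ) > 0`. As a consequence the
density there never exceeds `g(t)`. -/
theorem le_gauge_of_mem_smul {t : ℝ} (ht : 0 < t) {θ : Euc d} (hθ : θ ≠ 0) {x : Euc d}
    (hx : x ∈ t • supportHalfspace D θ) : t ≤ gauge D x := by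
  rw [mem_smul_supportHalfspace ht, real_inner_comm] at hx
  exact le_of_mul_le_mul_right (hx.trans (hD.inner_le_gauge_mul x θ)) (hD.supportFun_pos hθ)

theorem disjoint_smul_supportHalfspace_neg {t : ℝ} (ht : 0 < t) {θ : Euc d} (hθ : θ ≠ 0) :
    Disjoint (t • supportHalfspace D θ) (t • supportHalfspace D (-θ)) := by
  refine Set.disjoint_left.2 fun x h1 h2 => ?_
  rw [mem_smul_supportHalfspace ht] at h1 h2
  rw [inner_neg_left] at h2
  have := mul_pos ht (hD.supportFun_pos hθ)
  have := mul_pos ht (hD.supportFun_pos (neg_ne_zero.2 hθ))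
  linarith

theorem exists_inner_eq_supportFun (θ : Euc d) :
    ∃ x ∈ closure D, inner ℝ x θ = supportFun D θ := by
  have hK : IsCompact (closure D) := hD.isBounded.isCompact_closure
  obtain ⟨x, hx, hmax⟩ := hK.exists_isMaxOn ⟨0, subset_closure hD.zero_mem⟩
    (f := fun x : Euc d => inner ℝ x θ) (by fun_prop)
  refine ⟨x, hx, le_antisymm (hD.inner_le_supportFun hx θ) ?_⟩
  refine csSup_le ⟨_, 0, hD.zero_mem, rfl⟩ ?_
  rintro _ ⟨y, hy, rfl⟩
  exact hmax (subset_closure hy)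

/-- The gradient of the support function is the point of contact. -/
theorem supportPoint_mem_closure {θ : Euc d} (h0 : supportPoint D θ ≠ 0) :
    supportPoint D θ ∈ closure D := by
  -- The gradient is zero by convention where `ζ_D` is not differentiable; a nonzero value excludes
  -- this.
  have hdiff : DifferentiableAt ℝ (supportFun D) θ := by
    by_contra h
    exact h0 (gradient_eq_zero_of_not_differentiableAt h)
  obtain ⟨x, hx, hxθ⟩ := hD.exists_inner_eq_supportFun θ
  have h1 : HasFDerivAt (fun u => supportFun D u - inner ℝ x u)
      (InnerProductSpace.toDual ℝ (Euc d) (supportPoint D θ) - innerSL ℝ x) θ :=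
    hdiff.hasGradientAt.hasFDerivAt.sub (innerSL ℝ x).hasFDerivAt
  -- For a contact point `x`, the function `ζ_D - ⟨x, ·⟩` is nonnegative and vanishes at `θ`, so its
  -- derivative there is zero.
  have hmin : IsLocalMin (fun u => supportFun D u - inner ℝ x u) θ := by
    refine Eventually.of_forall fun u => ?_
    simp only
    rw [hxθ, sub_self, sub_nonneg]
    exact hD.inner_le_supportFun hx u
  have h2 := hmin.hasFDerivAt_eq_zero h1
  have h3 : supportPoint D θ = x := by
    refine ext_inner_right ℝ fun y => ?_
    have := DFunLike.congr_fun h2 y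
    simpa [sub_eq_zero] using this
  rw [h3]
  exact hx

/-- The function `ζ_D(θ) γ - ⟨θ, ·⟩` is nonnegative everywhere and nonpositive at a contact point,
which is thus a minimum. So the contact point determines the direction of `θ`. -/
theorem gradient_gauge_of_mem {θ x : Euc d} (hx0 : x ≠ 0)
    (hx : gauge D x ≤ 1) (hxH : x ∈ supportHalfspace D θ) :
    ∀ y, supportFun D θ * fderiv ℝ (gauge D) x y = inner ℝ θ y := by
  have h1 : HasFDerivAt (fun y => supportFun D θ * gauge D y - inner ℝ θ y)
      (supportFun D θ • fderiv ℝ (gauge D) x - innerSL ℝ θ) x :=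
    (((hD.contDiffAt_gauge hx0).differentiableAt (by norm_num)).hasFDerivAt.const_mul _).sub
      (innerSL ℝ θ).hasFDerivAt
  have hxH' : supportFun D θ ≤ inner ℝ θ x := hxH
  have hmin : IsLocalMin (fun y => supportFun D θ * gauge D y - inner ℝ θ y) x := by
    refine Eventually.of_forall fun y => ?_
    simp only
    have e1 := hD.inner_le_gauge_mul y θ
    rw [real_inner_comm] at e1
    have e2 : 0 ≤ supportFun D θ := by
      have := hD.inner_le_supportFun (subset_closure hD.zero_mem) θ
      simpa using this
    nlinarith
  have h2 := hmin.hasFDerivAt_eq_zero h1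
  intro y
  have := DFunLike.congr_fun h2 y
  simpa [sub_eq_zero] using this

/-- Two different halfspaces supporting a rotund set intersect away from its closure. -/
theorem exists_one_add_le_gauge {θ₁ θ₂ : Euc d} (h1 : ‖θ₁‖ = 1) (h2 : ‖θ₂‖ = 1)
    (hne : θ₁ ≠ θ₂) :
    ∃ δ : ℝ, 0 < δ ∧ ∀ x ∈ supportHalfspace D θ₁ ∩ supportHalfspace D θ₂, 1 + δ ≤ gauge D x := by
  have hθ₁ : θ₁ ≠ 0 := fun h => by simp [h] at h1
  have hθ₂ : θ₂ ≠ 0 := fun h => by simp [h] at h2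
  have hlt : ∀ x ∈ supportHalfspace D θ₁ ∩ supportHalfspace D θ₂, 1 < gauge D x := by
    rintro x ⟨hx1, hx2⟩
    by_contra hcon
    rw [not_lt] at hcon
    have hp1 := hD.supportFun_pos hθ₁
    have hp2 := hD.supportFun_pos hθ₂
    have hx0 : x ≠ 0 := by
      rintro rfl
      have : supportFun D θ₁ ≤ inner ℝ θ₁ (0 : Euc d) := hx1
      simp only [inner_zero_right] at this
      linarith
    -- At a common contact point both unit vectors are positive multiples of the same derivative of
    -- the gauge, hence equal.
    have e1 := hD.gradient_gauge_of_mem hx0 hcon hx1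
    have e2 := hD.gradient_gauge_of_mem hx0 hcon hx2
    have e3 : supportFun D θ₂ • θ₁ = supportFun D θ₁ • θ₂ := by
      refine ext_inner_right ℝ fun y => ?_
      rw [real_inner_smul_left, real_inner_smul_left, ← e1, ← e2]
      ring
    have e4 := congrArg norm e3
    rw [norm_smul, norm_smul, h1, h2, mul_one, mul_one, Real.norm_eq_abs, Real.norm_eq_abs,
      abs_of_pos hp1, abs_of_pos hp2] at e4
    rw [e4] at e3
    exact hne (smul_right_injective _ hp1.ne' e3)
  obtain ⟨R, hR0, hR⟩ := hD.exists_norm_le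
  -- The cut at gauge `2` gives a compact set, on which the minimum of the gauge is attained; beyond
  -- the cut the gauge exceeds `2`, which is at least that minimum.
  let K : Set (Euc d) := supportHalfspace D θ₁ ∩ supportHalfspace D θ₂ ∩ {x | gauge D x ≤ 2}
  have hcl : ∀ θ : Euc d, IsClosed (supportHalfspace D θ) := fun θ =>
    isClosed_le continuous_const (by fun_prop)
  have hK : IsCompact K := by
    refine Metric.isCompact_of_isClosed_isBounded (((hcl _).inter (hcl _)).inter
      (isClosed_le hD.continuous_gauge continuous_const)) ?_
    refine (Metric.isBounded_closedBall (x := (0 : Euc d)) (r := R * 2)).subset ?_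
    rintro x ⟨_, hx⟩
    rw [mem_closedBall_zero_iff]
    exact (hR x).trans (by gcongr; exact hx)
  rcases K.eq_empty_or_nonempty with hKe | hKn
  · refine ⟨1, one_pos, fun x hx => ?_⟩
    by_contra hcon
    have : x ∈ K := ⟨hx, by change gauge D x ≤ 2; linarith⟩
    rw [hKe] at this
    exact this
  · obtain ⟨x₀, hx₀, hmin⟩ := hK.exists_isMinOn hKn hD.continuous_gauge.continuousOn
    refine ⟨gauge D x₀ - 1, sub_pos.2 (hlt x₀ hx₀.1), fun x hx => ?_⟩
    rw [add_sub_cancel]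
    by_cases hx2 : gauge D x ≤ 2
    · exact hmin (show x ∈ K from ⟨hx, hx2⟩)
    · exact (show gauge D x₀ ≤ 2 from hx₀.2).trans (not_le.1 hx2).le

/-- The base point `z n` moves with `n`, so differentiability at `p` would not suffice; strict
differentiability, a consequence of the `C²` regularity, does. -/
theorem tendsto_gauge_sub {p : Euc d} (hp : p ≠ 0) {z : ℕ → Euc d} {ρ b : ℕ → ℝ} {c : ℝ}
    (y : Euc d) (hz : Tendsto z atTop (𝓝 p)) (hρ : Tendsto ρ atTop (𝓝 0))
    (hb : Tendsto (fun n => b n * ρ n) atTop (𝓝 c)) :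
    Tendsto (fun n => b n * (gauge D (z n + ρ n • y) - gauge D (z n))) atTop
      (𝓝 (c * inner ℝ (gradient (gauge D) p) y)) := by
  rw [inner_gradient_left]
  have hs := ((hD.contDiffAt_gauge hp).hasStrictFDerivAt (by norm_num)).isLittleO
  have hz' : Tendsto (fun n => z n + ρ n • y) atTop (𝓝 p) := by
    simpa using hz.add (hρ.smul_const y)
  have h1 := hs.comp_tendsto (hz'.prodMk_nhds hz)
  simp only [Function.comp_def, add_sub_cancel_left] at h1
  have h2 := (Asymptotics.isBigO_refl b atTop).mul_isLittleO h1.norm_right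
  have h3 : (fun n => b n * ‖ρ n • y‖) =O[atTop] fun _ => (1 : ℝ) := by
    have : Tendsto (fun n => |b n * ρ n| * ‖y‖) atTop (𝓝 (|c| * ‖y‖)) := hb.abs.mul_const _
    refine Asymptotics.IsBigO.trans (Asymptotics.isBigO_of_le _ fun n => ?_)
      (this.isBigO_one ℝ)
    rw [norm_smul, norm_mul, norm_mul, norm_norm, norm_mul, norm_norm, Real.norm_eq_abs,
      Real.norm_eq_abs, norm_abs_eq_norm, Real.norm_eq_abs, abs_mul, mul_assoc]
  have h4 := (Asymptotics.isLittleO_one_iff ℝ).1 (h2.trans_isBigO h3)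
  have h5 := h4.add (hb.mul_const (fderiv ℝ (gauge D) p y))
  rw [zero_add] at h5
  refine h5.congr fun n => ?_
  rw [map_smul, smul_eq_mul]
  ring

end IsRotund

/-! ### Horizontal and vertical coordinates -/

/-- The horizontal part `u` of `x = (u, v)`. -/
def horiz {m : ℕ} (x : Euc (m + 1)) : Euc m := WithLp.toLp 2 fun i => x (Fin.castSucc i)

section Coordinates

variable {m : ℕ}

@[simp]
theorem joinPt_castSucc (u : Euc m) (v : ℝ) (i : Fin m) : joinPt u v (Fin.castSucc i) = u i := by
  simp [joinPt]

@[simp]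
theorem joinPt_last (u : Euc m) (v : ℝ) : joinPt u v (Fin.last m) = v := by
  simp [joinPt]

@[simp]
theorem vert_joinPt (u : Euc m) (v : ℝ) : vert (joinPt u v) = v := joinPt_last u v

@[simp]
theorem horiz_joinPt (u : Euc m) (v : ℝ) : horiz (joinPt u v) = u := by
  ext i; simp [horiz]

theorem joinPt_horiz_vert (x : Euc (m + 1)) : joinPt (horiz x) (vert x) = x := by
  ext i
  refine Fin.lastCases ?_ (fun j => ?_) i
  · simp [vert]
  · simp [horiz]

theorem smul_joinPt (c : ℝ) (u : Euc m) (v : ℝ) : c • joinPt u v = joinPt (c • u) (c * v) := by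
  ext i
  refine Fin.lastCases ?_ (fun j => ?_) i <;> simp

theorem joinPt_add (u u' : Euc m) (v v' : ℝ) :
    joinPt (u + u') (v + v') = joinPt u v + joinPt u' v' := by
  ext i
  refine Fin.lastCases ?_ (fun j => ?_) i <;> simp

theorem horizSq_eq (x : Euc (m + 1)) : horizSq x = ‖horiz x‖ ^ 2 := by
  rw [EuclideanSpace.norm_sq_eq, horizSq]
  simp [horiz]

theorem norm_le_add (x : Euc (m + 1)) : ‖x‖ ≤ ‖horiz x‖ + |vert x| := by
  refine abs_le_of_sq_le_sq' ?_ (by positivity) |>.2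
  rw [EuclideanSpace.norm_sq_eq, Fin.sum_univ_castSucc, add_sq, EuclideanSpace.norm_sq_eq]
  have : 0 ≤ 2 * ‖horiz x‖ * |vert x| := by positivity
  have h2 : ‖x (Fin.last m)‖ ^ 2 = |vert x| ^ 2 := rfl
  have h3 : ∀ i, ‖x (Fin.castSucc i)‖ ^ 2 = ‖horiz x i‖ ^ 2 := fun i => rfl
  simp only [h3]
  linarith

theorem continuous_joinPt : Continuous fun p : Euc m × ℝ => joinPt p.1 p.2 := by
  refine (PiLp.continuous_toLp 2 _).comp (continuous_pi fun i => ?_)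
  refine Fin.lastCases ?_ (fun j => ?_) i
  · simpa using continuous_snd
  · simp only [Fin.snoc_castSucc]
    fun_prop

@[fun_prop]
theorem continuous_vert : Continuous (vert (m := m)) := by
  unfold vert; fun_prop

theorem vert_add (x y : Euc (m + 1)) : vert (x + y) = vert x + vert y := rfl

theorem vert_smul (c : ℝ) (x : Euc (m + 1)) : vert (c • x) = c * vert x := rfl

/-- The linear map `(u, v) ↦ (αu, βv)`. -/
def diagMap (m : ℕ) (α β : ℝ) : Euc (m + 1) →ₗ[ℝ] Euc (m + 1) where
  toFun x := joinPt (α • horiz x) (β * vert x)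
  map_add' x y := by
    rw [← joinPt_add, ← smul_add, vert_add, mul_add]
    rfl
  map_smul' c x := by
    rw [RingHom.id_apply, smul_joinPt, vert_smul, smul_smul, mul_comm c α, mul_left_comm β,
      mul_smul]
    rfl

theorem diagMap_apply (α β : ℝ) (x : Euc (m + 1)) :
    diagMap m α β x = joinPt (α • horiz x) (β * vert x) := rfl

theorem det_diagMap (α β : ℝ) : LinearMap.det (diagMap m α β) = α ^ m * β := by
  let b := (EuclideanSpace.basisFun (Fin (m + 1)) ℝ).toBasis
  have h : diagMap m α β = Matrix.toLin b b
      (Matrix.diagonal (Fin.snoc (α := fun _ => ℝ) (fun _ => α) β)) := by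
    rw [← Matrix.toLin_toMatrix b b (diagMap m α β)]
    congr 1
    ext i j
    rw [LinearMap.toMatrix_apply]
    simp only [b, OrthonormalBasis.coe_toBasis, OrthonormalBasis.coe_toBasis_repr_apply,
      EuclideanSpace.basisFun_apply, EuclideanSpace.basisFun_repr, diagMap_apply]
    refine Fin.lastCases ?_ (fun i => ?_) i
    · simp [vert, Matrix.diagonal_apply, PiLp.single_apply]
    · simp [horiz, Matrix.diagonal_apply, PiLp.single_apply]
  rw [h, LinearMap.det_toLin, Matrix.det_diagonal, Fin.prod_univ_castSucc]
  simp

end Coordinates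

/-! ### Initial transformations -/

namespace IsInitialTransformation

variable {m : ℕ} {D : Set (Euc (m + 1))} {θ : Euc (m + 1)}
  {A : Euc (m + 1) ≃ₗ[ℝ] Euc (m + 1)} (hA : IsInitialTransformation D θ A)

include hA

theorem mem_smul_supportHalfspace {t : ℝ} (ht : 0 < t) {x : Euc (m + 1)} :
    x ∈ t • supportHalfspace D θ ↔ t ≤ vert (A.symm x) := by
  rw [Set.mem_smul_set_iff_inv_smul_mem₀ ht.ne', ← hA.map_halfspace]
  have : t⁻¹ • x ∈ A '' {x | 1 ≤ vert x} ↔ 1 ≤ vert (A.symm (t⁻¹ • x)) := by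
    constructor
    · rintro ⟨y, hy, hyx⟩
      rw [← hyx, LinearEquiv.symm_apply_apply]
      exact hy
    · intro h
      exact ⟨_, h, LinearEquiv.apply_symm_apply _ _⟩
  rw [this, map_smul, vert_smul, le_inv_mul_iff₀ ht, mul_one]

theorem supportPoint_ne_zero : supportPoint D θ ≠ 0 := by
  rw [← hA.map_axis, ne_eq, LinearEquiv.map_eq_zero_iff]
  intro h
  have := congrArg vert h
  rw [vert_joinPt] at this
  exact one_ne_zero this

variable (hD : IsRotund D) (hθ : θ ≠ 0)

include hD hθ

theorem one_le_gauge (u : Euc m) : 1 ≤ gauge D (A (joinPt u 1)) := by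
  refine hD.le_gauge_of_mem_smul one_pos hθ ?_
  rw [hA.mem_smul_supportHalfspace one_pos]
  simp

/-- The point `A e_d = p(θ)` is nonzero, hence a genuine gradient and a contact point in the closure
of `D`; the other inequality holds on all of `H(θ)`. -/
theorem gauge_axis : gauge D (A (joinPt 0 1)) = 1 := by
  refine le_antisymm ?_ (hA.one_le_gauge hD hθ 0)
  rw [gauge_le_one_iff_mem_closure hD.convex hD.mem_nhds, hA.map_axis]
  exact hD.supportPoint_mem_closure hA.supportPoint_ne_zero

/-- The initial position gives quadratic growth near the axis, and convexity along rays propagates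
it to linear growth farther away. -/
theorem exists_min_le_gauge : ∃ c : ℝ, 0 < c ∧ c ≤ 1 / 4 ∧
    ∀ u, 1 + c * min (‖u‖ ^ 2) ‖u‖ ≤ gauge D (A (joinPt u 1)) := by
  have h1 : ∀ᶠ u in 𝓝 (0 : Euc m), ‖u‖ ^ 2 / 4 ≤ gauge D (A (joinPt u 1)) - 1 := by
    have h2 := hA.initial_position.isLittleO.def (c := 1 / 2) (by norm_num)
    filter_upwards [h2] with u hu
    rw [hA.gauge_axis hD hθ, Pi.sub_apply, Real.norm_eq_abs, Real.norm_eq_abs,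
      abs_of_nonneg (a := ‖u‖ ^ 2 / 2) (by positivity)] at hu
    have := (abs_le.1 hu).1
    linarith
  obtain ⟨δ, hδ0, hδ⟩ := Metric.eventually_nhds_iff.1 h1
  set ε := δ / 2 with hε
  have hε0 : 0 < ε := half_pos hδ0
  have hnear : ∀ u : Euc m, ‖u‖ ≤ ε → ‖u‖ ^ 2 / 4 ≤ gauge D (A (joinPt u 1)) - 1 := by
    intro u hu
    refine hδ ?_
    rw [dist_zero_right]
    linarith
  -- `1/4` is the quadratic constant valid up to radius `ε`, and `ε/4` is the slope of the chord
  -- reaching the excess `ε²/4` at that radius.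
  refine ⟨min (1 / 4) (ε / 4), by positivity, min_le_left _ _, fun u => ?_⟩
  rcases le_total ‖u‖ ε with hu | hu
  · have h2 : min (1 / 4) (ε / 4) * min (‖u‖ ^ 2) ‖u‖ ≤ 1 / 4 * ‖u‖ ^ 2 := by
      gcongr
      · exact min_le_left _ _
      · exact min_le_left _ _
    linarith [hnear u hu]
  · have hu0 : 0 < ‖u‖ := hε0.trans_le hu
    have h2 : min (1 / 4) (ε / 4) * min (‖u‖ ^ 2) ‖u‖ ≤ ε / 4 * ‖u‖ := by
      gcongr
      · exact min_le_right _ _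
      · exact min_le_right _ _
    set s := ε / ‖u‖ with hs
    have hs0 : 0 < s := div_pos hε0 hu0
    have hs1 : s ≤ 1 := (div_le_one hu0).2 hu
    have hsu : ‖s • u‖ = ε := by
      rw [norm_smul, Real.norm_eq_abs, abs_of_pos hs0, hs, div_mul_cancel₀ _ hu0.ne']
    have h3 := hnear (s • u) hsu.le
    have h4 : joinPt (s • u) 1 = s • joinPt u 1 + (1 - s) • joinPt (0 : Euc m) 1 := by
      rw [smul_joinPt, smul_joinPt, ← joinPt_add]
      simp
    have h5 : gauge D (A (joinPt (s • u) 1)) ≤ s * gauge D (A (joinPt u 1)) + (1 - s) := by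
      rw [h4, map_add, map_smul, map_smul]
      refine (gauge_add_le hD.convex hD.absorbent _ _).trans ?_
      rw [gauge_smul_of_nonneg hs0.le, gauge_smul_of_nonneg (sub_nonneg.2 hs1),
        hA.gauge_axis hD hθ]
      simp
    rw [hsu] at h3
    have h6 : ε ^ 2 / 4 ≤ s * (gauge D (A (joinPt u 1)) - 1) := by linarith
    have h7 : s * (ε / 4 * ‖u‖) = ε ^ 2 / 4 := by
      rw [hs]; field_simp
    rw [← h7] at h6
    linarith [le_of_mul_le_mul_left h6 hs0]

/-- The rescaled excess of the gauge in terms of its values at height one. -/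
theorem excess_eq {a t : ℝ} (ha : 0 < a) {x : Euc (m + 1)}
    (hv : 0 < t + a * vert x) :
    (gauge D (A (joinPt (√(a * t) • horiz x) (t + a * vert x))) - t) / a =
      vert x + (t + a * vert x) / a *
        (gauge D (A (joinPt ((√(a * t) / (t + a * vert x)) • horiz x) 1)) -
          gauge D (A (joinPt 0 1))) := by
  have h1 : joinPt (√(a * t) • horiz x) (t + a * vert x) =
      (t + a * vert x) • joinPt ((√(a * t) / (t + a * vert x)) • horiz x) 1 := by
    rw [smul_joinPt, smul_smul, mul_div_cancel₀ _ hv.ne', mul_one]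
  rw [h1, map_smul, gauge_smul_of_nonneg hv.le, hA.gauge_axis hD hθ, smul_eq_mul]
  field_simp
  ring

/-- With `b = t + a v`, `a ≤ t` and `w` the horizontal coordinate at height one, `(b/a)‖w‖² =
(t/b)‖u‖² ≥ ‖u‖²/(1+v)` and `(b/a)‖w‖ = √(t/a)‖u‖ ≥ ‖u‖`. Both are at least `‖u‖ - (1 + v)`, and `c
≤ 1/4` lets the term `1 + v` absorb the loss `2c(1 + v)`. -/
theorem exists_le_excess : ∃ c : ℝ, 0 < c ∧ ∀ a t : ℝ, 0 < a → a ≤ t → ∀ x : Euc (m + 1),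
    0 ≤ vert x →
    c * (1 + ‖x‖) ≤
      1 + (gauge D (A (joinPt (√(a * t) • horiz x) (t + a * vert x))) - t) / a := by
  obtain ⟨c, hc0, hc4, hc⟩ := hA.exists_min_le_gauge hD hθ
  refine ⟨c, hc0, fun a t ha hat x hx => ?_⟩
  have ht : 0 < t := ha.trans_le hat
  have hv : 0 < t + a * vert x := by positivity
  rw [hA.excess_eq hD hθ ha hv, hA.gauge_axis hD hθ]
  set b := t + a * vert x with hb
  set w := (√(a * t) / b) • horiz x with hw
  have hnw : ‖w‖ = √(a * t) / b * ‖horiz x‖ := by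
    rw [hw, norm_smul, Real.norm_eq_abs, abs_of_nonneg (by positivity)]
  have hsq : √(a * t) ^ 2 = a * t := Real.sq_sqrt (by positivity)
  have hba : b ≤ t * (1 + vert x) := by
    rw [hb, mul_add, mul_one]; gcongr
  have h1 : ‖horiz x‖ - (1 + vert x) ≤ b / a * ‖w‖ ^ 2 := by
    have e1 : b / a * ‖w‖ ^ 2 = t / b * ‖horiz x‖ ^ 2 := by
      rw [hnw, mul_pow, div_pow, hsq]
      field_simp
    have e2 : (1 + vert x)⁻¹ ≤ t / b := by
      rw [inv_eq_one_div, div_le_div_iff₀ (by positivity) hv, one_mul]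
      exact hba
    have e3 : ‖horiz x‖ - (1 + vert x) ≤ (1 + vert x)⁻¹ * ‖horiz x‖ ^ 2 := by
      rw [le_inv_mul_iff₀ (by positivity)]
      nlinarith [sq_nonneg (‖horiz x‖ - (1 + vert x)), norm_nonneg (horiz x)]
    rw [e1]
    exact e3.trans (by gcongr)
  have h2 : ‖horiz x‖ - (1 + vert x) ≤ b / a * ‖w‖ := by
    have e1 : b / a * ‖w‖ = √(a * t) / a * ‖horiz x‖ := by
      rw [hnw]; field_simp
    have e2 : 1 ≤ √(a * t) / a := by
      rw [one_le_div ha]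
      exact Real.le_sqrt_of_sq_le (by nlinarith)
    rw [e1]
    have := mul_le_mul_of_nonneg_right e2 (norm_nonneg (horiz x))
    linarith
  have h3 : ‖horiz x‖ - (1 + vert x) ≤ b / a * min (‖w‖ ^ 2) ‖w‖ := by
    rcases min_choice (‖w‖ ^ 2) ‖w‖ with h | h <;> rw [h]
    · exact h1
    · exact h2
  have h4 : b / a * (c * min (‖w‖ ^ 2) ‖w‖) ≤ b / a * (gauge D (A (joinPt w 1)) - 1) := by
    gcongr
    linarith [hc w]
  have h5 := mul_le_mul_of_nonneg_left h3 hc0.le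
  have h6 := norm_le_add x
  rw [abs_of_nonneg hx] at h6
  have h7 := mul_le_mul_of_nonneg_left h6 hc0.le
  nlinarith

/-- At height one the horizontal coordinate is of order `√(a/t) → 0`, so the initial position
applies; multiplication by `(t + a v)/a` restores the scale and leaves `‖u‖²/2`. -/
theorem tendsto_excess {a t : ℕ → ℝ} (ha : ∀ n, 0 < a n) (ht : ∀ n, 0 < t n)
    (hat : Tendsto (fun n => a n / t n) atTop (𝓝 0)) (x : Euc (m + 1)) (hx : 0 ≤ vert x) :
    Tendsto (fun n => (gauge D (A (joinPt (√(a n * t n) • horiz x) (t n + a n * vert x))) - t n)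
      / a n) atTop (𝓝 (horizSq x / 2 + vert x)) := by
  have hv : ∀ n, 0 < t n + a n * vert x := fun n => by
    have := mul_nonneg (ha n).le hx
    linarith [ht n]
  simp_rw [fun n => hA.excess_eq hD hθ (ha n) (hv n)]
  rw [add_comm (horizSq x / 2)]
  refine tendsto_const_nhds.add ?_
  -- the horizontal coordinate at height one tends to zero
  have hquot : Tendsto (fun n => t n / (t n + a n * vert x)) atTop (𝓝 1) := by
    have h1 : Tendsto (fun n => (1 + a n / t n * vert x)⁻¹) atTop (𝓝 (1 + 0 * vert x)⁻¹) :=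
      ((hat.mul_const _).const_add _).inv₀ (by simp)
    rw [zero_mul, add_zero, inv_one] at h1
    refine h1.congr fun n => ?_
    have := (ht n).ne'
    have := (hv n).ne'
    field_simp
  have hsq : ∀ n, √(a n * t n) ^ 2 = a n * t n := fun n =>
    Real.sq_sqrt (mul_pos (ha n) (ht n)).le
  have hcoef : Tendsto (fun n => √(a n * t n) / (t n + a n * vert x)) atTop (𝓝 0) := by
    have h1 : Tendsto (fun n => √(a n / t n * (t n / (t n + a n * vert x)) ^ 2)) atTop (𝓝 0) := by
      have := (hat.mul (hquot.pow 2)).sqrt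
      simpa using this
    refine h1.congr fun n => ?_
    rw [← Real.sqrt_sq (div_nonneg (Real.sqrt_nonneg _) (hv n).le), div_pow (√(a n * t n)), hsq]
    congr 1
    have := (ht n).ne'
    have := (hv n).ne'
    field_simp
  have hw : Tendsto (fun n => (√(a n * t n) / (t n + a n * vert x)) • horiz x) atTop
      (𝓝 (0 : Euc m)) := by
    simpa using hcoef.smul_const (horiz x)
  have heq := hA.initial_position.comp_tendsto hw
  have heq2 := (Asymptotics.IsEquivalent.refl (u := fun n => (t n + a n * vert x) / a n)
    (l := atTop)).mul heq
  refine heq2.symm.tendsto_nhds ?_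
  have h1 : Tendsto (fun n => t n / (t n + a n * vert x) * (horizSq x / 2)) atTop
      (𝓝 (1 * (horizSq x / 2))) := hquot.mul_const _
  rw [one_mul] at h1
  refine h1.congr fun n => ?_
  simp only [Pi.mul_apply, Function.comp]
  rw [norm_smul, mul_pow, Real.norm_eq_abs, sq_abs, div_pow, hsq, horizSq_eq]
  have := (ha n).ne'
  have := (hv n).ne'
  field_simp

omit hD hθ in
theorem tendsto_scaled_point {a t : ℕ → ℝ} (ht : ∀ n, 0 < t n)
    (hat : Tendsto (fun n => a n / t n) atTop (𝓝 0)) (x : Euc (m + 1)) :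
    Tendsto (fun n => (t n)⁻¹ • A (joinPt (√(a n * t n) • horiz x) (t n + a n * vert x))) atTop
      (𝓝 (supportPoint D θ)) := by
  have hAc : Continuous A := 
    LinearMap.continuous_of_finiteDimensional (A : Euc (m + 1) →ₗ[ℝ] Euc (m + 1))
  rw [← hA.map_axis]
  have h1 : ∀ n, (t n)⁻¹ • A (joinPt (√(a n * t n) • horiz x) (t n + a n * vert x)) =
      A (joinPt (√(a n / t n) • horiz x) (1 + a n / t n * vert x)) := by
    intro n
    rw [← map_smul, smul_joinPt, smul_smul]
    congr 2
    · congr 1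
      have : (t n)⁻¹ = √((t n)⁻¹ ^ 2) := (Real.sqrt_sq (inv_pos.2 (ht n)).le).symm
      rw [this, ← Real.sqrt_mul (by positivity)]
      congr 1
      have := (ht n).ne'
      field_simp
    · have := (ht n).ne'
      field_simp
  simp_rw [h1]
  refine (hAc.tendsto _).comp ?_
  have h2 : Tendsto (fun n => (√(a n / t n) • horiz x, 1 + a n / t n * vert x)) atTop
      (𝓝 ((0 : Euc m), (1 : ℝ))) := by
    refine Tendsto.prodMk_nhds ?_ ?_
    · have := hat.sqrt.smul_const (horiz x)
      simpa using this
    · have := (hat.mul_const (vert x)).const_add 1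
      simpa using this
  exact (continuous_joinPt.tendsto _).comp h2

/-- The rescaled excess of the gauge at the points of a small cluster. -/
theorem tendsto_excess_add {a t r : ℕ → ℝ} {c : ℝ} (ha : ∀ n, 0 < a n) (ht : ∀ n, 0 < t n)
    (hat : Tendsto (fun n => a n / t n) atTop (𝓝 0))
    (hrt : Tendsto (fun n => r n / t n) atTop (𝓝 0))
    (hra : Tendsto (fun n => r n / a n) atTop (𝓝 c)) (x : Euc (m + 1)) (hx : 0 ≤ vert x)
    (y : Euc (m + 1)) :
    Tendsto (fun n =>
        (gauge D (A (joinPt (√(a n * t n) • horiz x) (t n + a n * vert x)) + r n • y) - t n)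
      / a n) atTop
      (𝓝 (horizSq x / 2 + vert x + c * inner ℝ (gradient (gauge D) (supportPoint D θ)) y)) := by
  -- By homogeneity everything is divided by `t n`: the base points tend to `p(θ)`, the displacement
  -- is `r n / t n`, and its product with the prefactor `t n / a n` tends to `c`.
  have h1 := hD.tendsto_gauge_sub hA.supportPoint_ne_zero (b := fun n => t n / a n) (c := c) y
    (hA.tendsto_scaled_point ht hat x) hrt (hra.congr fun n => by
      have := (ha n).ne'
      have := (ht n).ne'
      field_simp)
  refine ((hA.tendsto_excess hD hθ ha ht hat x hx).add h1).congr fun n => ?_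
  set z := A (joinPt (√(a n * t n) • horiz x) (t n + a n * vert x))
  have h2 : (t n)⁻¹ • z + (r n / t n) • y = (t n)⁻¹ • (z + r n • y) := by
    rw [smul_add, smul_smul, div_eq_inv_mul]
  have h3 : 0 ≤ (t n)⁻¹ := (inv_pos.2 (ht n)).le
  rw [h2, gauge_smul_of_nonneg h3, gauge_smul_of_nonneg h3, smul_eq_mul, smul_eq_mul]
  have := (ha n).ne'
  have := (ht n).ne'
  field_simp
  ring

end IsInitialTransformation

/-! ### Integrals over powers of a measure space -/

section FinPi

variable {E : Type*} [MeasurableSpace E]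

theorem lintegral_pi_fin_succ (ν : Measure E) [SigmaFinite ν] {n : ℕ}
    (f : (Fin (n + 1) → E) → ℝ≥0∞) :
    ∫⁻ w, f w ∂(Measure.pi fun _ => ν) =
      ∫⁻ p : E × (Fin n → E), f (Fin.cons (α := fun _ => E) p.1 p.2)
        ∂(ν.prod (Measure.pi fun _ => ν)) := by
  have h := (measurePreserving_piFinSuccAbove (α := fun _ : Fin (n + 1) => E) (fun _ => ν) 0).symm
  rw [← h.lintegral_comp_emb (MeasurableEquiv.measurableEmbedding _)]
  refine lintegral_congr fun p => ?_
  congr 1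
  exact Fin.insertNth_zero' p.1 p.2

theorem measurable_fin_cons {n : ℕ} :
    Measurable fun p : E × (Fin n → E) =>
      (Fin.cons (α := fun _ => E) p.1 p.2 : Fin (n + 1) → E) := by
  refine measurable_pi_lambda _ fun i => ?_
  refine Fin.cases ?_ (fun j => ?_) i
  · simpa using measurable_fst
  · simp only [Fin.cons_succ]
    fun_prop

theorem lintegral_pi_fin_prod (ν : Measure E) [SigmaFinite ν] {n : ℕ}
    {f : Fin n → E → ℝ≥0∞} (hf : ∀ i, Measurable (f i)) :
    ∫⁻ w, ∏ i, f i (w i) ∂(Measure.pi fun _ => ν) = ∏ i, ∫⁻ x, f i x ∂ν := by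
  induction n with
  | zero => simp
  | succ n ih =>
    rw [lintegral_pi_fin_succ]
    simp only [Fin.prod_univ_succ, Fin.cons_zero, Fin.cons_succ]
    rw [lintegral_prod_mul (f := f 0) (g := fun w : Fin n → E => ∏ i : Fin n, f i.succ (w i))
      (hf 0).aemeasurable, ih fun i => hf i.succ]
    exact (Finset.measurable_fun_prod _ fun i _ =>
      (hf i.succ).comp (measurable_pi_apply i)).aemeasurable

theorem pi_withDensity (μ : Measure E) [SigmaFinite μ] {f : E → ℝ≥0∞} (hf : Measurable f)
    [SigmaFinite (μ.withDensity f)] (n : ℕ) :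
    Measure.pi (fun _ : Fin n => μ.withDensity f) =
      (Measure.pi fun _ => μ).withDensity fun w => ∏ i, f (w i) := by
  refine Measure.pi_eq fun s hs => ?_
  rw [withDensity_apply _ (MeasurableSet.univ_pi hs), ← lintegral_indicator
    (MeasurableSet.univ_pi hs)]
  have h1 : ∀ w : Fin n → E, (Set.pi univ s).indicator (fun w => ∏ i, f (w i)) w =
      ∏ i, (s i).indicator f (w i) := by
    intro w
    by_cases hw : w ∈ Set.pi univ s
    · rw [Set.indicator_of_mem hw]
      exact Finset.prod_congr rfl fun i _ => (Set.indicator_of_mem (hw i trivial) f).symm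
    · rw [Set.indicator_of_notMem hw]
      simp only [Set.mem_pi, Set.mem_univ, true_imp_iff, not_forall] at hw
      obtain ⟨i, hi⟩ := hw
      exact (Finset.prod_eq_zero (Finset.mem_univ i) (Set.indicator_of_notMem hi f)).symm
  simp_rw [h1]
  rw [lintegral_pi_fin_prod μ fun i => hf.indicator (hs i)]
  refine Finset.prod_congr rfl fun i _ => ?_
  rw [lintegral_indicator (hs i), withDensity_apply _ (hs i)]

end FinPi

/-! ### Affine changes of variables -/

theorem lintegral_comp_affine {E : Type*} [NormedAddCommGroup E] [NormedSpace ℝ E]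
    [FiniteDimensional ℝ E] [MeasurableSpace E] [BorelSpace E] (μ : Measure E)
    [μ.IsAddHaarMeasure] {L : E →ₗ[ℝ] E} (hL : LinearMap.det L ≠ 0) (b : E) {f : E → ℝ≥0∞}
    (hf : Measurable f) :
    ∫⁻ x, f x ∂μ = ENNReal.ofReal |LinearMap.det L| * ∫⁻ x, f (b + L x) ∂μ := by
  have hLm : Measurable L := (LinearMap.continuous_of_finiteDimensional L).measurable
  have h1 : ∫⁻ x, f (b + L x) ∂μ = ∫⁻ y, f (b + y) ∂(μ.map L) := by
    rw [lintegral_map (f := fun y => f (b + y)) (hf.comp (measurable_const_add b)) hLm]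
  rw [h1, Measure.map_linearMap_addHaar_eq_smul_addHaar _ hL, lintegral_smul_measure,
    lintegral_add_left_eq_self, smul_eq_mul, ← mul_assoc, ← ENNReal.ofReal_mul (abs_nonneg _),
    ← abs_mul, mul_inv_cancel₀ hL]
  simp

theorem lintegral_pi_affine {m n : ℕ} {ρ : ℝ} (hρ : 0 < ρ) (x : Euc (m + 1))
    {f : (Fin n → Euc (m + 1)) → ℝ≥0∞} (hf : Measurable f) :
    ∫⁻ y, f y = ENNReal.ofReal (ρ ^ ((m + 1) * n)) *
      ∫⁻ y : Fin n → Euc (m + 1), f fun i => x + ρ • y i := by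
  have hdet : LinearMap.det (ρ • (LinearMap.id : (Fin n → Euc (m + 1)) →ₗ[ℝ] _)) =
      ρ ^ ((m + 1) * n) := by
    rw [LinearMap.det_smul, LinearMap.det_id, mul_one, Module.finrank_pi_fintype]
    simp [mul_comm]
  have h0 : LinearMap.det (ρ • (LinearMap.id : (Fin n → Euc (m + 1)) →ₗ[ℝ] _)) ≠ 0 := by
    rw [hdet]; positivity
  rw [lintegral_comp_affine volume h0 (fun _ => x) hf, hdet, abs_of_pos (by positivity)]
  rfl

/-- Integration over clusters: the first point is `X x` for an affine map `X`, the other points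
are close to it. -/
theorem lintegral_cluster {m n : ℕ} {ρ : ℝ} (hρ : 0 < ρ)
    {L : Euc (m + 1) →ₗ[ℝ] Euc (m + 1)} (hL : LinearMap.det L ≠ 0) (b : Euc (m + 1))
    {f : (Fin (n + 1) → Euc (m + 1)) → ℝ≥0∞} (hf : Measurable f) :
    ∫⁻ w, f w ∂(Measure.pi fun _ => volume) =
      ENNReal.ofReal (|LinearMap.det L| * ρ ^ ((m + 1) * n)) *
        ∫⁻ p : Euc (m + 1) × (Fin n → Euc (m + 1)),
          f fun i => b + L p.1 + ρ • (Fin.cons (α := fun _ => Euc (m + 1)) 0 p.2 :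
            Fin (n + 1) → Euc (m + 1)) i := by
  have hLm : Measurable L := (LinearMap.continuous_of_finiteDimensional L).measurable
  have hcons : ∀ p : Euc (m + 1) × (Fin n → Euc (m + 1)),
      (fun i => p.1 + ρ • (Fin.cons (α := fun _ => Euc (m + 1)) 0 p.2 :
            Fin (n + 1) → Euc (m + 1)) i) =
        Fin.cons (α := fun _ => Euc (m + 1)) p.1 fun i => p.1 + ρ • p.2 i := by
    intro p
    ext1 i
    refine Fin.cases ?_ (fun j => ?_) i <;> simp
  have hm1 : Measurable fun p : Euc (m + 1) × (Fin n → Euc (m + 1)) =>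
      f (Fin.cons (α := fun _ => Euc (m + 1)) p.1 p.2) := hf.comp measurable_fin_cons
  have hpm' : Measurable fun p : Euc (m + 1) × (Fin n → Euc (m + 1)) =>
      ((p.1, fun i => p.1 + ρ • p.2 i) : Euc (m + 1) × (Fin n → Euc (m + 1))) := by
    fun_prop
  have hm2 : Measurable fun p : Euc (m + 1) × (Fin n → Euc (m + 1)) =>
      f (Fin.cons (α := fun _ => Euc (m + 1)) p.1 fun i => p.1 + ρ • p.2 i) :=
    hm1.comp hpm'
  have hpm : Measurable fun p : Euc (m + 1) × (Fin n → Euc (m + 1)) => (b + L p.1, p.2) := by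
    fun_prop
  have hm3 : Measurable fun p : Euc (m + 1) × (Fin n → Euc (m + 1)) =>
      f (Fin.cons (α := fun _ => Euc (m + 1)) (b + L p.1) fun i => b + L p.1 + ρ • p.2 i) :=
    hm2.comp hpm
  have hin : ∀ x, ∫⁻ y : Fin n → Euc (m + 1), f (Fin.cons (α := fun _ => Euc (m + 1)) x y) =
      ENNReal.ofReal (ρ ^ ((m + 1) * n)) * ∫⁻ y : Fin n → Euc (m + 1),
        f (Fin.cons (α := fun _ => Euc (m + 1)) x fun i => x + ρ • y i) := fun x =>
    lintegral_pi_affine hρ x (f := fun y => f (Fin.cons (α := fun _ => Euc (m + 1)) x y))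
      (hm1.comp measurable_prodMk_left)
  rw [lintegral_pi_fin_succ, lintegral_prod _ hm1.aemeasurable, ← volume_pi]
  simp_rw [hin]
  rw [lintegral_const_mul _ hm2.lintegral_prod_right', lintegral_comp_affine volume hL b
    hm2.lintegral_prod_right', Measure.volume_eq_prod]
  simp_rw [fun p : Euc (m + 1) × (Fin n → Euc (m + 1)) => hcons (b + L p.1, p.2)]
  rw [lintegral_prod _ hm3.aemeasurable, ← mul_assoc, ← ENNReal.ofReal_mul (by positivity),
    mul_comm |LinearMap.det L|]

/-! ### Integrals over clusters of points in a remote halfspace -/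

theorem IsVonMises.continuous_homDensity {d : ℕ} {D : Set (Euc d)} (hD : IsRotund D) {ψ : ℝ → ℝ}
    (hψ : IsVonMises ψ) (C : ℝ) : Continuous (homDensity D C ψ) := by
  have h1 : Continuous fun x => ψ (gauge D x) :=
    hψ.continuousOn.comp_continuous hD.continuous_gauge fun x => gauge_nonneg x
  exact continuous_const.mul (Real.continuous_exp.comp h1.neg)

theorem generator_pos {C : ℝ} (hC : 0 < C) (ψ : ℝ → ℝ) (t : ℝ) : 0 < generator C ψ t :=
  mul_pos hC (Real.exp_pos _)

/-- A point of a cluster in the coordinates adapted to the halfspace `t H`. -/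
noncomputable def clusterPt {m : ℕ} (A : Euc (m + 1) ≃ₗ[ℝ] Euc (m + 1)) (ψ : ℝ → ℝ) (t ρ : ℝ)
    (x y : Euc (m + 1)) : Euc (m + 1) :=
  A (joinPt (√(aux ψ t * t) • horiz x) (t + aux ψ t * vert x)) + ρ • y

/-- The normalized density at a point of a cluster, restricted to the halfspace. -/
noncomputable def clusterFactor {m : ℕ} (D : Set (Euc (m + 1))) (C : ℝ) (ψ : ℝ → ℝ)
    (θ : Euc (m + 1)) (A : Euc (m + 1) ≃ₗ[ℝ] Euc (m + 1)) (t ρ : ℝ) (x y : Euc (m + 1)) : ℝ :=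
  (t • supportHalfspace D θ).indicator (fun z => homDensity D C ψ z / generator C ψ t)
    (clusterPt A ψ t ρ x y)

/-- The limit of the normalized density at a point of a cluster. -/
noncomputable def limitFactor {m : ℕ} (D : Set (Euc (m + 1))) (θ : Euc (m + 1))
    (A : Euc (m + 1) ≃ₗ[ℝ] Euc (m + 1)) (c : ℝ) (x y : Euc (m + 1)) : ℝ :=
  if -c * vert (A.symm y) ≤ vert x then
    Real.exp (-(horizSq x / 2 + vert x + c * inner ℝ (gradient (gauge D) (supportPoint D θ)) y))
  else 0

/-- The points `0, y_1, …, y_N`. -/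
abbrev consZero {d N : ℕ} (y : Fin N → Euc d) : Fin (N + 1) → Euc d :=
  Fin.cons (α := fun _ => Euc d) 0 y

/-! ### Bounds and limits for the density at one cluster point. -/

section Cluster

variable {m : ℕ} {D : Set (Euc (m + 1))} {C : ℝ} {ψ : ℝ → ℝ} {θ : Euc (m + 1)}
  {A : Euc (m + 1) ≃ₗ[ℝ] Euc (m + 1)}

theorem continuous_linearEquiv (A : Euc (m + 1) ≃ₗ[ℝ] Euc (m + 1)) : Continuous A :=
  LinearMap.continuous_of_finiteDimensional (A : Euc (m + 1) →ₗ[ℝ] Euc (m + 1))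

theorem vert_symm_clusterPt (t ρ : ℝ) (x y : Euc (m + 1)) :
    vert (A.symm (clusterPt A ψ t ρ x y)) =
      t + aux ψ t * vert x + ρ * vert (A.symm y) := by
  rw [clusterPt, map_add, LinearEquiv.symm_apply_apply, map_smul, vert_add, vert_joinPt, vert_smul]

theorem clusterPt_eq_affine (t ρ : ℝ) (x y : Euc (m + 1)) :
    clusterPt A ψ t ρ x y = A (t • joinPt 0 1) +
      ((A : Euc (m + 1) →ₗ[ℝ] Euc (m + 1)) ∘ₗ diagMap m (√(aux ψ t * t)) (aux ψ t)) x + ρ • y := by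
  rw [LinearMap.comp_apply, LinearEquiv.coe_coe, ← map_add, diagMap_apply, smul_joinPt,
    ← joinPt_add, smul_zero, zero_add, mul_one, clusterPt]

theorem clusterFactor_nonneg (hC : 0 < C) (t ρ : ℝ) (x y : Euc (m + 1)) :
    0 ≤ clusterFactor D C ψ θ A t ρ x y :=
  Set.indicator_nonneg (fun _ _ => div_nonneg (generator_pos hC ψ _).le
    (generator_pos hC ψ _).le) _

theorem measurable_clusterFactor (hD : IsRotund D) (hψ : IsVonMises ψ) {t : ℝ} (ht : 0 < t)
    (ρ : ℝ) {α : Type*} [MeasurableSpace α] {f g : α → Euc (m + 1)} (hf : Measurable f)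
    (hg : Measurable g) : Measurable fun p => clusterFactor D C ψ θ A t ρ (f p) (g p) := by
  unfold clusterFactor
  have h1 : Measurable ((t • supportHalfspace D θ).indicator
      (fun z => homDensity D C ψ z / generator C ψ t)) :=
    ((hψ.continuous_homDensity hD C).measurable.div_const _).indicator
      (measurableSet_smul_supportHalfspace D ht θ)
  have h2 : Measurable fun p => clusterPt A ψ t ρ (f p) (g p) := by
    simp_rw [clusterPt_eq_affine]
    have hL : Measurable ((A : Euc (m + 1) →ₗ[ℝ] Euc (m + 1)) ∘ₗ
        diagMap m (√(aux ψ t * t)) (aux ψ t)) :=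
      (LinearMap.continuous_of_finiteDimensional _).measurable
    exact ((hL.comp hf).const_add _).add (hg.const_smul ρ)
  exact h1.comp h2

theorem homDensity_div_le_one (hψ : IsVonMises ψ) (hC : 0 < C) {t : ℝ}
    (ht : 0 < t) {z : Euc (m + 1)} (hz : t ≤ gauge D z) :
    homDensity D C ψ z / generator C ψ t ≤ 1 :=
  div_le_one_of_le₀ (hψ.generator_le hC ht.le hz) (generator_pos hC ψ _).le

theorem clusterFactor_le_one (hD : IsRotund D) (hψ : IsVonMises ψ) (hC : 0 < C) (hθ : θ ≠ 0)
    {t : ℝ} (ht : 0 < t) (ρ : ℝ) (x y : Euc (m + 1)) :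
    clusterFactor D C ψ θ A t ρ x y ≤ 1 := by
  unfold clusterFactor
  by_cases hz : clusterPt A ψ t ρ x y ∈ t • supportHalfspace D θ
  · rw [Set.indicator_of_mem hz]
    exact homDensity_div_le_one hψ hC ht (hD.le_gauge_of_mem_smul ht hθ hz)
  · rw [Set.indicator_of_notMem hz]
    exact zero_le_one

variable (hA : IsInitialTransformation D θ A)

include hA

/-- The normalized density has tails of arbitrary polynomial order. -/
theorem eventually_clusterFactor_le (hD : IsRotund D) (hψ : IsVonMises ψ) (hC : 0 < C)
    (hθ : θ ≠ 0) (p : ℕ) (hp : 0 < p) :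
    ∃ B : ℝ, 0 ≤ B ∧ ∀ᶠ t in atTop, ∀ ρ x,
      clusterFactor D C ψ θ A t ρ x 0 ≤ B * ((1 + ‖x‖) ^ p)⁻¹ := by
  obtain ⟨c, hc0, hc⟩ := hA.exists_le_excess hD hθ
  have hp' : (1 : ℝ) ≤ p := by exact_mod_cast hp
  -- The constant comes from `c (1 + ‖x‖) ≤ 1 + s ≤ p (1 + s/p)`, where `s` is the rescaled excess.
  refine ⟨(p / c) ^ p, by positivity, ?_⟩
  have h1 : ∀ᶠ t in atTop, aux ψ t / t < 1 :=
    hψ.tendsto_aux_div.eventually_lt_const one_pos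
  filter_upwards [hψ.eventually_generator_div_le hC hp, h1, eventually_gt_atTop 0]
    with t ht hat ht0 ρ x
  unfold clusterFactor
  have ha : 0 < aux ψ t := hψ.aux_pos ht0
  rw [div_lt_one ht0] at hat
  by_cases hz : clusterPt A ψ t ρ x 0 ∈ t • supportHalfspace D θ
  · rw [Set.indicator_of_mem hz]
    have hg := hD.le_gauge_of_mem_smul ht0 hθ hz
    rw [hA.mem_smul_supportHalfspace ht0, vert_symm_clusterPt, map_zero] at hz
    have hv : 0 ≤ vert x := by
      have h0 : vert (0 : Euc (m + 1)) = 0 := rfl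
      rw [h0, mul_zero, add_zero] at hz
      exact nonneg_of_mul_nonneg_right (by linarith) ha
    set s := (gauge D (clusterPt A ψ t ρ x 0) - t) / aux ψ t with hs
    have hs0 : 0 ≤ s := div_nonneg (sub_nonneg.2 hg) ha.le
    have hsg : gauge D (clusterPt A ψ t ρ x 0) = t + aux ψ t * s := by
      rw [hs, mul_div_cancel₀ _ ha.ne']; ring
    have h2 := hc (aux ψ t) t ha hat.le x hv
    have h3 : c * (1 + ‖x‖) ≤ 1 + s := by
      rw [hs]
      simpa [clusterPt] using h2
    have h4 := ht s hs0
    rw [← hsg] at h4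
    refine (show homDensity D C ψ _ / generator C ψ t ≤ _ from h4).trans ?_
    rw [← div_eq_mul_inv, ← div_pow, ← inv_pow]
    refine pow_le_pow_left₀ (by positivity) ?_ p
    rw [inv_le_comm₀ (by positivity) (by positivity), inv_div, div_div_eq_mul_div,
      div_le_iff₀ (by positivity)]
    calc (1 + ‖x‖) * c ≤ 1 + s := by linarith
      _ ≤ p + s := by linarith
      _ = (1 + s / p) * p := by field_simp
  · rw [Set.indicator_of_notMem hz]
    positivity

/-- The indicator of the halfspace is eventually constant in `n` away from the limiting hyperplane;
on that hyperplane it need not converge, hence `hne`. -/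
theorem tendsto_clusterFactor (hD : IsRotund D) (hψ : IsVonMises ψ) (hC : 0 < C)
    (hθ : θ ≠ 0) {t ρ : ℕ → ℝ} (ht_pos : ∀ n, 0 < t n) (ht : Tendsto t atTop atTop)
    (hrt : Tendsto (fun n => ρ n / t n) atTop (𝓝 0)) {c : ℝ}
    (hra : Tendsto (fun n => ρ n / aux ψ (t n)) atTop (𝓝 c)) {x : Euc (m + 1)}
    (hx : 0 ≤ vert x) (y : Euc (m + 1)) (hne : vert x ≠ -c * vert (A.symm y)) :
    Tendsto (fun n => clusterFactor D C ψ θ A (t n) (ρ n) x y) atTop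
      (𝓝 (limitFactor D θ A c x y)) := by
  have ha : ∀ n, 0 < aux ψ (t n) := fun n => hψ.aux_pos (ht_pos n)
  have hmem : ∀ n, clusterPt A ψ (t n) (ρ n) x y ∈ t n • supportHalfspace D θ ↔
      0 ≤ vert x + ρ n / aux ψ (t n) * vert (A.symm y) := by
    intro n
    rw [hA.mem_smul_supportHalfspace (ht_pos n), vert_symm_clusterPt]
    have : t n + aux ψ (t n) * vert x + ρ n * vert (A.symm y) =
        t n + aux ψ (t n) * (vert x + ρ n / aux ψ (t n) * vert (A.symm y)) := by
      have := (ha n).ne'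
      field_simp
      ring
    rw [this, le_add_iff_nonneg_right, mul_nonneg_iff_of_pos_left (ha n)]
  have hlim : Tendsto (fun n => vert x + ρ n / aux ψ (t n) * vert (A.symm y)) atTop
      (𝓝 (vert x + c * vert (A.symm y))) := (hra.mul_const _).const_add _
  unfold limitFactor
  rcases lt_or_gt_of_ne hne with hlt | hgt
  · rw [if_neg (not_le.2 hlt)]
    have h1 : ∀ᶠ n in atTop, vert x + ρ n / aux ψ (t n) * vert (A.symm y) < 0 :=
      hlim.eventually_lt_const (by linarith)
    refine tendsto_const_nhds.congr' ?_
    filter_upwards [h1] with n hn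
    rw [clusterFactor, Set.indicator_of_notMem]
    rw [hmem]
    exact not_le.2 hn
  · rw [if_pos hgt.le]
    have h1 : ∀ᶠ n in atTop, 0 < vert x + ρ n / aux ψ (t n) * vert (A.symm y) :=
      hlim.eventually_const_lt (by linarith)
    have h2 := hψ.tendsto_generator_div hC ht (hA.tendsto_excess_add hD hθ ha ht_pos
      (hψ.tendsto_aux_div.comp ht) hrt hra x hx y)
    refine h2.congr' ?_
    filter_upwards [h1] with n hn
    rw [clusterFactor, Set.indicator_of_mem ((hmem n).2 hn.le), homDensity, clusterPt]
    congr 2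
    rw [mul_div_cancel₀ _ (ha n).ne']
    ring

end Cluster

theorem ae_vert_ne {m : ℕ} (s : ℝ) : ∀ᵐ x : Euc (m + 1), vert x ≠ s := by
  have h := EuclideanSpace.volume_preserving_symm_measurableEquiv_toLp (Fin (m + 1))
  have h1 : ∀ᵐ y : Fin (m + 1) → ℝ, y (Fin.last m) ≠ s := by
    rw [ae_iff]
    simp only [ne_eq, not_not, volume_pi]
    exact Measure.pi_hyperplane (fun _ : Fin (m + 1) => (volume : Measure ℝ))
      (Fin.last m) s
  exact h.quasiMeasurePreserving.ae h1

theorem ae_vert_ne_prod {m N : ℕ} {u : (Fin N → Euc (m + 1)) → ℝ} (hu : Measurable u) :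
    ∀ᵐ p : Euc (m + 1) × (Fin N → Euc (m + 1)), vert p.1 ≠ u p.2 := by
  rw [ae_iff, Measure.volume_eq_prod]
  simp only [ne_eq, not_not]
  have hm : MeasurableSet {p : Euc (m + 1) × (Fin N → Euc (m + 1)) | vert p.1 = u p.2} :=
    measurableSet_eq_fun (continuous_vert.measurable.comp measurable_fst) (hu.comp measurable_snd)
  rw [Measure.prod_apply_symm hm, lintegral_eq_zero_iff (measurable_measure_prodMk_right hm)]
  refine Eventually.of_forall fun y => ?_
  have := ae_vert_ne (m := m) (u y)
  rw [ae_iff] at this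
  simpa using this

/-! ### Dominated convergence for cluster integrals. -/

section ClusterIntegral

variable {m N : ℕ} {D : Set (Euc (m + 1))} {C : ℝ} {ψ : ℝ → ℝ} {θ : Euc (m + 1)}
  {A : Euc (m + 1) ≃ₗ[ℝ] Euc (m + 1)} {F : (Fin (N + 1) → Euc (m + 1)) → ℝ}

theorem consZero_zero {d : ℕ} (y : Fin N → Euc d) : consZero y 0 = 0 := rfl

theorem measurable_consZero {d : ℕ} : Measurable (consZero (d := d) (N := N)) :=
  measurable_fin_cons.comp measurable_prodMk_left

/-- The rescaled integrand over clusters. -/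
noncomputable def clusterIntegrand (F : (Fin (N + 1) → Euc (m + 1)) → ℝ) (D : Set (Euc (m + 1)))
    (C : ℝ) (ψ : ℝ → ℝ) (θ : Euc (m + 1)) (A : Euc (m + 1) ≃ₗ[ℝ] Euc (m + 1)) (t ρ : ℝ)
    (p : Euc (m + 1) × (Fin N → Euc (m + 1))) : ℝ :=
  F (consZero p.2) * ∏ i, clusterFactor D C ψ θ A t ρ p.1 (consZero p.2 i)

/-- The limit of the rescaled integrand over clusters. -/
noncomputable def limitIntegrand (F : (Fin (N + 1) → Euc (m + 1)) → ℝ) (D : Set (Euc (m + 1)))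
    (θ : Euc (m + 1)) (A : Euc (m + 1) ≃ₗ[ℝ] Euc (m + 1)) (c : ℝ)
    (p : Euc (m + 1) × (Fin N → Euc (m + 1))) : ℝ :=
  F (consZero p.2) * ∏ i, limitFactor D θ A c p.1 (consZero p.2 i)

theorem measurable_clusterIntegrand (hD : IsRotund D) (hψ : IsVonMises ψ) (hF : Measurable F)
    {t : ℝ} (ht : 0 < t) (ρ : ℝ) : Measurable (clusterIntegrand F D C ψ θ A t ρ) := by
  have h1 : Measurable fun p : Euc (m + 1) × (Fin N → Euc (m + 1)) => F (consZero p.2) :=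
    hF.comp (measurable_consZero.comp measurable_snd)
  have h2 : ∀ i, Measurable fun p : Euc (m + 1) × (Fin N → Euc (m + 1)) => consZero p.2 i :=
    fun i => (measurable_pi_apply i).comp (measurable_consZero.comp measurable_snd)
  have h3 : ∀ i, Measurable fun p : Euc (m + 1) × (Fin N → Euc (m + 1)) =>
      clusterFactor D C ψ θ A t ρ p.1 (consZero p.2 i) := fun i =>
    measurable_clusterFactor hD hψ ht ρ measurable_fst (h2 i)
  exact h1.mul (Finset.measurable_fun_prod _ fun i _ => h3 i)

theorem clusterIntegrand_nonneg (hC : 0 < C) (hF : ∀ y, 0 ≤ F y) (t ρ : ℝ)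
    (p : Euc (m + 1) × (Fin N → Euc (m + 1))) : 0 ≤ clusterIntegrand F D C ψ θ A t ρ p :=
  mul_nonneg (hF _) (Finset.prod_nonneg fun _ _ => clusterFactor_nonneg hC _ _ _ _)

/-- The exponent `m + 2` is the first integer above the dimension `m + 1`. -/
theorem integrable_cluster_bound (c κ : ℝ) :
    Integrable fun p : Euc (m + 1) × (Fin N → Euc (m + 1)) =>
      (c * ((1 + ‖p.1‖) ^ (m + 2))⁻¹) *
        (Metric.closedBall (0 : Fin N → Euc (m + 1)) κ).indicator 1 p.2 := by
  have h1 : Integrable fun x : Euc (m + 1) => c * ((1 + ‖x‖) ^ (m + 2))⁻¹ := by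
    have h2 : Integrable fun x : Euc (m + 1) => (1 + ‖x‖) ^ (-((m + 2 : ℕ) : ℝ)) := by
      refine integrable_one_add_norm ?_
      rw [finrank_euclideanSpace_fin]
      exact_mod_cast Nat.lt_succ_self _
    refine (h2.congr (Eventually.of_forall fun x => ?_)).const_mul c
    simp only
    rw [Real.rpow_neg (by positivity), Real.rpow_natCast]
  have h3 : Integrable ((Metric.closedBall (0 : Fin N → Euc (m + 1)) κ).indicator
      (1 : (Fin N → Euc (m + 1)) → ℝ)) :=
    (integrable_indicator_iff Metric.isClosed_closedBall.measurableSet).2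
      (integrableOn_const measure_closedBall_lt_top.ne)
  exact h1.mul_prod h3

variable {M κ : ℝ} (hA : IsInitialTransformation D θ A) (hD : IsRotund D) (hψ : IsVonMises ψ)
  (hC : 0 < C) (hθ : θ ≠ 0) (hF : Measurable F) (hF0 : ∀ y, 0 ≤ F y) (hFM : ∀ y, F y ≤ M)
  (hFκ : ∀ y, F (consZero y) ≠ 0 → ‖y‖ ≤ κ)

include hA hD hψ hC hθ hF0 hFM hFκ

/-- The first point alone supplies the decay in `x`; the other factors are at most one, and the
kernel confines `y` to a ball. -/
theorem eventually_clusterIntegrand_le :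
    ∃ B : ℝ, ∀ᶠ t in atTop, ∀ ρ (p : Euc (m + 1) × (Fin N → Euc (m + 1))),
      clusterIntegrand F D C ψ θ A t ρ p ≤ (B * ((1 + ‖p.1‖) ^ (m + 2))⁻¹) *
        (Metric.closedBall (0 : Fin N → Euc (m + 1)) κ).indicator 1 p.2 := by
  obtain ⟨B, hB0, hB⟩ := eventually_clusterFactor_le hA hD hψ hC hθ (m + 2) (by omega)
  have hM0 : 0 ≤ M := (hF0 0).trans (hFM 0)
  refine ⟨M * B, ?_⟩
  filter_upwards [hB, eventually_gt_atTop 0] with t ht ht0 ρ p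
  unfold clusterIntegrand
  by_cases hp : F (consZero p.2) = 0
  · rw [hp, zero_mul]
    exact mul_nonneg (by positivity) (Set.indicator_nonneg (fun _ _ => zero_le_one) _)
  · rw [Set.indicator_of_mem (mem_closedBall_zero_iff.2 (hFκ _ hp)), Pi.one_apply, mul_one,
      mul_assoc, Fin.prod_univ_succ]
    refine mul_le_mul (hFM _) ?_ (mul_nonneg (clusterFactor_nonneg hC _ _ _ _)
      (Finset.prod_nonneg fun _ _ => clusterFactor_nonneg hC _ _ _ _)) hM0
    calc _ ≤ clusterFactor D C ψ θ A t ρ p.1 (consZero p.2 0) * 1 := by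
          refine mul_le_mul_of_nonneg_left ?_ (clusterFactor_nonneg hC _ _ _ _)
          exact Finset.prod_le_one (fun _ _ => clusterFactor_nonneg hC _ _ _ _)
            fun _ _ => clusterFactor_le_one hD hψ hC hθ ht0 _ _ _
      _ ≤ _ := by
          rw [mul_one]
          exact ht ρ p.1

variable {t ρ : ℕ → ℝ} (ht_pos : ∀ n, 0 < t n) (ht : Tendsto t atTop atTop)
    (hrt : Tendsto (fun n => ρ n / t n) atTop (𝓝 0)) {c : ℝ}
    (hra : Tendsto (fun n => ρ n / aux ψ (t n)) atTop (𝓝 c))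

include ht_pos ht hrt hra

omit hF0 hFM hFκ in
theorem ae_tendsto_clusterIntegrand :
    ∀ᵐ p : Euc (m + 1) × (Fin N → Euc (m + 1)),
      Tendsto (fun n => clusterIntegrand F D C ψ θ A (t n) (ρ n) p) atTop
        (𝓝 (limitIntegrand F D θ A c p)) := by
  have h1 : ∀ i : Fin (N + 1), ∀ᵐ p : Euc (m + 1) × (Fin N → Euc (m + 1)),
      vert p.1 ≠ -c * vert (A.symm (consZero p.2 i)) := by
    intro i
    refine ae_vert_ne_prod (u := fun y => -c * vert (A.symm (consZero y i))) ?_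
    exact ((continuous_vert.comp (continuous_linearEquiv A.symm)).measurable.comp
      ((measurable_pi_apply i).comp measurable_consZero)).const_mul _
  filter_upwards [ae_all_iff.2 h1] with p hp
  have hvz : vert (A.symm (0 : Euc (m + 1))) = 0 := by rw [map_zero]; rfl
  -- For `v < 0` the first point of the cluster is outside the halfspace, and the integrand and its
  -- limit both vanish.
  rcases lt_or_ge (vert p.1) 0 with hneg | hpos
  · have hlim : limitIntegrand F D θ A c p = 0 := by
      unfold limitIntegrand
      rw [Finset.prod_eq_zero (Finset.mem_univ 0), mul_zero]
      rw [consZero_zero, limitFactor, hvz, mul_zero, if_neg (not_le.2 hneg)]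
    rw [hlim]
    refine tendsto_const_nhds.congr fun n => ?_
    unfold clusterIntegrand
    rw [Finset.prod_eq_zero (Finset.mem_univ 0), mul_zero]
    rw [consZero_zero, clusterFactor, Set.indicator_of_notMem]
    rw [hA.mem_smul_supportHalfspace (ht_pos n), vert_symm_clusterPt, hvz, not_le]
    have := mul_neg_of_pos_of_neg (hψ.aux_pos (ht_pos n)) hneg
    linarith
  · refine tendsto_const_nhds.mul (tendsto_finsetProd _ fun i _ => ?_)
    exact tendsto_clusterFactor hA hD hψ hC hθ ht_pos ht hrt hra hpos _ (hp i)

include hF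

/-- The limit obeys the same bound as the integrands; its integrability is recorded for the use of
Fubini in `integral_limitIntegrand_kernel`. -/
theorem tendsto_integral_clusterIntegrand :
    Integrable (limitIntegrand F D θ A c) ∧
    Tendsto (fun n => ∫ p, clusterIntegrand F D C ψ θ A (t n) (ρ n) p) atTop
      (𝓝 (∫ p, limitIntegrand F D θ A c p)) := by
  obtain ⟨B, hB⟩ := eventually_clusterIntegrand_le hA hD hψ hC hθ hF0 hFM hFκ
  have hae := ae_tendsto_clusterIntegrand (F := F) hA hD hψ hC hθ ht_pos ht hrt hra
  have hm : ∀ n, AEStronglyMeasurable (clusterIntegrand F D C ψ θ A (t n) (ρ n)) volume :=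
    fun n => (measurable_clusterIntegrand hD hψ hF (ht_pos n) _).aestronglyMeasurable
  have hbd : ∀ᶠ n in atTop, ∀ p, ‖clusterIntegrand F D C ψ θ A (t n) (ρ n) p‖ ≤
      (B * ((1 + ‖p.1‖) ^ (m + 2))⁻¹) *
        (Metric.closedBall (0 : Fin N → Euc (m + 1)) κ).indicator 1 p.2 := by
    filter_upwards [ht.eventually hB] with n hn p
    rw [Real.norm_eq_abs, abs_of_nonneg (clusterIntegrand_nonneg hC hF0 _ _ _)]
    exact hn _ _
  refine ⟨(integrable_cluster_bound B κ).mono' (aestronglyMeasurable_of_tendsto_ae atTop hm hae)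
    ?_, ?_⟩
  · filter_upwards [hae] with p hp
    exact le_of_tendsto hp.norm (hbd.mono fun n hn => hn p)
  · exact tendsto_integral_filter_of_dominated_convergence _ (Eventually.of_forall hm)
      (hbd.mono fun n hn => Eventually.of_forall hn) (integrable_cluster_bound B κ) hae

end ClusterIntegral

/-! ### The exact change of variables -/

theorem sqrt_pow_mul_aux (m : ℕ) (ψ : ℝ → ℝ) {t : ℝ} (h : 0 ≤ aux ψ t * t) :
    √(aux ψ t * t) ^ m * aux ψ t = qFun m ψ t := by
  rw [qFun, Real.sqrt_eq_rpow, ← Real.rpow_natCast, ← Real.rpow_mul h]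
  congr 2
  ring

theorem isFiniteMeasure_withDensity_homDensity {d : ℕ} {D : Set (Euc d)} {C : ℝ} {ψ : ℝ → ℝ}
    (hf : ∫ x, homDensity D C ψ x = 1) (n : ℕ) :
    IsFiniteMeasure
      (volume.withDensity fun x => ENNReal.ofReal (n * homDensity D C ψ x)) := by
  have hint : Integrable (homDensity D C ψ) := by
    -- A nonintegrable function has integral `0` by convention, contradicting `hf`.
    by_contra h
    rw [integral_undef h] at hf
    exact zero_ne_one hf
  exact isFiniteMeasure_withDensity_ofReal (hint.const_mul _).2

/-- The substitution is exact. The affine map has determinant `z_D(θ) q(t)` up to sign, the `N`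
displacements give `ρ ^ ((m+1) N)`, each of the `N + 1` densities releases `n g(t)`, and `hKF`
removes position and scale from the kernel. -/
theorem integral_cluster_eq {m N : ℕ} {D : Set (Euc (m + 1))} {C : ℝ} {ψ : ℝ → ℝ}
    {θ : Euc (m + 1)} (A : Euc (m + 1) ≃ₗ[ℝ] Euc (m + 1)) (hD : IsRotund D) (hψ : IsVonMises ψ)
    (hC : 0 < C) (hf : ∫ x, homDensity D C ψ x = 1) (n : ℕ) {t ρ : ℝ} (ht : 0 < t) (hρ : 0 < ρ)
    {K F : (Fin (N + 1) → Euc (m + 1)) → ℝ} (hK : Measurable K) (hF : Measurable F)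
    (hF0 : ∀ y, 0 ≤ F y) (hKF : ∀ x y, K (fun i => x + ρ • y i) = F y) :
    (∫⁻ w, ENNReal.ofReal (K w * ∏ i, (t • supportHalfspace D θ).indicator 1 (w i))
      ∂(Measure.pi fun _ : Fin (N + 1) =>
        volume.withDensity fun x => ENNReal.ofReal (n * homDensity D C ψ x))).toReal =
      (n * generator C ψ t) ^ (N + 1) * ρ ^ ((m + 1) * N) * qFun m ψ t *
        (zConst A * ∫ p, clusterIntegrand F D C ψ θ A t ρ p) := by
  have := isFiniteMeasure_withDensity_homDensity hf n
  have ha : 0 < aux ψ t := hψ.aux_pos ht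
  have hg : 0 < generator C ψ t := generator_pos hC ψ t
  have hfm : Measurable (homDensity D C ψ) := (hψ.continuous_homDensity hD C).measurable
  have hHm := measurableSet_smul_supportHalfspace D ht θ
  have hKm : Measurable fun w : Fin (N + 1) → Euc (m + 1) =>
      K w * ∏ i, (t • supportHalfspace D θ).indicator (1 : Euc (m + 1) → ℝ) (w i) :=
    hK.mul (Finset.measurable_fun_prod _ fun i _ =>
      (measurable_one.indicator hHm).comp (measurable_pi_apply i))
  have hfm' : Measurable fun x => ENNReal.ofReal (n * homDensity D C ψ x) := by fun_prop
  have hprodm : Measurable fun w : Fin (N + 1) → Euc (m + 1) =>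
      ∏ i, ENNReal.ofReal (n * homDensity D C ψ (w i)) :=
    Finset.measurable_fun_prod _ fun i _ => hfm'.comp (measurable_pi_apply i)
  rw [pi_withDensity volume hfm', lintegral_withDensity_eq_lintegral_mul _ hprodm
    hKm.ennreal_ofReal]
  set L := (A : Euc (m + 1) →ₗ[ℝ] Euc (m + 1)) ∘ₗ diagMap m (√(aux ψ t * t)) (aux ψ t) with hL
  have hdet : |LinearMap.det L| = zConst A * qFun m ψ t := by
    rw [hL, LinearMap.det_comp, det_diagMap, abs_mul, sqrt_pow_mul_aux m ψ (by positivity),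
      ← zConst, abs_of_nonneg (a := qFun m ψ t)]
    unfold qFun
    positivity
  have hdet0 : LinearMap.det L ≠ 0 := by
    rw [hL, LinearMap.det_comp, det_diagMap]
    refine mul_ne_zero (LinearEquiv.isUnit_det' A).ne_zero (mul_ne_zero (pow_ne_zero _ ?_) ha.ne')
    exact (Real.sqrt_pos.2 (mul_pos ha ht)).ne'
  rw [lintegral_cluster hρ hdet0 (A (t • joinPt 0 1))
    (hprodm.mul hKm.ennreal_ofReal)]
  have hpt : ∀ p : Euc (m + 1) × (Fin N → Euc (m + 1)),
      ((fun w : Fin (N + 1) → Euc (m + 1) => ∏ i, ENNReal.ofReal (n * homDensity D C ψ (w i))) *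
        fun w => ENNReal.ofReal (K w *
          ∏ i, (t • supportHalfspace D θ).indicator (1 : Euc (m + 1) → ℝ) (w i)))
        (fun i => A (t • joinPt 0 1) + L p.1 + ρ • consZero p.2 i) =
      ENNReal.ofReal ((n * generator C ψ t) ^ (N + 1)) *
        ENNReal.ofReal (clusterIntegrand F D C ψ θ A t ρ p) := by
    intro p
    have hf0 : ∀ x, 0 ≤ (n : ℝ) * homDensity D C ψ x := fun x =>
      mul_nonneg (Nat.cast_nonneg _) (generator_pos hC ψ _).le
    simp only [Pi.mul_apply]
    rw [hKF (A (t • joinPt 0 1) + L p.1) (consZero p.2),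
      ← ENNReal.ofReal_prod_of_nonneg fun _ _ => hf0 _,
      ← ENNReal.ofReal_mul (Finset.prod_nonneg fun _ _ => hf0 _),
      ← ENNReal.ofReal_mul (by positivity)]
    congr 1
    have hcard : (n * generator C ψ t) ^ (N + 1) =
        ∏ _i : Fin (N + 1), (n * generator C ψ t) := by simp
    rw [clusterIntegrand, hcard, mul_left_comm, mul_left_comm (∏ _i : Fin (N + 1), _),
      ← Finset.prod_mul_distrib, ← Finset.prod_mul_distrib]
    congr 1
    refine Finset.prod_congr rfl fun i _ => ?_
    rw [clusterFactor, clusterPt_eq_affine, ← hL]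
    by_cases hz : A (t • joinPt 0 1) + L p.1 + ρ • consZero p.2 i ∈ t • supportHalfspace D θ
    · rw [Set.indicator_of_mem hz, Set.indicator_of_mem hz, Pi.one_apply]
      field_simp
    · rw [Set.indicator_of_notMem hz, Set.indicator_of_notMem hz]
      simp
  have hcm := measurable_clusterIntegrand (C := C) (θ := θ) (A := A) hD hψ hF ht ρ
  simp_rw [hpt]
  rw [lintegral_const_mul _ hcm.ennreal_ofReal, ENNReal.toReal_mul, ENNReal.toReal_mul,
    ← integral_eq_lintegral_of_nonneg_ae
      (Eventually.of_forall fun p => clusterIntegrand_nonneg hC hF0 t ρ p)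
      hcm.aestronglyMeasurable, hdet, ENNReal.toReal_ofReal, ENNReal.toReal_ofReal]
  · ring
  · positivity
  · have : 0 ≤ qFun m ψ t := by unfold qFun; positivity
    have : 0 ≤ zConst A := abs_nonneg _
    positivity

/-! ### Kernels of U-statistics as cluster functions -/

theorem restrictKernel_eq_ofReal {E : Type*} {n : ℕ} (h : (Fin n → E) → ℝ) (H : Set E)
    (x : Fin n → E) :
    restrictKernel h H x = ENNReal.ofReal (h x * ∏ i, H.indicator 1 (x i)) := by
  unfold restrictKernel
  by_cases hx : x ∈ Set.pi univ fun _ => H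
  · rw [Set.indicator_of_mem hx, Finset.prod_eq_one, mul_one]
    intro i _
    exact Set.indicator_of_mem (hx i trivial) _
  · rw [Set.indicator_of_notMem hx]
    simp only [Set.mem_pi, Set.mem_univ, true_imp_iff, not_forall] at hx
    obtain ⟨i, hi⟩ := hx
    rw [Finset.prod_eq_zero (Finset.mem_univ i) (Set.indicator_of_notMem hi _), mul_zero,
      ENNReal.ofReal_zero]

theorem exists_fstIdx_or_sndIdx {k ℓ : ℕ} (hℓ : ℓ ≤ k + 1) (j : Fin (2 * k + 1 - ℓ + 1)) :
    (∃ i, fstIdx k ℓ i = j) ∨ ∃ i, sndIdx k ℓ i = j := by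
  have hj := j.2
  by_cases h : (j : ℕ) < k + 1
  · exact Or.inl ⟨⟨j, h⟩, Fin.ext (val_fstIdx hℓ _)⟩
  · refine Or.inr ⟨⟨j - (k + 1 - ℓ), by omega⟩, Fin.ext ?_⟩
    rw [val_sndIdx hℓ]
    simp only
    rw [if_neg (by omega)]
    omega

theorem fstIdx_zero {k ℓ : ℕ} (hℓ : ℓ ≤ k + 1) : fstIdx k ℓ 0 = 0 :=
  Fin.ext (val_fstIdx hℓ _)

theorem sndIdx_zero {k ℓ : ℕ} (hℓ : ℓ ≤ k + 1) (hℓ0 : 1 ≤ ℓ) : sndIdx k ℓ 0 = 0 := by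
  refine Fin.ext ?_
  rw [val_sndIdx hℓ, if_pos]
  · rfl
  · exact hℓ0

/-- The product of two kernels with `ℓ` common arguments. -/
def overlapKernel {E : Type*} (k ℓ : ℕ) (h : (Fin (k + 1) → E) → ℝ)
    (w : Fin (2 * k + 1 - ℓ + 1) → E) : ℝ :=
  h (w ∘ fstIdx k ℓ) * h (w ∘ sndIdx k ℓ)

/-- The two index maps together reach every index, so both tuples lie in `H` exactly when all the
points do. -/
theorem restrictKernel_mul_restrictKernel {E : Type*} {k ℓ : ℕ} (hℓ : ℓ ≤ k + 1)
    {h : (Fin (k + 1) → E) → ℝ} (hh : ∀ x, 0 ≤ h x) (H : Set E)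
    (w : Fin (2 * k + 1 - ℓ + 1) → E) :
    restrictKernel h H (w ∘ fstIdx k ℓ) * restrictKernel h H (w ∘ sndIdx k ℓ) =
      restrictKernel (overlapKernel k ℓ h) H w := by
  have hiff : w ∈ (Set.pi univ fun _ => H) ↔
      w ∘ fstIdx k ℓ ∈ (Set.pi univ fun _ : Fin (k + 1) => H) ∧
        w ∘ sndIdx k ℓ ∈ (Set.pi univ fun _ : Fin (k + 1) => H) := by
    simp only [Set.mem_pi, Set.mem_univ, true_imp_iff, Function.comp]
    refine ⟨fun hw => ⟨fun i => hw _, fun i => hw _⟩, fun ⟨h1, h2⟩ j => ?_⟩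
    rcases exists_fstIdx_or_sndIdx hℓ j with ⟨i, rfl⟩ | ⟨i, rfl⟩
    · exact h1 i
    · exact h2 i
  unfold restrictKernel
  by_cases hw : w ∈ (Set.pi univ fun _ => H)
  · rw [Set.indicator_of_mem hw, Set.indicator_of_mem (hiff.1 hw).1,
      Set.indicator_of_mem (hiff.1 hw).2, ← ENNReal.ofReal_mul (hh _)]
    rfl
  · rw [Set.indicator_of_notMem hw]
    rw [hiff, not_and_or] at hw
    rcases hw with hw | hw <;> rw [Set.indicator_of_notMem hw]
    · rw [zero_mul]
    · rw [mul_zero]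

theorem vertexPt_eq_consZero {d N : ℕ} (y : Fin N → Euc d) (i : Fin (N + 1)) :
    vertexPt y i = consZero y i := by
  refine Fin.cases ?_ (fun j => ?_) i
  · simp [vertexPt]
  · have : 0 < ((j.succ : Fin (N + 1)) : ℕ) ∧ ((j.succ : Fin (N + 1)) : ℕ) ≤ N := by
      rw [Fin.val_succ]; omega
    rw [vertexPt, dif_pos this]
    simp

section Kernel

variable {d k : ℕ} {h : ℝ → (Fin (k + 1) → Euc d) → ℝ} (hh : IsLocalKernel k h)

include hh

theorem IsLocalKernel.apply_affine {r : ℝ} (hr : 0 < r) (x : Euc d) (y : Fin (k + 1) → Euc d) :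
    h r (fun i => x + r • y i) = h 1 y := by
  have h1 := hh.translation r hr.le x fun i => r • y i
  have h2 := hh.scaling r hr.le r hr y
  rw [div_self hr.ne'] at h2
  rw [← h2, ← h1]
  congr 1
  ext1 i
  exact add_comm _ _

/-- The bound `κ` may be negative when the kernel at scale one vanishes identically, so its sign is
asserted only where the kernel is nonzero. -/
theorem IsLocalKernel.exists_norm_sub_le : ∃ κ : ℝ, ∀ x, h 1 x ≠ 0 → 0 ≤ κ ∧
    ∀ i j, ‖x i - x j‖ ≤ κ := by
  obtain ⟨κ, hκ⟩ := hh.localized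
  refine ⟨κ, fun x hx => ?_⟩
  have h1 := hκ x (lt_of_le_of_ne (hh.nonneg 1 zero_le_one x) hx.symm)
  refine ⟨Metric.diam_nonneg.trans h1, fun i j => ?_⟩
  rw [← dist_eq_norm]
  exact (Metric.dist_le_diam_of_mem (Set.finite_range x).isBounded ⟨i, rfl⟩ ⟨j, rfl⟩).trans h1

theorem IsLocalKernel.exists_norm_le_of_ne_zero :
    ∃ κ : ℝ, ∀ y : Fin k → Euc d, h 1 (consZero y) ≠ 0 → ‖y‖ ≤ κ := by
  obtain ⟨κ, hκ⟩ := hh.exists_norm_sub_le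
  refine ⟨κ, fun y hy => ?_⟩
  obtain ⟨h0, h1⟩ := hκ _ hy
  refine (pi_norm_le_iff_of_nonneg h0).2 fun i => ?_
  simpa using h1 i.succ 0

/-- For `ℓ ≥ 1` the point with index `0` belongs to both tuples, and every other point shares a
tuple with it. -/
theorem IsLocalKernel.exists_norm_le_of_overlapKernel_ne_zero {ℓ : ℕ} (hℓ : ℓ ≤ k + 1)
    (hℓ0 : 1 ≤ ℓ) : ∃ κ : ℝ, ∀ y : Fin (2 * k + 1 - ℓ) → Euc d,
      overlapKernel k ℓ (h 1) (consZero y) ≠ 0 → ‖y‖ ≤ κ := by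
  obtain ⟨κ, hκ⟩ := hh.exists_norm_sub_le
  refine ⟨κ, fun y hy => ?_⟩
  obtain ⟨h0, h1⟩ := hκ _ (left_ne_zero_of_mul hy)
  obtain ⟨-, h2⟩ := hκ _ (right_ne_zero_of_mul hy)
  refine (pi_norm_le_iff_of_nonneg h0).2 fun i => ?_
  rcases exists_fstIdx_or_sndIdx hℓ i.succ with ⟨j, hj⟩ | ⟨j, hj⟩
  · have := h1 j 0
    simpa [hj, fstIdx_zero hℓ] using this
  · have := h2 j 0
    simpa [hj, sndIdx_zero hℓ hℓ0] using this

theorem IsLocalKernel.measurable_overlapKernel {r : ℝ} (hr : 0 ≤ r) (ℓ : ℕ) :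
    Measurable (overlapKernel k ℓ (h r)) := by
  unfold overlapKernel
  refine ((hh.measurable r hr).comp ?_).mul ((hh.measurable r hr).comp ?_) <;>
  exact measurable_pi_lambda _ fun i => measurable_pi_apply _

end Kernel

/-! ### Identification of the limits -/

theorem prod_limitFactor {m N : ℕ} (D : Set (Euc (m + 1))) (θ : Euc (m + 1))
    (A : Euc (m + 1) ≃ₗ[ℝ] Euc (m + 1)) (c : ℝ) (x : Euc (m + 1)) (y : Fin N → Euc (m + 1)) :
    ∏ i, limitFactor D θ A c x (consZero y i) =
      (if 0 ≤ vert x then (1 : ℝ) else 0) *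
      (∏ i, if -c * vert (A.symm (y i)) ≤ vert x then (1 : ℝ) else 0) *
      Real.exp (-(N + 1) * (horizSq x / 2 + vert x) -
        c * ∑ i, inner ℝ (gradient (gauge D) (supportPoint D θ)) (y i)) := by
  have h0 : vert (A.symm (0 : Euc (m + 1))) = 0 := by rw [map_zero]; rfl
  have hfac : ∀ y : Euc (m + 1), limitFactor D θ A c x y =
      (if -c * vert (A.symm y) ≤ vert x then (1 : ℝ) else 0) *
      Real.exp (-(horizSq x / 2 + vert x +
        c * inner ℝ (gradient (gauge D) (supportPoint D θ)) y)) := by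
    intro y
    unfold limitFactor
    split_ifs <;> simp
  simp_rw [hfac]
  rw [Finset.prod_mul_distrib, ← Real.exp_sum]
  congr 1
  -- The factor at `y_0 = 0` is the indicator of `v ≥ 0`.
  · rw [Fin.prod_univ_succ, consZero_zero, h0, mul_zero]
    simp only [Fin.cons_succ]
  · congr 1
    rw [Fin.sum_univ_succ]
    simp only [Fin.cons_zero, Fin.cons_succ, inner_zero_right, Finset.sum_neg_distrib,
      Finset.sum_add_distrib, Finset.sum_const, Finset.card_univ, Fintype.card_fin, nsmul_eq_mul,
      ← Finset.mul_sum]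
    ring

theorem integral_limitIntegrand_overlapKernel {m k ℓ : ℕ} (hℓ : ℓ ≤ k + 1)
    (h : ℝ → (Fin (k + 1) → Euc (m + 1)) → ℝ) (D : Set (Euc (m + 1))) (θ : Euc (m + 1))
    (A : Euc (m + 1) ≃ₗ[ℝ] Euc (m + 1)) (c : ℝ) :
    zConst A * ∫ p, limitIntegrand (overlapKernel k ℓ (h 1)) D θ A c p =
      varIntegral k ℓ h D θ A c := by
  unfold varIntegral
  congr 1
  refine integral_congr_ae (Eventually.of_forall fun p => ?_)
  have hN : ((2 * k + 1 - ℓ : ℕ) : ℝ) + 1 = 2 * k + 2 - ℓ := by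
    rw [Nat.cast_sub (by omega)]
    push_cast
    ring
  have e1 : (fun i : Fin (k + 1) => vertexPt p.2 i) = consZero p.2 ∘ fstIdx k ℓ := by
    ext1 i
    rw [Function.comp, ← vertexPt_eq_consZero, val_fstIdx hℓ]
  have e2 : (fun i : Fin (k + 1) => vertexPt p.2
      (if (i : ℕ) < ℓ then (i : ℕ) else i + (k + 1 - ℓ))) = consZero p.2 ∘ sndIdx k ℓ := by
    ext1 i
    rw [Function.comp, ← vertexPt_eq_consZero, val_sndIdx hℓ]
  simp only
  rw [limitIntegrand, prod_limitFactor, hN, overlapKernel, e1, e2]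
  ring

theorem integral_eq_integral_joinPt {m : ℕ} (f : Euc (m + 1) → ℝ) :
    ∫ x, f x = ∫ p : Euc m × ℝ, f (joinPt p.1 p.2) := by
  have h1 := EuclideanSpace.volume_preserving_symm_measurableEquiv_toLp (Fin (m + 1))
  have h2 := volume_preserving_piFinSuccAbove (fun _ : Fin (m + 1) => ℝ) (Fin.last m)
  have h3 : MeasurePreserving (MeasurableEquiv.prodComm (α := ℝ) (β := Fin m → ℝ)) :=
    Measure.measurePreserving_swap
  have h4 : MeasurePreserving (MeasurableEquiv.prodCongr (MeasurableEquiv.toLp 2 (Fin m → ℝ))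
      (MeasurableEquiv.refl ℝ)) :=
    (PiLp.volume_preserving_toLp (Fin m)).prod (MeasurePreserving.id volume)
  have h5 := h4.comp (h3.comp (h2.comp h1))
  let e := (((MeasurableEquiv.toLp 2 (Fin (m + 1) → ℝ)).symm.trans
    (MeasurableEquiv.piFinSuccAbove (fun _ : Fin (m + 1) => ℝ) (Fin.last m))).trans
    MeasurableEquiv.prodComm).trans (MeasurableEquiv.prodCongr (MeasurableEquiv.toLp 2 (Fin m → ℝ))
      (MeasurableEquiv.refl ℝ))
  have he : MeasurePreserving e := h5
  rw [← he.integral_comp']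
  refine integral_congr_ae (Eventually.of_forall fun x => ?_)
  have h6 : e x = (horiz x, vert x) := by
    refine Prod.ext ?_ rfl
    ext i
    change x ((Fin.last m).succAbove i) = x (Fin.castSucc i)
    rw [Fin.succAbove_last]
  simp only [h6, joinPt_horiz_vert]

/-- The horizontal coordinate enters only through a Gaussian factor, and integrating it out leaves
`(2π/(k+1))^{m/2}`. -/
theorem integral_limitIntegrand_kernel {m k : ℕ} (h : ℝ → (Fin (k + 1) → Euc (m + 1)) → ℝ)
    (D : Set (Euc (m + 1))) (θ : Euc (m + 1)) (A : Euc (m + 1) ≃ₗ[ℝ] Euc (m + 1)) (c : ℝ)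
    (hint : Integrable (limitIntegrand (N := k) (h 1) D θ A c)) :
    ((k + 1)! : ℝ)⁻¹ * (zConst A * ∫ p, limitIntegrand (N := k) (h 1) D θ A c p) =
      meanLimit k h D θ A c := by
  have hgauss : ∫ u : Euc m, Real.exp (-(((k : ℝ) + 1) / 2) * ‖u‖ ^ 2) =
      (2 * Real.pi / (k + 1)) ^ ((m : ℝ) / 2) := by
    rw [GaussianFourier.integral_rexp_neg_mul_sq_norm (by positivity), finrank_euclideanSpace_fin]
    congr 1
    field_simp
  have hin : ∀ y : Fin k → Euc (m + 1), ∫ x, limitIntegrand (N := k) (h 1) D θ A c (x, y) =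
      (2 * Real.pi / (k + 1)) ^ ((m : ℝ) / 2) * ∫ v in Ioi (0 : ℝ),
      h 1 (Fin.cons (α := fun _ => Euc (m + 1)) 0 y) *
      (∏ i, if -c * vert (A.symm (y i)) ≤ v then (1 : ℝ) else 0) *
      Real.exp (-(k + 1) * v - c * ∑ i,
        inner ℝ (gradient (gauge D) (supportPoint D θ)) (y i)) := by
    intro y
    rw [integral_eq_integral_joinPt, ← integral_Ici_eq_integral_Ioi,
      ← integral_indicator measurableSet_Ici, ← hgauss, ← integral_prod_mul,
      ← Measure.volume_eq_prod]
    refine integral_congr_ae (Eventually.of_forall fun p => ?_)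
    simp only
    rw [limitIntegrand, prod_limitFactor, vert_joinPt, horizSq_eq, horiz_joinPt]
    by_cases hv : 0 ≤ p.2
    · rw [if_pos hv, Set.indicator_of_mem (mem_Ici.2 hv)]
      have : Real.exp (-((k : ℝ) + 1) * (‖p.1‖ ^ 2 / 2 + p.2) - c * ∑ i,
          inner ℝ (gradient (gauge D) (supportPoint D θ)) (y i)) =
          Real.exp (-(((k : ℝ) + 1) / 2) * ‖p.1‖ ^ 2) * Real.exp (-(k + 1) * p.2 - c * ∑ i,
          inner ℝ (gradient (gauge D) (supportPoint D θ)) (y i)) := by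
        rw [← Real.exp_add]
        congr 1
        ring
      rw [this]
      ring
    · rw [if_neg hv, Set.indicator_of_notMem (by simpa using hv)]
      ring
  rw [Measure.volume_eq_prod] at hint ⊢
  rw [integral_prod_symm _ hint]
  simp_rw [hin]
  rw [integral_const_mul, meanLimit]
  ring

/-! ### Asymptotics of cluster integrals at one angle -/

theorem qFun_pos {m : ℕ} {ψ : ℝ → ℝ} (hψ : IsVonMises ψ) {t : ℝ} (ht : 0 < t) :
    0 < qFun m ψ t := by
  have := hψ.aux_pos ht
  unfold qFun
  positivity

theorem tendsto_lintegral_cluster {m N : ℕ} {D : Set (Euc (m + 1))} {C : ℝ} {ψ : ℝ → ℝ}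
    {θ : Euc (m + 1)} {A : Euc (m + 1) ≃ₗ[ℝ] Euc (m + 1)} (hA : IsInitialTransformation D θ A)
    (hD : IsRotund D) (hψ : IsVonMises ψ) (hC : 0 < C) (hf : ∫ x, homDensity D C ψ x = 1)
    (hθ : θ ≠ 0) {t ρ : ℕ → ℝ} (ht_pos : ∀ n, 0 < t n) (ht : Tendsto t atTop atTop)
    (hρ : ∀ n, 0 < ρ n) (hrt : Tendsto (fun n => ρ n / t n) atTop (𝓝 0)) {c : ℝ}
    (hra : Tendsto (fun n => ρ n / aux ψ (t n)) atTop (𝓝 c))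
    {K : ℕ → (Fin (N + 1) → Euc (m + 1)) → ℝ} {F : (Fin (N + 1) → Euc (m + 1)) → ℝ} {M κ : ℝ}
    (hK : ∀ n, Measurable (K n)) (hF : Measurable F) (hF0 : ∀ y, 0 ≤ F y) (hFM : ∀ y, F y ≤ M)
    (hFκ : ∀ y, F (consZero y) ≠ 0 → ‖y‖ ≤ κ)
    (hKF : ∀ n x y, K n (fun i => x + ρ n • y i) = F y) :
    Integrable (limitIntegrand F D θ A c) ∧
    Tendsto (fun n : ℕ => (∫⁻ x, restrictKernel (K n) (t n • supportHalfspace D θ) x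
      ∂(Measure.pi fun _ : Fin (N + 1) =>
        volume.withDensity fun x => ENNReal.ofReal (n * homDensity D C ψ x))).toReal /
      ((n * generator C ψ (t n)) ^ (N + 1) * ρ n ^ ((m + 1) * N) * qFun m ψ (t n))) atTop
      (𝓝 (zConst A * ∫ p, limitIntegrand F D θ A c p)) := by
  obtain ⟨h1, h2⟩ := tendsto_integral_clusterIntegrand hA hD hψ hC hθ hF hF0 hFM hFκ ht_pos ht
    hrt hra
  refine ⟨h1, (h2.const_mul (zConst A)).congr' ?_⟩
  -- The index `n = 0` is discarded because the normalization vanishes there.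
  filter_upwards [eventually_gt_atTop 0] with n hn
  have hn' : (0 : ℝ) < n := by exact_mod_cast hn
  simp_rw [restrictKernel_eq_ofReal]
  rw [integral_cluster_eq A hD hψ hC hf n (ht_pos n) (hρ n) (hK n) hF hF0 (hKF n),
    mul_div_cancel_left₀]
  have := hρ n
  have := generator_pos hC ψ (t n)
  have := qFun_pos (m := m) hψ (ht_pos n)
  positivity

/-! ### The three regimes -/

section Regimes

variable {k m : ℕ} {w r q ν : ℕ → ℝ} {J : ℕ → ℕ → ℝ} {I : ℕ → ℝ} {V : ℕ → ℝ}
  (hw : ∀ᶠ n in atTop, 0 < w n) (hr : ∀ n, 0 < r n) (hq : ∀ n, 0 < q n)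
  (hν : ∀ n, ν n = w n * r n ^ (m + 1))
  (hV : ∀ n, V n = ∑ ℓ ∈ Finset.Icc 1 (k + 1), ((ℓ ! : ℝ) * ((k + 1 - ℓ)! : ℝ) ^ 2)⁻¹ * J ℓ n)
  (hJ : ∀ ℓ ∈ Finset.Icc 1 (k + 1), Tendsto (fun n => J ℓ n /
    (w n ^ (2 * k + 1 - ℓ + 1) * r n ^ ((m + 1) * (2 * k + 1 - ℓ)) * q n)) atTop (𝓝 (I ℓ)))

include hw hr hq hV hJ

/-- `T` is the normalization of a regime and `c' ℓ` the ratio of the natural order of the `ℓ`-th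
overlap to it; a regime is settled by the limits of these ratios. -/
theorem tendsto_sum_overlap_div {T : ℕ → ℝ} {c : ℕ → ℝ} {c' : ℕ → ℕ → ℝ}
    (hT : ∀ ℓ ∈ Finset.Icc 1 (k + 1), ∀ᶠ n in atTop,
      w n ^ (2 * k + 1 - ℓ + 1) * r n ^ ((m + 1) * (2 * k + 1 - ℓ)) * q n = T n * c' ℓ n)
    (hc : ∀ ℓ ∈ Finset.Icc 1 (k + 1), Tendsto (c' ℓ) atTop (𝓝 (c ℓ))) :
    Tendsto (fun n => V n / T n) atTop (𝓝 (∑ ℓ ∈ Finset.Icc 1 (k + 1),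
      ((ℓ ! : ℝ) * ((k + 1 - ℓ)! : ℝ) ^ 2)⁻¹ * (I ℓ * c ℓ))) := by
  simp_rw [hV, Finset.sum_div]
  refine tendsto_finsetSum _ fun ℓ hℓ => ?_
  simp_rw [mul_div_assoc]
  refine ((((hJ ℓ hℓ).mul (hc ℓ hℓ)).congr' ?_)).const_mul _
  filter_upwards [hw, hT ℓ hℓ] with n hn hTn
  have h1 : 0 < w n ^ (2 * k + 1 - ℓ + 1) * r n ^ ((m + 1) * (2 * k + 1 - ℓ)) * q n := by
    have := hr n
    have := hq n
    positivity
  rw [hTn] at h1 ⊢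
  have h2 : T n ≠ 0 := left_ne_zero_of_mul h1.ne'
  have h3 : c' ℓ n ≠ 0 := right_ne_zero_of_mul h1.ne'
  field_simp

include hν

/-- The ratio is `ν ^ (k + 1 - ℓ)`, so only complete overlap survives. -/
theorem tendsto_div_of_tendsto_zero (hν0 : Tendsto ν atTop (𝓝 0)) :
    Tendsto (fun n => V n / (w n ^ (k + 1) * r n ^ ((m + 1) * k) * q n)) atTop
      (𝓝 (I (k + 1) / (k + 1)!)) := by
  have h := tendsto_sum_overlap_div (c := fun ℓ => 0 ^ (k + 1 - ℓ))
    (c' := fun ℓ n => ν n ^ (k + 1 - ℓ))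
    (T := fun n => w n ^ (k + 1) * r n ^ ((m + 1) * k) * q n) hw hr hq hV hJ ?_
    fun ℓ _ => hν0.pow _
  · convert h using 2
    rw [Finset.sum_eq_single_of_mem (k + 1) (by simp)]
    · simp [div_eq_inv_mul]
    · intro ℓ hℓ hne
      rw [zero_pow, mul_zero, mul_zero]
      have := (Finset.mem_Icc.1 hℓ).2
      omega
  · intro ℓ hℓ
    refine Eventually.of_forall fun n => ?_
    have h1 := (Finset.mem_Icc.1 hℓ).2
    have e1 : 2 * k + 1 - ℓ + 1 = k + 1 + (k + 1 - ℓ) := by omega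
    have e2 : 2 * k + 1 - ℓ = k + (k + 1 - ℓ) := by omega
    rw [hν, e1, e2, mul_pow, ← pow_mul, pow_add, mul_add, pow_add]
    ring

/-- The ratio is `ν ^ (2k + 1 - ℓ)`, with a finite limit for each `ℓ`; all overlaps are of the same
order. -/
theorem tendsto_div_of_tendsto_pos {χ : ℝ} (hνχ : Tendsto ν atTop (𝓝 χ)) :
    Tendsto (fun n => V n / (w n * q n)) atTop
      (𝓝 (∑ ℓ ∈ Finset.Icc 1 (k + 1),
            χ ^ (2 * k + 1 - ℓ) * I ℓ / (ℓ ! * ((k + 1 - ℓ)! : ℝ) ^ 2))) := by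
  have h := tendsto_sum_overlap_div (c := fun ℓ => χ ^ (2 * k + 1 - ℓ))
    (c' := fun ℓ n => ν n ^ (2 * k + 1 - ℓ)) (T := fun n => w n * q n) hw hr hq hV hJ ?_
    fun ℓ _ => hνχ.pow _
  · convert h using 2
    refine Finset.sum_congr rfl fun ℓ _ => ?_
    rw [div_eq_inv_mul, mul_comm (I ℓ)]
  · intro ℓ hℓ
    refine Eventually.of_forall fun n => ?_
    rw [hν, mul_pow, ← pow_mul, pow_succ]
    ring

/-- The ratio is `ν⁻¹ ^ (ℓ - 1)`, so only pairs sharing a single point survive. -/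
theorem tendsto_div_of_tendsto_atTop (hν' : Tendsto ν atTop atTop) :
    Tendsto (fun n => V n / (w n ^ (2 * k + 1) * r n ^ (2 * (m + 1) * k) * q n)) atTop
      (𝓝 (I 1 / (k ! : ℝ) ^ 2)) := by
  have h := tendsto_sum_overlap_div (c := fun ℓ => 0 ^ (ℓ - 1))
    (c' := fun ℓ n => (ν n)⁻¹ ^ (ℓ - 1))
    (T := fun n => w n ^ (2 * k + 1) * r n ^ (2 * (m + 1) * k) * q n) hw hr hq hV hJ ?_
    fun ℓ _ => hν'.inv_tendsto_atTop.pow _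
  · convert h using 2
    rw [Finset.sum_eq_single_of_mem 1 (by simp)]
    · simp [div_eq_inv_mul]
    · intro ℓ hℓ hne
      rw [zero_pow, mul_zero, mul_zero]
      have := (Finset.mem_Icc.1 hℓ).1
      omega
  · intro ℓ hℓ
    filter_upwards [hw] with n hn
    have hrn := hr n
    have h1 := Finset.mem_Icc.1 hℓ
    have e1 : 2 * k + 1 = 2 * k + 1 - ℓ + 1 + (ℓ - 1) := by omega
    have e2 : 2 * (m + 1) * k = (m + 1) * (2 * k + 1 - ℓ) + (m + 1) * (ℓ - 1) := by
      rw [← mul_add, show 2 * k + 1 - ℓ + (ℓ - 1) = 2 * k by omega]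
      ring
    have e3 : w n ^ (2 * k + 1) * r n ^ (2 * (m + 1) * k) =
        w n ^ (2 * k + 1 - ℓ + 1) * r n ^ ((m + 1) * (2 * k + 1 - ℓ)) * ν n ^ (ℓ - 1) := by
      rw [e2, hν, mul_pow, ← pow_mul, pow_add (r n)]
      nth_rw 1 [e1]
      rw [pow_add (w n)]
      ring
    have hνn : 0 < ν n := by rw [hν]; positivity
    rw [e3, inv_pow]
    field_simp

end Regimes

/-! ### Covariances at different angles -/

/-- The tail of the density is of smaller order than its mass near a support point. -/
theorem exists_tail_bound {m : ℕ} {D : Set (Euc (m + 1))} {C : ℝ} {ψ : ℝ → ℝ} (hD : IsRotund D)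
    (hψ : IsVonMises ψ) (hC : 0 < C) {δ : ℝ} (hδ : 0 < δ) :
    ∃ B : ℝ, 0 ≤ B ∧ ∀ᶠ t in atTop, ∀ b : ℝ, 0 ≤ b →
      ∫⁻ x, {x | (1 + δ) * t ≤ gauge D x}.indicator
        (fun x => ENNReal.ofReal (b * homDensity D C ψ x)) x ≤
      ENNReal.ofReal (b * generator C ψ t * qFun m ψ t * (B * (aux ψ t / t))) := by
  obtain ⟨R, hR0, hR⟩ := hD.exists_norm_le
  -- One more than the dimension: enough for integrability, with a factor `a/t` to spare.
  set p := m + 2 with hp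
  have hp0 : 0 < p := by omega
  have hp0' : (0 : ℝ) < p := by exact_mod_cast hp0
  -- For `γ ≥ 1 + δ` one has `γ - 1 ≥ δ/(2+δ) · (1 + γ)`, and `‖x‖ ≤ R γ` compares `1 + γ` with `1 +
  -- ‖x‖`.
  set c := δ / (2 + δ) * min 1 R⁻¹ with hc
  have hc0 : 0 < c := by positivity
  have hgap : ∀ x, 1 + δ ≤ gauge D x → c * (1 + ‖x‖) ≤ gauge D x - 1 := by
    intro x hx
    have h1 : min 1 R⁻¹ * (1 + ‖x‖) ≤ 1 + gauge D x := by
      rw [mul_add, mul_one]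
      refine add_le_add (min_le_left _ _) ?_
      calc min 1 R⁻¹ * ‖x‖ ≤ R⁻¹ * (R * gauge D x) := by
            gcongr
            · exact min_le_right _ _
            · exact hR x
        _ = gauge D x := by field_simp
    rw [hc, mul_assoc]
    calc δ / (2 + δ) * (min 1 R⁻¹ * (1 + ‖x‖)) ≤ δ / (2 + δ) * (1 + gauge D x) := by gcongr
      _ ≤ gauge D x - 1 := by
        rw [div_mul_eq_mul_div, div_le_iff₀ (by positivity)]
        nlinarith
  have hint : Integrable fun x : Euc (m + 1) => ((1 + ‖x‖) ^ p)⁻¹ := by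
    have h2 : Integrable fun x : Euc (m + 1) => (1 + ‖x‖) ^ (-(p : ℝ)) := by
      refine integrable_one_add_norm ?_
      rw [finrank_euclideanSpace_fin]
      exact_mod_cast Nat.lt_succ_self _
    refine h2.congr (Eventually.of_forall fun x => ?_)
    simp only
    rw [Real.rpow_neg (by positivity), Real.rpow_natCast]
  set I₀ := ∫ x : Euc (m + 1), ((1 + ‖x‖) ^ p)⁻¹ with hI₀
  have hI₀0 : 0 ≤ I₀ := integral_nonneg fun x => by positivity
  have hI₀' : ∫⁻ x : Euc (m + 1), ENNReal.ofReal ((1 + ‖x‖) ^ p)⁻¹ = ENNReal.ofReal I₀ :=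
    (ofReal_integral_eq_lintegral_ofReal hint (Eventually.of_forall fun x => by positivity)).symm
  refine ⟨(p / c) ^ p * I₀, by positivity, ?_⟩
  have h1 : ∀ᶠ t in atTop, aux ψ t / t < 1 := hψ.tendsto_aux_div.eventually_lt_const one_pos
  filter_upwards [hψ.eventually_generator_div_le hC hp0, h1, eventually_gt_atTop 0]
    with t ht hat ht0 b hb
  have ha : 0 < aux ψ t := hψ.aux_pos ht0
  have hg := generator_pos hC ψ t
  have hat' := (div_lt_one ht0).1 hat
  have hfm : Measurable fun x => {x | (1 + δ) * t ≤ gauge D x}.indicator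
      (fun x => ENNReal.ofReal (b * homDensity D C ψ x)) x := by
    refine Measurable.indicator ?_ (measurableSet_le measurable_const
      hD.continuous_gauge.measurable)
    exact ((hψ.continuous_homDensity hD C).measurable.const_mul b).ennreal_ofReal
  have hdet : LinearMap.det (t • (LinearMap.id : Euc (m + 1) →ₗ[ℝ] _)) = t ^ (m + 1) := by
    rw [LinearMap.det_smul, LinearMap.det_id, mul_one, finrank_euclideanSpace_fin]
  have hdet0 : LinearMap.det (t • (LinearMap.id : Euc (m + 1) →ₗ[ℝ] _)) ≠ 0 := by
    rw [hdet]; positivity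
  rw [lintegral_comp_affine volume hdet0 0 hfm, hdet, abs_of_pos (by positivity)]
  have hpt : ∀ x : Euc (m + 1), {x | (1 + δ) * t ≤ gauge D x}.indicator
      (fun x => ENNReal.ofReal (b * homDensity D C ψ x))
        (0 + (t • (LinearMap.id : Euc (m + 1) →ₗ[ℝ] _)) x) ≤
      ENNReal.ofReal (b * generator C ψ t * ((p / c) ^ p * (aux ψ t / t) ^ p)) *
        ENNReal.ofReal ((1 + ‖x‖) ^ p)⁻¹ := by
    intro x
    rw [zero_add, LinearMap.smul_apply, LinearMap.id_apply]
    by_cases hx : t • x ∈ {x | (1 + δ) * t ≤ gauge D x}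
    · rw [Set.indicator_of_mem hx, ← ENNReal.ofReal_mul (by positivity)]
      refine ENNReal.ofReal_le_ofReal ?_
      have hgt : gauge D (t • x) = t * gauge D x := gauge_smul_of_nonneg ht0.le x
      have hx' : 1 + δ ≤ gauge D x := by
        have : (1 + δ) * t ≤ gauge D (t • x) := hx
        rw [hgt, mul_comm t] at this
        exact le_of_mul_le_mul_right this ht0
      have hgx := hgap x hx'
      have hnx : 0 < c * (1 + ‖x‖) := by positivity
      set s := t / aux ψ t * (gauge D x - 1) with hs
      have hs1 : t / aux ψ t * (c * (1 + ‖x‖)) ≤ s := by rw [hs]; gcongr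
      have hs2 : 0 < t / aux ψ t * (c * (1 + ‖x‖)) := by positivity
      have hs0 : 0 < s := hs2.trans_le hs1
      have hts : t * gauge D x = t + aux ψ t * s := by
        rw [hs]; field_simp; ring
      have h4 := ht s hs0.le
      rw [div_le_iff₀ hg] at h4
      have h5 : ((1 + s / p) ^ p)⁻¹ ≤ (p / c) ^ p * (aux ψ t / t) ^ p * ((1 + ‖x‖) ^ p)⁻¹ := by
        have h6 : t / aux ψ t * (c * (1 + ‖x‖)) / p ≤ 1 + s / p := by
          have : t / aux ψ t * (c * (1 + ‖x‖)) / p ≤ s / p := by gcongr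
          linarith
        have h7 : (p / c) ^ p * (aux ψ t / t) ^ p * ((1 + ‖x‖) ^ p)⁻¹ =
            ((t / aux ψ t * (c * (1 + ‖x‖)) / p) ^ p)⁻¹ := by
          rw [← mul_pow, ← inv_pow, ← mul_pow, ← inv_pow]
          congr 1
          field_simp
        rw [h7]
        have h8 : 0 < t / aux ψ t * (c * (1 + ‖x‖)) / p := by positivity
        gcongr
      have h9 : homDensity D C ψ (t • x) = generator C ψ (t + aux ψ t * s) := by
        rw [homDensity, hgt, hts]
      rw [h9]
      calc b * generator C ψ (t + aux ψ t * s)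
          ≤ b * (((1 + s / p) ^ p)⁻¹ * generator C ψ t) := by gcongr
        _ ≤ b * ((p / c) ^ p * (aux ψ t / t) ^ p * ((1 + ‖x‖) ^ p)⁻¹ * generator C ψ t) := by
            gcongr
        _ = _ := by ring
    · rw [Set.indicator_of_notMem hx]
      exact bot_le
  refine (mul_le_mul' le_rfl (lintegral_mono hpt)).trans ?_
  rw [lintegral_const_mul _ (by fun_prop), hI₀', ← ENNReal.ofReal_mul (by positivity),
    ← ENNReal.ofReal_mul (by positivity)]
  refine ENNReal.ofReal_le_ofReal ?_
  -- This uses `a ≤ t`, hence `a ≤ √(a t)`.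
  have hq : aux ψ t ^ (m + 1) ≤ qFun m ψ t := by
    rw [← sqrt_pow_mul_aux m ψ (by positivity), pow_succ]
    gcongr
    exact Real.le_sqrt_of_sq_le (by nlinarith)
  have htp : t ^ (m + 1) * (aux ψ t / t) ^ p = aux ψ t ^ (m + 1) * (aux ψ t / t) := by
    rw [hp, pow_succ (aux ψ t / t) (m + 1), ← mul_assoc, ← mul_pow]
    congr 2
    field_simp
  calc t ^ (m + 1) * (b * generator C ψ t * ((p / c) ^ p * (aux ψ t / t) ^ p) * I₀)
      = b * generator C ψ t * (t ^ (m + 1) * (aux ψ t / t) ^ p) * ((p / c) ^ p * I₀) := by ring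
    _ = b * generator C ψ t * aux ψ t ^ (m + 1) * ((p / c) ^ p * I₀ * (aux ψ t / t)) := by
        rw [htp]; ring
    _ ≤ b * generator C ψ t * qFun m ψ t * ((p / c) ^ p * I₀ * (aux ψ t / t)) := by gcongr

/-! ### Clusters whose first point is far out. -/

section Tail

variable {m N : ℕ} {D : Set (Euc (m + 1))} {C : ℝ} {ψ : ℝ → ℝ}

/-- The first point carries the tail mass, the other `N` densities are bounded by `n g(t)`, and the
kernel is integrated over the displacements. -/
theorem lintegral_cluster_tail_le (hD : IsRotund D) (hψ : IsVonMises ψ) (hC : 0 < C)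
    (hf : ∫ x, homDensity D C ψ x = 1) (n : ℕ) {t ρ δ : ℝ} (ht : 0 < t) (hρ : 0 < ρ)
    {K F : (Fin (N + 1) → Euc (m + 1)) → ℝ} (hK : Measurable K) (hF : Measurable F)
    (hKF : ∀ x y, K (fun i => x + ρ • y i) = F y)
    {G : (Fin (N + 1) → Euc (m + 1)) → ℝ≥0∞} (hGK : ∀ w, G w ≤ ENNReal.ofReal (K w))
    (hG0 : ∀ w, G w ≠ 0 → (1 + δ) * t ≤ gauge D (w 0))
    (hG1 : ∀ w, G w ≠ 0 → ∀ i, t ≤ gauge D (w i)) :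
    ∫⁻ w, G w ∂(Measure.pi fun _ : Fin (N + 1) =>
        volume.withDensity fun x => ENNReal.ofReal (n * homDensity D C ψ x)) ≤
      ENNReal.ofReal (ρ ^ ((m + 1) * N)) * (ENNReal.ofReal (n * generator C ψ t) ^ N *
        ((∫⁻ x, {x | (1 + δ) * t ≤ gauge D x}.indicator
          (fun x => ENNReal.ofReal (n * homDensity D C ψ x)) x) *
        ∫⁻ y : Fin N → Euc (m + 1), ENNReal.ofReal (F (consZero y)))) := by
  have hfm : Measurable fun x => ENNReal.ofReal (n * homDensity D C ψ x) :=
    ((hψ.continuous_homDensity hD C).measurable.const_mul _).ennreal_ofReal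
  have := isFiniteMeasure_withDensity_homDensity hf n
  set U : Euc (m + 1) → ℝ≥0∞ := {x | (1 + δ) * t ≤ gauge D x}.indicator
    fun x => ENNReal.ofReal (n * homDensity D C ψ x) with hU
  have hUm : Measurable U :=
    hfm.indicator (measurableSet_le measurable_const hD.continuous_gauge.measurable)
  have hprod : Measurable fun w : Fin (N + 1) → Euc (m + 1) =>
      ∏ i, ENNReal.ofReal (n * homDensity D C ψ (w i)) :=
    Finset.measurable_fun_prod _ fun i _ => hfm.comp (measurable_pi_apply i)
  have hpt : ∀ w : Fin (N + 1) → Euc (m + 1),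
      (∏ i, ENNReal.ofReal (n * homDensity D C ψ (w i))) * G w ≤
        ENNReal.ofReal (n * generator C ψ t) ^ N * (U (w 0) * ENNReal.ofReal (K w)) := by
    intro w
    by_cases hw : G w = 0
    · rw [hw, mul_zero]
      exact bot_le
    · rw [Fin.prod_univ_succ, mul_comm (ENNReal.ofReal (n * homDensity D C ψ (w 0))), mul_assoc]
      refine mul_le_mul' ?_ (mul_le_mul' ?_ (hGK w))
      · refine (Finset.prod_le_pow_card _ _ (ENNReal.ofReal (n * generator C ψ t))
          fun i _ => ENNReal.ofReal_le_ofReal ?_).trans (by simp)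
        exact mul_le_mul_of_nonneg_left (hψ.generator_le hC ht.le (hG1 w hw _)) n.cast_nonneg
      · have hw0 : w 0 ∈ {x | (1 + δ) * t ≤ gauge D x} := hG0 w hw
        rw [hU, Set.indicator_of_mem hw0]
  rw [pi_withDensity volume hfm (N + 1)]
  refine (lintegral_withDensity_le_lintegral_mul _ hprod _).trans ?_
  refine (lintegral_mono hpt).trans ?_
  have hFm : Measurable fun y : Fin N → Euc (m + 1) => ENNReal.ofReal (F (consZero y)) :=
    (hF.comp measurable_consZero).ennreal_ofReal
  have hKm : Measurable fun w : Fin (N + 1) → Euc (m + 1) => U (w 0) * ENNReal.ofReal (K w) :=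
    (hUm.comp (measurable_pi_apply 0)).mul hK.ennreal_ofReal
  have hdet : LinearMap.det (LinearMap.id : Euc (m + 1) →ₗ[ℝ] Euc (m + 1)) ≠ 0 := by
    rw [LinearMap.det_id]; exact one_ne_zero
  rw [lintegral_const_mul _ hKm, lintegral_cluster hρ hdet 0 hKm, LinearMap.det_id, abs_one,
    one_mul]
  have hsplit : ∀ p : Euc (m + 1) × (Fin N → Euc (m + 1)),
      U (0 + LinearMap.id (R := ℝ) p.1 + ρ • consZero p.2 0) * ENNReal.ofReal
        (K fun i => 0 + LinearMap.id (R := ℝ) p.1 + ρ • consZero p.2 i) =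
      U p.1 * ENNReal.ofReal (F (consZero p.2)) := by
    intro p
    rw [hKF, consZero_zero, smul_zero, add_zero, zero_add, LinearMap.id_apply]
  rw [lintegral_congr hsplit, Measure.volume_eq_prod, lintegral_prod_mul hUm.aemeasurable
    hFm.aemeasurable]
  exact (mul_left_comm _ _ _).le

theorem tendsto_lintegral_cluster_tail (hD : IsRotund D) (hψ : IsVonMises ψ) (hC : 0 < C)
    (hf : ∫ x, homDensity D C ψ x = 1) {δ : ℝ} (hδ : 0 < δ) {t ρ : ℕ → ℝ} (ht_pos : ∀ n, 0 < t n)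
    (ht : Tendsto t atTop atTop) (hρ : ∀ n, 0 < ρ n)
    {K : ℕ → (Fin (N + 1) → Euc (m + 1)) → ℝ} {F : (Fin (N + 1) → Euc (m + 1)) → ℝ} {M κ : ℝ}
    (hK : ∀ n, Measurable (K n)) (hF : Measurable F) (hFM : ∀ y, F y ≤ M)
    (hFκ : ∀ y, F (consZero y) ≠ 0 → ‖y‖ ≤ κ)
    (hKF : ∀ n x y, K n (fun i => x + ρ n • y i) = F y)
    {G : ℕ → (Fin (N + 1) → Euc (m + 1)) → ℝ≥0∞} (hGK : ∀ n w, G n w ≤ ENNReal.ofReal (K n w))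
    (hG0 : ∀ n w, G n w ≠ 0 → (1 + δ) * t n ≤ gauge D (w 0))
    (hG1 : ∀ n w, G n w ≠ 0 → ∀ i, t n ≤ gauge D (w i)) :
    Tendsto (fun n : ℕ => (∫⁻ w, G n w ∂(Measure.pi fun _ : Fin (N + 1) =>
        volume.withDensity fun x => ENNReal.ofReal (n * homDensity D C ψ x))).toReal /
      ((n * generator C ψ (t n)) ^ (N + 1) * ρ n ^ ((m + 1) * N) * qFun m ψ (t n))) atTop
      (𝓝 0) := by
  obtain ⟨B, hB, hbound⟩ := exists_tail_bound hD hψ hC hδ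
  have hfin : ∫⁻ y : Fin N → Euc (m + 1), ENNReal.ofReal (F (consZero y)) ≠ ∞ := by
    have h1 : ∀ y : Fin N → Euc (m + 1), ENNReal.ofReal (F (consZero y)) ≤
        (Metric.closedBall 0 κ).indicator (fun _ => ENNReal.ofReal M) y := by
      intro y
      by_cases hy : F (consZero y) = 0
      · rw [hy, ENNReal.ofReal_zero]
        exact bot_le
      · rw [Set.indicator_of_mem (mem_closedBall_zero_iff.2 (hFκ y hy))]
        exact ENNReal.ofReal_le_ofReal (hFM _)
    refine ((lintegral_mono h1).trans_lt ?_).ne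
    rw [lintegral_indicator_const Metric.isClosed_closedBall.measurableSet]
    exact ENNReal.mul_lt_top ENNReal.ofReal_lt_top
      (isCompact_closedBall _ _).measure_lt_top
  set Φ := (∫⁻ y : Fin N → Euc (m + 1), ENNReal.ofReal (F (consZero y))).toReal with hΦ
  have hΦ0 : 0 ≤ Φ := ENNReal.toReal_nonneg
  have hlim : Tendsto (fun n => Φ * (B * (aux ψ (t n) / t n))) atTop (𝓝 0) := by
    have := ((hψ.tendsto_aux_div.comp ht).const_mul B).const_mul Φ
    simpa using this
  refine squeeze_zero' (Eventually.of_forall fun n => ?_) ?_ hlim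
  · have := hρ n
    have := generator_pos hC ψ (t n)
    have := qFun_pos (m := m) hψ (ht_pos n)
    positivity
  filter_upwards [ht.eventually hbound, eventually_gt_atTop 0] with n hb hn
  have hn' : (0 : ℝ) < n := by exact_mod_cast hn
  have h1 := hρ n
  have h2 := generator_pos hC ψ (t n)
  have h3 := qFun_pos (m := m) hψ (ht_pos n)
  have h4 := hψ.aux_pos (ht_pos n)
  have h5 := ht_pos n
  rw [div_le_iff₀ (by positivity)]
  refine ENNReal.toReal_le_of_le_ofReal (by positivity) ?_
  refine (lintegral_cluster_tail_le hD hψ hC hf n h5 h1 (hK n) hF (hKF n) (hGK n) (hG0 n)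
    (hG1 n)).trans ?_
  refine (mul_le_mul' le_rfl (mul_le_mul' le_rfl (mul_le_mul' (hb n hn'.le) le_rfl))).trans ?_
  rw [← ENNReal.ofReal_toReal hfin, ← hΦ, ← ENNReal.ofReal_pow (by positivity),
    ← ENNReal.ofReal_mul (by positivity), ← ENNReal.ofReal_mul (by positivity),
    ← ENNReal.ofReal_mul (by positivity)]
  refine ENNReal.ofReal_le_ofReal (le_of_eq ?_)
  ring

end Tail

theorem IsLocalKernel.overlapKernel_nonneg {d k ℓ : ℕ} {h : ℝ → (Fin (k + 1) → Euc d) → ℝ}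
    (hh : IsLocalKernel k h) {r : ℝ} (hr : 0 ≤ r) (w : Fin (2 * k + 1 - ℓ + 1) → Euc d) :
    0 ≤ overlapKernel k ℓ (h r) w :=
  mul_nonneg (hh.nonneg r hr _) (hh.nonneg r hr _)

theorem IsLocalKernel.overlapKernel_le {d k ℓ : ℕ} {h : ℝ → (Fin (k + 1) → Euc d) → ℝ}
    (hh : IsLocalKernel k h) {r M : ℝ} (hr : 0 ≤ r) (hM : ∀ x, h r x ≤ M)
    (w : Fin (2 * k + 1 - ℓ + 1) → Euc d) : overlapKernel k ℓ (h r) w ≤ M * M :=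
  mul_le_mul (hM _) (hM _) (hh.nonneg r hr _) ((hh.nonneg r hr _).trans (hM (w ∘ fstIdx k ℓ)))

theorem IsLocalKernel.overlapKernel_affine {d k ℓ : ℕ} {h : ℝ → (Fin (k + 1) → Euc d) → ℝ}
    (hh : IsLocalKernel k h) {r : ℝ} (hr : 0 < r) (x : Euc d)
    (y : Fin (2 * k + 1 - ℓ + 1) → Euc d) :
    overlapKernel k ℓ (h r) (fun i => x + r • y i) = overlapKernel k ℓ (h 1) y :=
  congr_arg₂ (· * ·) (hh.apply_affine hr x (y ∘ fstIdx k ℓ))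
    (hh.apply_affine hr x (y ∘ sndIdx k ℓ))

/-! ### Pairs of halfspaces -/

section Pair

variable {E : Type*} {k ℓ : ℕ} {h : (Fin (k + 1) → E) → ℝ} {H H' : Set E}
  {w : Fin (2 * k + 1 - ℓ + 1) → E}

theorem mem_of_restrictKernel_ne_zero {n : ℕ} {h : (Fin n → E) → ℝ} {x : Fin n → E}
    (hx : restrictKernel h H x ≠ 0) (i : Fin n) : x i ∈ H :=
  Set.mem_of_indicator_ne_zero hx i trivial

theorem mem_inter_of_restrictKernel_mul_ne_zero (hℓ : ℓ ≤ k + 1) (hℓ0 : 1 ≤ ℓ)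
    (hw : restrictKernel h H (w ∘ fstIdx k ℓ) * restrictKernel h H' (w ∘ sndIdx k ℓ) ≠ 0) :
    w 0 ∈ H ∩ H' := by
  have h1 := mem_of_restrictKernel_ne_zero (left_ne_zero_of_mul hw) 0
  have h2 := mem_of_restrictKernel_ne_zero (right_ne_zero_of_mul hw) 0
  rw [Function.comp, fstIdx_zero hℓ] at h1
  rw [Function.comp, sndIdx_zero hℓ hℓ0] at h2
  exact ⟨h1, h2⟩

theorem mem_union_of_restrictKernel_mul_ne_zero (hℓ : ℓ ≤ k + 1)
    (hw : restrictKernel h H (w ∘ fstIdx k ℓ) * restrictKernel h H' (w ∘ sndIdx k ℓ) ≠ 0)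
    (j : Fin (2 * k + 1 - ℓ + 1)) : w j ∈ H ∪ H' := by
  rcases exists_fstIdx_or_sndIdx hℓ j with ⟨i, rfl⟩ | ⟨i, rfl⟩
  · exact Or.inl (mem_of_restrictKernel_ne_zero (left_ne_zero_of_mul hw) i)
  · exact Or.inr (mem_of_restrictKernel_ne_zero (right_ne_zero_of_mul hw) i)

theorem restrictKernel_mul_restrictKernel_le (hh : ∀ x, 0 ≤ h x) :
    restrictKernel h H (w ∘ fstIdx k ℓ) * restrictKernel h H' (w ∘ sndIdx k ℓ) ≤
      ENNReal.ofReal (overlapKernel k ℓ h w) := by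
  rw [overlapKernel, ENNReal.ofReal_mul (hh _)]
  exact mul_le_mul' (Set.indicator_le_self _ _ _) (Set.indicator_le_self _ _ _)

theorem overlapIntegral_eq_zero_of_disjoint [MeasurableSpace E] (μ : Measure E) (hℓ : ℓ ≤ k + 1)
    (hℓ0 : 1 ≤ ℓ) (hH : Disjoint H H') :
    overlapIntegral μ k ℓ (restrictKernel h H) (restrictKernel h H') = 0 := by
  unfold overlapIntegral
  rw [← lintegral_zero]
  refine lintegral_congr fun w => ?_
  by_contra hw
  obtain ⟨h1, h2⟩ := mem_inter_of_restrictKernel_mul_ne_zero hℓ hℓ0 hw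
  exact Set.disjoint_left.1 hH h1 h2

/-- The shared point lies in the intersection of the two halfspaces, where the gauge is at least `(1
+ δ) t`; every other point lies in one of them, where it is at least `t`. -/
theorem tendsto_overlapIntegral_of_ne {m k ℓ : ℕ} (hℓ : ℓ ≤ k + 1) (hℓ0 : 1 ≤ ℓ)
    {D : Set (Euc (m + 1))} {C : ℝ} {ψ : ℝ → ℝ} (hD : IsRotund D) (hψ : IsVonMises ψ) (hC : 0 < C)
    (hf : ∫ x, homDensity D C ψ x = 1) {h : ℝ → (Fin (k + 1) → Euc (m + 1)) → ℝ}
    (hh : IsLocalKernel k h) {t r : ℕ → ℝ} (ht_pos : ∀ n, 0 < t n) (ht : Tendsto t atTop atTop)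
    (hr : ∀ n, 0 < r n) {θ₁ θ₂ : Euc (m + 1)} (h1 : ‖θ₁‖ = 1) (h2 : ‖θ₂‖ = 1) (hne : θ₁ ≠ θ₂) :
    Tendsto (fun n : ℕ => (overlapIntegral
        (volume.withDensity fun x => ENNReal.ofReal (n * homDensity D C ψ x)) k ℓ
        (restrictKernel (h (r n)) (t n • supportHalfspace D θ₁))
        (restrictKernel (h (r n)) (t n • supportHalfspace D θ₂))).toReal /
      ((n * generator C ψ (t n)) ^ (2 * k + 1 - ℓ + 1) * r n ^ ((m + 1) * (2 * k + 1 - ℓ)) *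
        qFun m ψ (t n))) atTop (𝓝 0) := by
  obtain ⟨δ, hδ, hgap⟩ := hD.exists_one_add_le_gauge h1 h2 hne
  obtain ⟨M, hM⟩ := hh.bounded
  obtain ⟨κ, hκ⟩ := hh.exists_norm_le_of_overlapKernel_ne_zero hℓ hℓ0
  have hθ₁ : θ₁ ≠ 0 := by rintro rfl; simp at h1
  have hθ₂ : θ₂ ≠ 0 := by rintro rfl; simp at h2
  refine tendsto_lintegral_cluster_tail (K := fun n => overlapKernel k ℓ (h (r n)))
    (F := overlapKernel k ℓ (h 1)) (M := M * M) (κ := κ) hD hψ hC hf hδ ht_pos ht hr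
    (fun n => hh.measurable_overlapKernel (hr n).le ℓ)
    (hh.measurable_overlapKernel zero_le_one ℓ)
    (hh.overlapKernel_le zero_le_one (hM _ zero_le_one)) hκ
    (fun n => hh.overlapKernel_affine (hr n))
    (fun n w => restrictKernel_mul_restrictKernel_le fun x => hh.nonneg _ (hr n).le x) ?_ ?_
  · intro n w hw
    have hw0 := mem_inter_of_restrictKernel_mul_ne_zero hℓ hℓ0 hw
    rw [← Set.smul_set_inter₀ (ht_pos n).ne'] at hw0
    obtain ⟨z, hz, hzw⟩ := hw0
    simp only at hzw
    rw [← hzw, gauge_smul_of_nonneg (ht_pos n).le, smul_eq_mul, mul_comm]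
    exact mul_le_mul_of_nonneg_left (hgap z hz) (ht_pos n).le
  · intro n w hw i
    rcases mem_union_of_restrictKernel_mul_ne_zero hℓ hw i with hi | hi
    · exact hD.le_gauge_of_mem_smul (ht_pos n) hθ₁ hi
    · exact hD.le_gauge_of_mem_smul (ht_pos n) hθ₂ hi

end Pair

theorem tendsto_overlapIntegral_self {m k ℓ : ℕ} (hℓ : ℓ ≤ k + 1) (hℓ0 : 1 ≤ ℓ)
    {D : Set (Euc (m + 1))} {C : ℝ} {ψ : ℝ → ℝ} {θ : Euc (m + 1)}
    {A : Euc (m + 1) ≃ₗ[ℝ] Euc (m + 1)} (hA : IsInitialTransformation D θ A)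
    (hD : IsRotund D) (hψ : IsVonMises ψ) (hC : 0 < C) (hf : ∫ x, homDensity D C ψ x = 1)
    (hθ : θ ≠ 0) {h : ℝ → (Fin (k + 1) → Euc (m + 1)) → ℝ} (hh : IsLocalKernel k h)
    {t r : ℕ → ℝ} (ht_pos : ∀ n, 0 < t n) (ht : Tendsto t atTop atTop) (hr : ∀ n, 0 < r n)
    (hrt : Tendsto (fun n => r n / t n) atTop (𝓝 0)) {c : ℝ}
    (hra : Tendsto (fun n => r n / aux ψ (t n)) atTop (𝓝 c)) :
    Tendsto (fun n : ℕ => (overlapIntegral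
        (volume.withDensity fun x => ENNReal.ofReal (n * homDensity D C ψ x)) k ℓ
        (restrictKernel (h (r n)) (t n • supportHalfspace D θ))
        (restrictKernel (h (r n)) (t n • supportHalfspace D θ))).toReal /
      ((n * generator C ψ (t n)) ^ (2 * k + 1 - ℓ + 1) * r n ^ ((m + 1) * (2 * k + 1 - ℓ)) *
        qFun m ψ (t n))) atTop (𝓝 (varIntegral k ℓ h D θ A c)) := by
  obtain ⟨M, hM⟩ := hh.bounded
  obtain ⟨κ, hκ⟩ := hh.exists_norm_le_of_overlapKernel_ne_zero hℓ hℓ0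
  obtain ⟨-, hlim⟩ := tendsto_lintegral_cluster (K := fun n => overlapKernel k ℓ (h (r n)))
    (F := overlapKernel k ℓ (h 1)) (M := M * M) (κ := κ) hA hD hψ hC hf hθ ht_pos ht hr hrt hra
    (fun n => hh.measurable_overlapKernel (hr n).le ℓ)
    (hh.measurable_overlapKernel zero_le_one ℓ) (hh.overlapKernel_nonneg zero_le_one)
    (hh.overlapKernel_le zero_le_one (hM _ zero_le_one)) hκ
    (fun n => hh.overlapKernel_affine (hr n))
  rw [integral_limitIntegrand_overlapKernel hℓ] at hlim
  unfold overlapIntegral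
  simp_rw [fun n => restrictKernel_mul_restrictKernel hℓ (hh.nonneg _ (hr n).le)]
  exact hlim

theorem tendsto_integral_uStat {m k : ℕ} {D : Set (Euc (m + 1))} {C : ℝ} {ψ : ℝ → ℝ}
    {θ : Euc (m + 1)} {A : Euc (m + 1) ≃ₗ[ℝ] Euc (m + 1)} (hA : IsInitialTransformation D θ A)
    (hD : IsRotund D) (hψ : IsVonMises ψ) (hC : 0 < C) (hf : ∫ x, homDensity D C ψ x = 1)
    (hθ : θ ≠ 0) {h : ℝ → (Fin (k + 1) → Euc (m + 1)) → ℝ} (hh : IsLocalKernel k h)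
    {t r : ℕ → ℝ} (ht_pos : ∀ n, 0 < t n) (ht : Tendsto t atTop atTop) (hr : ∀ n, 0 < r n)
    (hrt : Tendsto (fun n => r n / t n) atTop (𝓝 0)) {c : ℝ}
    (hra : Tendsto (fun n => r n / aux ψ (t n)) atTop (𝓝 c))
    {Ω : ℕ → Type*} [∀ n, MeasurableSpace (Ω n)] {Pr : ∀ n, Measure (Ω n)}
    [∀ n, IsProbabilityMeasure (Pr n)] {P : ∀ n, Ω n → Set (Euc (m + 1))}
    (hP : ∀ n, IsPoissonProcess (P n)
      (volume.withDensity fun x => ENNReal.ofReal (n * homDensity D C ψ x)) (Pr n)) :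
    Tendsto (fun n => (∫ ω, uStat k (h (r n)) (P n ω ∩ t n • supportHalfspace D θ) ∂(Pr n)) /
      ((n * generator C ψ (t n)) ^ (k + 1) * r n ^ ((m + 1) * k) * qFun m ψ (t n))) atTop
      (𝓝 (meanLimit k h D θ A c)) := by
  have := isFiniteMeasure_withDensity_homDensity hf
  obtain ⟨M, hM⟩ := hh.bounded
  obtain ⟨κ, hκ⟩ := hh.exists_norm_le_of_ne_zero
  obtain ⟨hint, hlim⟩ := tendsto_lintegral_cluster (K := fun n => h (r n))
    (F := h 1) (M := M) (κ := κ) hA hD hψ hC hf hθ ht_pos ht hr hrt hra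
    (fun n => hh.measurable _ (hr n).le) (hh.measurable _ zero_le_one) (hh.nonneg _ zero_le_one)
    (hM _ zero_le_one) hκ (fun n => hh.apply_affine (hr n))
  rw [← integral_limitIntegrand_kernel h D θ A c hint]
  refine (hlim.const_mul _).congr fun n => ?_
  rw [hh.integral_uStat (hr n).le (hP n) (measurableSet_smul_supportHalfspace D (ht_pos n) θ),
    mul_div_assoc]

/-- The inverse is taken in `[0, ∞]` so that `ξ = ∞` is included, with `ξ⁻¹ = 0`. -/
theorem tendsto_div_aux {ψ : ℝ → ℝ} (hψ : IsVonMises ψ) {t r : ℕ → ℝ} (ht_pos : ∀ n, 0 < t n)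
    {ξ : ℝ≥0∞} (hξ_pos : 0 < ξ)
    (hξ : Tendsto (fun n => ENNReal.ofReal (aux ψ (t n))) atTop (𝓝 ξ)) {r' : ℝ}
    (hr : Tendsto r atTop (𝓝 r')) :
    Tendsto (fun n => r n / aux ψ (t n)) atTop (𝓝 (r' * (ξ⁻¹).toReal)) := by
  have h1 := (ENNReal.tendsto_toReal (ENNReal.inv_ne_top.2 hξ_pos.ne')).comp
    (tendsto_inv_iff.2 hξ)
  refine (hr.mul h1).congr fun n => ?_
  simp only [Function.comp]
  rw [ENNReal.toReal_inv, ENNReal.toReal_ofReal (hψ.aux_pos (ht_pos n)).le, div_eq_mul_inv]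

end Extremes

open Extremes in
theorem propositionp
    -- the dimension is `d = m + 1 ≥ 1`
    (m : ℕ) (D : Set (Euc (m + 1))) (hD : IsRotund D)
    -- the probability density `f = g ∘ γ_D` with `g = C e^{-ψ}`
    (ψ : ℝ → ℝ) (hψ : IsVonMises ψ) (C : ℝ) (hC : 0 < C)
    (hf : ∫ x, homDensity D C ψ x = 1)
    -- the kernel
    (k : ℕ) (h : ℝ → (Fin (k + 1) → Euc (m + 1)) → ℝ) (hh : IsLocalKernel k h)
    -- the sequences `t_n → ∞` with `a(t_n) → ξ ∈ (0, ∞]`, and `r_n → r ∈ [0, ∞)`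
    (t : ℕ → ℝ) (ht_pos : ∀ n, 0 < t n) (ht : Tendsto t atTop atTop)
    (ξ : ℝ≥0∞) (hξ_pos : 0 < ξ)
    (hξ : Tendsto (fun n => ENNReal.ofReal (aux ψ (t n))) atTop (𝓝 ξ))
    (r : ℕ → ℝ) (hr_pos : ∀ n, 0 < r n) (r' : ℝ) (hr : Tendsto r atTop (𝓝 r'))
    -- the Poisson processes `P_n` with intensity `n f`
    {Ω : ℕ → Type*} [∀ n, MeasurableSpace (Ω n)] (Pr : ∀ n, Measure (Ω n))
    [∀ n, IsProbabilityMeasure (Pr n)] (P : ∀ n, Ω n → Set (Euc (m + 1)))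
    (hP : ∀ n, IsPoissonProcess (P n)
      (volume.withDensity fun x => ENNReal.ofReal (n * homDensity D C ψ x)) (Pr n))
    -- `S n θ` is `S_{k,n}(θ)`
    (S : ∀ n, Euc (m + 1) → Ω n → ℝ)
    (hS : ∀ n θ ω, S n θ ω = uStat k (h (r n)) (P n ω ∩ t n • supportHalfspace D θ))
    -- `w n = n g(t_n)`, `q n = q_n`, `ν n = n g(t_n) r_n^d`
    (w q ν : ℕ → ℝ) (hw : ∀ n, w n = n * generator C ψ (t n)) (hq : ∀ n, q n = qFun m ψ (t n))
    (hν : ∀ n, ν n = w n * r n ^ (m + 1))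
    -- `I θ A ℓ = I_{k,ℓ}`
    (I : Euc (m + 1) → (Euc (m + 1) ≃ₗ[ℝ] Euc (m + 1)) → ℕ → ℝ)
    (hI : ∀ θ A ℓ, I θ A ℓ = varIntegral k ℓ h D θ A (r' * (ξ⁻¹).toReal)) :
    -- the second moments exist
    (∀ θ ∈ Metric.sphere (0 : Euc (m + 1)) 1, ∀ n, MemLp (S n θ) 2 (Pr n)) ∧
    -- expectation and variance
    (∀ θ ∈ Metric.sphere (0 : Euc (m + 1)) 1, ∀ A, IsInitialTransformation D θ A →
      Tendsto (fun n => (∫ ω, S n θ ω ∂(Pr n)) /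
          (w n ^ (k + 1) * r n ^ ((m + 1) * k) * q n)) atTop
        (𝓝 (meanLimit k h D θ A (r' * (ξ⁻¹).toReal))) ∧
      (Tendsto ν atTop (𝓝 0) →
        Tendsto (fun n => variance (S n θ) (Pr n) /
            (w n ^ (k + 1) * r n ^ ((m + 1) * k) * q n)) atTop
          (𝓝 (I θ A (k + 1) / (k + 1)!))) ∧
      (∀ χ : ℝ, 0 < χ → Tendsto ν atTop (𝓝 χ) →
        Tendsto (fun n => variance (S n θ) (Pr n) / (w n * q n)) atTop
          (𝓝 (∑ ℓ ∈ Finset.Icc 1 (k + 1),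
            χ ^ (2 * k + 1 - ℓ) * I θ A ℓ / (ℓ ! * ((k + 1 - ℓ)! : ℝ) ^ 2)))) ∧
      (Tendsto ν atTop atTop →
        Tendsto (fun n => variance (S n θ) (Pr n) /
            (w n ^ (2 * k + 1) * r n ^ (2 * (m + 1) * k) * q n)) atTop
          (𝓝 (I θ A 1 / (k ! : ℝ) ^ 2)))) ∧
    -- covariance at angles that are neither equal nor opposite
    (∀ θ₁ ∈ Metric.sphere (0 : Euc (m + 1)) 1, ∀ θ₂ ∈ Metric.sphere (0 : Euc (m + 1)) 1,
      θ₁ ≠ θ₂ → θ₁ ≠ -θ₂ →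
      (Tendsto ν atTop (𝓝 0) →
        Tendsto (fun n => covariance (S n θ₁) (S n θ₂) (Pr n) /
          (w n ^ (k + 1) * r n ^ ((m + 1) * k) * q n)) atTop (𝓝 0)) ∧
      (∀ χ : ℝ, 0 < χ → Tendsto ν atTop (𝓝 χ) →
        Tendsto (fun n => covariance (S n θ₁) (S n θ₂) (Pr n) / (w n * q n)) atTop (𝓝 0)) ∧
      (Tendsto ν atTop atTop →
        Tendsto (fun n => covariance (S n θ₁) (S n θ₂) (Pr n) /
          (w n ^ (2 * k + 1) * r n ^ (2 * (m + 1) * k) * q n)) atTop (𝓝 0))) ∧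
    -- covariance at opposite angles
    (∀ θ₁ ∈ Metric.sphere (0 : Euc (m + 1)) 1, ∀ θ₂ ∈ Metric.sphere (0 : Euc (m + 1)) 1,
      θ₁ = -θ₂ → ∀ n, covariance (S n θ₁) (S n θ₂) (Pr n) = 0) := by
  have hfin := isFiniteMeasure_withDensity_homDensity hf
  have hS' : ∀ n θ, S n θ = fun ω => uStat k (h (r n)) (P n ω ∩ t n • supportHalfspace D θ) :=
    fun n θ => funext (hS n θ)
  have hmeas := fun n θ => measurableSet_smul_supportHalfspace D (ht_pos n) θ
  have hmem : ∀ θ n, MemLp (S n θ) 2 (Pr n) := by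
    intro θ n
    rw [hS']
    exact hh.memLp_uStat (hr_pos n).le (hP n) (hmeas n θ)
  have hcov : ∀ θ₁ θ₂ n, covariance (S n θ₁) (S n θ₂) (Pr n) =
      ∑ ℓ ∈ Finset.Icc 1 (k + 1), ((ℓ ! : ℝ) * ((k + 1 - ℓ)! : ℝ) ^ 2)⁻¹ *
        (overlapIntegral (volume.withDensity fun x => ENNReal.ofReal (n * homDensity D C ψ x)) k ℓ
          (restrictKernel (h (r n)) (t n • supportHalfspace D θ₁))
          (restrictKernel (h (r n)) (t n • supportHalfspace D θ₂))).toReal := by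
    intro θ₁ θ₂ n
    rw [hS', hS']
    exact hh.covariance_uStat (hr_pos n).le (hP n) (hmeas n θ₁) (hmeas n θ₂)
  have hne : ∀ θ ∈ Metric.sphere (0 : Euc (m + 1)) 1, θ ≠ 0 :=
    fun θ hθ => ne_zero_of_mem_unit_sphere ⟨θ, hθ⟩
  have hrt : Tendsto (fun n => r n / t n) atTop (𝓝 0) := hr.div_atTop ht
  have hra := tendsto_div_aux hψ ht_pos hξ_pos hξ hr
  have hw0 : ∀ᶠ n in atTop, 0 < w n := by
    filter_upwards [eventually_gt_atTop 0] with n hn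
    have := generator_pos hC ψ (t n)
    rw [hw]
    positivity
  have hq0 : ∀ n, 0 < q n := fun n => by
    rw [hq]
    exact qFun_pos hψ (ht_pos n)
  refine ⟨fun θ _ n => hmem θ n, fun θ hθ A hA => ?_, fun θ₁ hθ₁ θ₂ hθ₂ hθ _ => ?_,
    fun θ₁ hθ₁ θ₂ hθ₂ hθ n => ?_⟩
  · have hvar : ∀ n, variance (S n θ) (Pr n) = _ := fun n =>
      (covariance_self (hmem θ n).aemeasurable).symm.trans (hcov θ θ n)
    have hJ := fun ℓ (hℓ : ℓ ∈ Finset.Icc 1 (k + 1)) =>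
      tendsto_overlapIntegral_self (Finset.mem_Icc.1 hℓ).2 (Finset.mem_Icc.1 hℓ).1 hA hD hψ hC hf
        (hne θ hθ) hh ht_pos ht hr_pos hrt hra
    simp_rw [← hw, ← hq, ← hI] at hJ
    refine ⟨?_, tendsto_div_of_tendsto_zero hw0 hr_pos hq0 hν hvar hJ,
      fun χ _ => tendsto_div_of_tendsto_pos hw0 hr_pos hq0 hν hvar hJ,
      tendsto_div_of_tendsto_atTop hw0 hr_pos hq0 hν hvar hJ⟩
    simp_rw [hS', hw, hq]
    exact tendsto_integral_uStat hA hD hψ hC hf (hne θ hθ) hh ht_pos ht hr_pos hrt hra hP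
  · have hJ := fun ℓ (hℓ : ℓ ∈ Finset.Icc 1 (k + 1)) =>
      tendsto_overlapIntegral_of_ne (Finset.mem_Icc.1 hℓ).2 (Finset.mem_Icc.1 hℓ).1 hD hψ hC hf
        hh ht_pos ht hr_pos (mem_sphere_zero_iff_norm.1 hθ₁) (mem_sphere_zero_iff_norm.1 hθ₂) hθ
    simp_rw [← hw, ← hq] at hJ
    -- The analysis of the regimes uses only the orders of the overlaps, so it applies to the
    -- covariance with all limits `I ℓ` equal to zero.
    refine ⟨fun h0 => ?_, fun χ _ hχ => ?_, fun htop => ?_⟩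
    · simpa using tendsto_div_of_tendsto_zero (I := fun _ => 0) hw0 hr_pos hq0 hν (hcov θ₁ θ₂) hJ h0
    · simpa using tendsto_div_of_tendsto_pos (I := fun _ => 0) hw0 hr_pos hq0 hν (hcov θ₁ θ₂) hJ hχ
    · simpa using
        tendsto_div_of_tendsto_atTop (I := fun _ => 0) hw0 hr_pos hq0 hν (hcov θ₁ θ₂) hJ htop
  · rw [hcov]
    refine Finset.sum_eq_zero fun ℓ hℓ => ?_
    rw [hθ, overlapIntegral_eq_zero_of_disjoint _ (Finset.mem_Icc.1 hℓ).2 (Finset.mem_Icc.1 hℓ).1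
      (hD.disjoint_smul_supportHalfspace_neg (ht_pos n) (hne θ₂ hθ₂)).symm, ENNReal.toReal_zero,
      mul_zero]
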